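/- Let $n\in\{2,3\}$, $L,T,\sigma>0$, $Q=(0,L]^n$. All functions are $L$-periodic in each space coordinate. For a force $f=f(t,x)\in\mathbf R^n$ ($C^2$ in $x$) and a terminal field $\varphi$, a *classical solution on $[0,T']$* of the Navier–Stokes problem with negative direction of time is a pair $(u,p)$ with $$\frac{\partial u}{\partial t}+\frac{\sigma^2}{2}\Delta u-(u,\nabla)u-\nabla p+f=0\ (0\le t<T'),\qquad \operatorname{div}u=0,\qquad u(T',\cdot)=\varphi,$$ with $\int_Q u(t,x)\,dx=0$ for all $t$, $u\in C^3([0,T']\times\mathbf R^n)$ and $p(t,\cdot)\in C^2$. For a vorticity $\omega$ with Fourier coefficients $\omega_{\mathbf m}=L^{-n}\int_Q\omega(x)e^{-i(2\pi/L)(\mathbf m,x)}dx$ let $U\omega$ be the periodic Biot–Savart velocity $$U\omega(x)=\frac{iL}{2\pi}\sum_{\mathbf m\in\mathbf Z^n,\ \mathbf m\ne0}\frac{e^{i(2\pi/L)(\mathbf m,x)}}{|\mathbf m|^2}\,\mathbf m\times\omega_{\mathbf m},\qquad \mathbf m\times\omega_{\mathbf m}:=\omega_{\mathbf m}(m_2,-m_1)^\top\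 \text{ if } n=2 ,$$ where for $n=2$ the vorticity $\omega$ is a scalar and $\operatorname{curl}u=\partial_1u^2-\partial_2u^1$. Let $N\ge1$, $h=T/N$, $t_k=kh$. An approximation with frozen velocity consists of $\tilde\omega_k\in C^3([t_k,t_{k+1}]\times\mathbf R^n)$, $k=N-1,\dots,0$, such that, with $\hat u_k:=U\tilde\omega_k(t_{k+1},\cdot)$, $$\frac{\partial\tilde\omega_k}{\partial t}+\frac{\sigma^2}{2}\Delta\tilde\omega_k-(\hat u_k,\nabla)\tilde\omega_k+(\tilde\omega_k,\nabla)\hat u_k+\operatorname{curl}f=0,\qquad t_k\le t<t_{k+1}$$ (without the term $(\tilde\omega_k,\nabla)\hat u_k$ if $n=2$), $\tilde\omega_{N-1}(t_N,\cdot)=\operatorname{curl}\varphi$ and $\tilde\omega_k(t_{k+1},\cdot)=\tilde\omega_{k+1}(t_{k+1},\cdot)$ for $k\le N-2$. The velocity approximation is $\tilde u(t,\cdot)=U\tilde\omega_k(t,\cdot)$ for $t_k\le t\le t_{k+1}$. **Theorem.** For every $M$ there is a constant $K$, depending only on $n,L,T,\sigma,M$, with the following property. Let $(u,p)$ be a classical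 solution on $[0,T]$ with force $f$ and terminal field $\varphi$, let $N\ge1$, and let $\tilde\omega_k$, $0\le k<N$, be an approximation with frozen velocity. Assume that for every $k=1,\dots,N$ the Navier–Stokes problem on $[0,t_k]$ with the same force $f$ and the terminal field $\tilde u(t_k,\cdot)$ has a classical solution ${}_ku$ whose derivatives in $(t,x)$ of orders $0,1,2$ are bounded by $M$ on $[0,t_k]\times\mathbf R^n$. Then $\tilde u$ is of first order in $h$ in the $L^2$-norm: $$\|u(t,\cdot)-\tilde u(t,\cdot)\|_{L^2(Q)}\le K h\qquad\text{for all } t\in[0,T].$$ -/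

import Mathlib

open MeasureTheory Set

noncomputable section

namespace PeriodicNSE

/-- The Euclidean space of dimension `n` (with the Euclidean norm). -/
abbrev E (n : ℕ) : Type := EuclideanSpace ℝ (Fin n)

/-! ### Periodic fields and differential operators in space -/

/-- Periodicity with period `L` in every coordinate direction. -/
def SpacePeriodic {n : ℕ} {F : Type*} (L : ℝ) (v : E n → F) : Prop :=
  ∀ (x : E n) (i : Fin n), v (x + L • EuclideanSpace.single i (1 : ℝ)) = v x

/-- The cube of periods `(0, L]ⁿ`. -/
def cell (n : ℕ) (L : ℝ) : Set (E n) := {x | ∀ i, x i ∈ Ioc 0 L}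

/-- The partial derivative of the `j`-th component of `v` in the `i`-th direction. -/
def partialD {n : ℕ} (i j : Fin n) (v : E n → E n) (x : E n) : ℝ :=
  fderiv ℝ (fun y => v y j) x (EuclideanSpace.single i (1 : ℝ))

/-- The divergence of a vector field. -/
def divergence {n : ℕ} (v : E n → E n) (x : E n) : ℝ := ∑ i, partialD i i v x

/-- The (scalar) curl of a planar vector field. -/
def curl2 (v : E 2 → E 2) (x : E 2) : ℝ := partialD 0 1 v x - partialD 1 0 v x

/-- The curl of a vector field in dimension three. -/
def curl3 (v : E 3 → E 3) (x : E 3) : E 3 :=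
  !₂[partialD 1 2 v x - partialD 2 1 v x,
     partialD 2 0 v x - partialD 0 2 v x,
     partialD 0 1 v x - partialD 1 0 v x]

/-- The directional derivative `(a, ∇) v` of the field `v` along the field `a`. -/
def advect {n : ℕ} {F : Type*} [NormedAddCommGroup F] [NormedSpace ℝ F]
    (a : E n → E n) (v : E n → F) (x : E n) : F := fderiv ℝ v x (a x)

/-! ### Fourier series and the periodic Biot-Savart law -/

/-- The Fourier mode `exp (i (2π/L) (m, x))`. -/
def mode {n : ℕ} (L : ℝ) (m : Fin n → ℤ) (x : E n) : ℂ :=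
  Complex.exp (Complex.I * ((2 * Real.pi / L * ∑ i, (m i : ℝ) * x i : ℝ) : ℂ))

/-- The Fourier coefficient `L⁻ⁿ ∫ g(x) exp (-i (2π/L) (m, x)) dx` over the cube of periods. -/
def coeff {n : ℕ} (L : ℝ) (g : E n → ℝ) (m : Fin n → ℤ) : ℂ :=
  ((1 / L ^ n : ℝ) : ℂ) * ∫ x in cell n L, (g x : ℂ) * mode L (-m) x

/-- The squared length `|m|²` of a wave vector. -/
def normSqZ {n : ℕ} (m : Fin n → ℤ) : ℝ := ∑ i, (m i : ℝ) ^ 2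

/-- The series `(i L / 2π) ∑_m |m|⁻² c_m exp (i (2π/L) (m, x))`. In the uses below `c 0 = 0`, so the
sum runs over `m ≠ 0`, and the sum is real, so that taking the real part loses nothing. -/
def potentialSeries {n : ℕ} (L : ℝ) (c : (Fin n → ℤ) → ℂ) (x : E n) : ℝ :=
  (Complex.I * ((L / (2 * Real.pi) : ℝ) : ℂ) *
    ∑' m : Fin n → ℤ, ((1 / normSqZ m : ℝ) : ℂ) * mode L m x * c m).re

/-- The velocity `U ω` of a scalar vorticity in dimension two. -/
def biotSavart2 (L : ℝ) (ω : E 2 → ℝ) (x : E 2) : E 2 :=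
  !₂[potentialSeries L (fun m => coeff L ω m * (m 1 : ℂ)) x,
     -potentialSeries L (fun m => coeff L ω m * (m 0 : ℂ)) x]

/-- The velocity `U ω` of a vorticity field in dimension three. -/
def biotSavart3 (L : ℝ) (ω : E 3 → E 3) (x : E 3) : E 3 :=
  !₂[potentialSeries L (fun m =>
        coeff L (fun y => ω y 2) m * (m 1 : ℂ) - coeff L (fun y => ω y 1) m * (m 2 : ℂ)) x,
     potentialSeries L (fun m =>
        coeff L (fun y => ω y 0) m * (m 2 : ℂ) - coeff L (fun y => ω y 2) m * (m 0 : ℂ)) x,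
     potentialSeries L (fun m =>
        coeff L (fun y => ω y 1) m * (m 0 : ℂ) - coeff L (fun y => ω y 0) m * (m 1 : ℂ)) x]

/-! ### The Navier-Stokes equations with negative direction of time -/

/-- `(u, p)` is a (sufficiently smooth) classical solution on `[0, T]`, with zero space average, of
`∂u/∂t + (σ²/2) Δu - (u, ∇)u - ∇p + f = 0`, `div u = 0`, `u(T, ·) = φ`, periodic in space. -/
structure IsNSESolution {n : ℕ} (L σ T : ℝ) (f : ℝ → E n → E n) (φ : E n → E n)
    (u : ℝ → E n → E n) (p : ℝ → E n → ℝ) : Prop where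
  smooth : ContDiffOn ℝ 3 (fun z : ℝ × E n => u z.1 z.2) (Icc 0 T ×ˢ univ)
  smooth_pressure : ∀ t ∈ Ico 0 T, ContDiff ℝ 2 (p t)
  periodic : ∀ t ∈ Icc 0 T, SpacePeriodic L (u t)
  periodic_pressure : ∀ t ∈ Ico 0 T, SpacePeriodic L (p t)
  momentum : ∀ t ∈ Ico 0 T, ∀ x : E n,
    HasDerivWithinAt (fun s => u s x)
      (-((σ ^ 2 / 2) • Laplacian.laplacian (u t) x) + advect (u t) (u t) x
        + gradient (p t) x - f t x) (Icc 0 T) t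
  incompressible : ∀ t ∈ Icc 0 T, ∀ x : E n, divergence (u t) x = 0
  zero_average : ∀ t ∈ Icc 0 T, ∫ x in cell n L, u t x = 0
  terminal : u T = φ

/-- All derivatives in `(t, x)` of order at most two are bounded by `M` on `[0, T] × ℝⁿ`. -/
def DerivativesBoundedBy {n : ℕ} (M T : ℝ) (v : ℝ → E n → E n) : Prop :=
  ∀ j : ℕ, j ≤ 2 → ∀ z ∈ (Icc 0 T ×ˢ univ : Set (ℝ × E n)),
    ‖iteratedFDerivWithin ℝ j (fun z : ℝ × E n => v z.1 z.2) (Icc 0 T ×ˢ univ) z‖ ≤ M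

/-! ### The approximation with frozen velocity -/

/-- The node `t_k = k h`, `h = T / N`, of the uniform partition. -/
def node (T : ℝ) (N k : ℕ) : ℝ := k * (T / N)

/-- Dimension two: for `k < N`, `w k` is the approximation of the vorticity on `[t_k, t_{k+1}]`,
obtained backwards from `curl φ` by freezing the velocity at `U (w k t_{k+1})`. -/
structure IsVorticityApprox2 (L σ T : ℝ) (N : ℕ) (f : ℝ → E 2 → E 2) (φ : E 2 → E 2)
    (w : ℕ → ℝ → E 2 → ℝ) : Prop where
  smooth : ∀ k < N, ContDiffOn ℝ 3 (fun z : ℝ × E 2 => w k z.1 z.2)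
    (Icc (node T N k) (node T N (k + 1)) ×ˢ univ)
  periodic : ∀ k < N, ∀ t ∈ Icc (node T N k) (node T N (k + 1)), SpacePeriodic L (w k t)
  equation : ∀ k < N, ∀ t ∈ Ico (node T N k) (node T N (k + 1)), ∀ x : E 2,
    HasDerivWithinAt (fun s => w k s x)
      (-((σ ^ 2 / 2) * Laplacian.laplacian (w k t) x)
        + advect (biotSavart2 L (w k (node T N (k + 1)))) (w k t) x
        - curl2 (f t) x) (Icc (node T N k) (node T N (k + 1))) t
  terminal : w (N - 1) (node T N N) = curl2 φ
  matching : ∀ k, k + 1 < N → w k (node T N (k + 1)) = w (k + 1) (node T N (k + 1))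

/-- Dimension three: for `k < N`, `w k` is the approximation of the vorticity on `[t_k, t_{k+1}]`,
obtained backwards from `curl φ` by freezing the velocity at `U (w k t_{k+1})`. -/
structure IsVorticityApprox3 (L σ T : ℝ) (N : ℕ) (f : ℝ → E 3 → E 3) (φ : E 3 → E 3)
    (w : ℕ → ℝ → E 3 → E 3) : Prop where
  smooth : ∀ k < N, ContDiffOn ℝ 3 (fun z : ℝ × E 3 => w k z.1 z.2)
    (Icc (node T N k) (node T N (k + 1)) ×ˢ univ)
  periodic : ∀ k < N, ∀ t ∈ Icc (node T N k) (node T N (k + 1)), SpacePeriodic L (w k t)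
  equation : ∀ k < N, ∀ t ∈ Ico (node T N k) (node T N (k + 1)), ∀ x : E 3,
    HasDerivWithinAt (fun s => w k s x)
      (-((σ ^ 2 / 2) • Laplacian.laplacian (w k t) x)
        + advect (biotSavart3 L (w k (node T N (k + 1)))) (w k t) x
        - advect (w k t) (biotSavart3 L (w k (node T N (k + 1)))) x
        - curl3 (f t) x) (Icc (node T N k) (node T N (k + 1))) t
  terminal : w (N - 1) (node T N N) = curl3 φ
  matching : ∀ k, k + 1 < N → w k (node T N (k + 1)) = w (k + 1) (node T N (k + 1))

end PeriodicNSE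

end

open MeasureTheory Set

set_option linter.unusedSectionVars false

noncomputable section

namespace PeriodicNSE

local notation "⟪" x "," y "⟫" => inner ℝ x y

/-! ### Integration over the cell of periods -/

section

/-! The argument is the usual one for one-step methods: consistency of order `h²` per step, combined
with stability of the exact flow. On the step `[t_k, t_{k+1}]` let `v_k` be the exact solution on
`[0, t_{k+1}]` whose terminal value is the approximate velocity at `t_{k+1}`. Then `u - ũ` on this
step telescopes as `(u - v_{N-1}) + ∑ (v_{j+1} - v_j) + (v_k - ũ)`, with `k ≤ j < N - 1`. The first
term vanishes in `L²` because `U (curl φ) = φ`. Each middle term is the one-step error at `t_{j+1}`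
carried backwards by the exact flow. The last term is a one-step error. There are at most `N = T /
h` contributions of size `h²`.

Stability (`stability`) is an energy estimate. The difference of two exact solutions is transported
by one of them and stretched by the gradient of the other, so a bound on one gradient suffices and
nothing quantitative is needed about `u`. Pressures are orthogonal to divergence-free fields.

Consistency (`local_error`) is an energy estimate for the vorticity. The defect `curl v_k - w_k`
satisfies a transport-diffusion equation whose residual involves only `v_k(t) - v_k(t_{k+1})` and
its gradient, hence is `O(h)`; over a step of length `h` from zero terminal data this yields `O(h²)`
in `L²`. No bound on the approximation `w` enters. The Biot-Savart operator maps an `L²` vorticity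
defect to an `L²` velocity defect (`integral_sq_sub_biotSavart2_le`,
`integral_sq_sub_biotSavart3_le`), by Parseval.

The terminal defect is zero only if `curl (U w) = w` at the nodes. This holds when `w` has zero mean
and, in dimension three, zero divergence. Both properties hold for `curl φ` and propagate through
the frozen equations (`integral_eq_zero_of_frozen`, `divergence_eq_zero_of_frozen`).

The two dimensions are treated together in `global_error`: a curl is a linear map `C` of the
Jacobian that kills symmetric matrices, and the stretching term is a bilinear `B` with `C (A²) = -B
(C A) A` for traceless `A`. -/

/-- The `i`-th vector of the standard basis. -/
abbrev bv {n : ℕ} (i : Fin n) : E n := EuclideanSpace.single i (1 : ℝ)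

variable {n : ℕ} {L : ℝ} {F : Type*} [NormedAddCommGroup F] [NormedSpace ℝ F]

lemma measurableSet_cell : MeasurableSet (cell n L) := by
  have : cell n L = (WithLp.ofLp : E n → (Fin n → ℝ)) ⁻¹' (univ.pi fun _ => Ioc 0 L) := by
    ext x; simp [cell]
  rw [this]
  exact (PiLp.volume_preserving_ofLp (Fin n)).measurable
    (MeasurableSet.univ_pi fun _ => measurableSet_Ioc)

lemma cell_ae_eq : (cell n L) =ᵐ[volume]
    ((WithLp.ofLp : E n → (Fin n → ℝ)) ⁻¹' (Icc 0 (fun _ => L))) := by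
  have : cell n L = (WithLp.ofLp : E n → (Fin n → ℝ)) ⁻¹' (univ.pi fun _ => Ioc 0 L) := by
    ext x; simp [cell]
  rw [this]
  exact (PiLp.volume_preserving_ofLp (Fin n)).quasiMeasurePreserving.preimage_ae_eq
    (Measure.univ_pi_Ioc_ae_eq_Icc (f := (0 : Fin n → ℝ)) (g := fun _ => L))

/-- The closed cube of periods. -/
def closedCell (n : ℕ) (L : ℝ) : Set (E n) := {x | ∀ i, x i ∈ Icc 0 L}

lemma closedCell_eq : closedCell n L =
    (WithLp.toLp 2 : (Fin n → ℝ) → E n) '' (Icc 0 (fun _ => L)) := by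
  ext x
  constructor
  · intro h
    exact ⟨WithLp.ofLp x, ⟨fun i => (h i).1, fun i => (h i).2⟩, rfl⟩
  · rintro ⟨y, hy, rfl⟩ i
    exact ⟨hy.1 i, hy.2 i⟩

lemma isCompact_closedCell : IsCompact (closedCell n L) := by
  rw [closedCell_eq]
  exact isCompact_Icc.image (PiLp.continuous_toLp 2 _)

lemma cell_subset_closedCell : cell n L ⊆ closedCell n L := fun _ hx i => Ioc_subset_Icc_self (hx i)

lemma volume_cell_lt_top : volume (cell n L) < ⊤ :=
  (measure_mono cell_subset_closedCell).trans_lt isCompact_closedCell.measure_lt_top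

instance : IsFiniteMeasure (volume.restrict (cell n L) : Measure (E n)) :=
  ⟨by simpa using volume_cell_lt_top⟩

lemma integrableOn_cell {g : E n → F} (hg : Continuous g) : IntegrableOn g (cell n L) :=
  (hg.continuousOn.integrableOn_compact isCompact_closedCell).mono_set cell_subset_closedCell

lemma integral_cell_eq (g : E n → F) :
    ∫ x in cell n L, g x = ∫ y in Icc (0 : Fin n → ℝ) (fun _ => L), g (WithLp.toLp 2 y) := by
  rw [setIntegral_congr_set cell_ae_eq]
  have := (PiLp.volume_preserving_ofLp (Fin n)).setIntegral_preimage_emb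
    (MeasurableEquiv.toLp 2 (Fin n → ℝ)).symm.measurableEmbedding (fun y => g (WithLp.toLp 2 y))
    (Icc 0 (fun _ => L))
  simpa using this

lemma volume_cell (hL : 0 ≤ L) : volume.real (cell n L) = L ^ n := by
  have := integral_cell_eq (n := n) (L := L) (fun _ => (1 : ℝ))
  simp only [integral_const, smul_eq_mul, mul_one, measureReal_restrict_apply_univ] at this
  rw [this, measureReal_def,
    Real.volume_Icc_pi_toReal (a := (0 : Fin n → ℝ)) (b := fun _ => L) (fun _ => hL)]
  simp

/-- Divergence theorem on the cube for the field whose only nonzero component is the `i`-th, equal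
to `g`: the contributions of the two faces orthogonal to direction `i` cancel by periodicity. -/
theorem integral_partial_eq_zero (hL : 0 ≤ L) [CompleteSpace F] {g : E n → F} (hg : ContDiff ℝ 1 g)
    (hp : SpacePeriodic L g) (i : Fin n) :
    ∫ x in cell n L, fderiv ℝ g x (bv i) = 0 := by
  obtain _ | n := n
  · exact i.elim0
  rw [integral_cell_eq]
  let e : (Fin (n + 1) → ℝ) →L[ℝ] E (n + 1) :=
    (EuclideanSpace.equiv (Fin (n + 1)) ℝ).symm.toContinuousLinearMap
  have key := integral_divergence_of_hasFDerivAt_off_countable' (E := F)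
    (0 : Fin (n + 1) → ℝ) (fun _ => L) (fun _ => hL)
    (fun j y => if j = i then g (e y) else 0)
    (fun j y => if j = i then (fderiv ℝ g (e y)).comp e else 0) ∅ countable_empty
    (by
      intro j
      by_cases h : j = i
      · simp only [h, if_true]
        exact (hg.continuous.comp e.continuous).continuousOn
      · simp only [h, if_false]; exact continuousOn_const)
    (by
      intro x _ j
      by_cases h : j = i
      · simp only [h, if_true]
        exact ((hg.differentiable one_ne_zero) (e x)).hasFDerivAt.comp x e.hasFDerivAt
      · simp only [h, if_false]; exact hasFDerivAt_const _ _)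
    (by
      refine Continuous.integrableOn_Icc ?_
      refine continuous_finsetSum _ fun j _ => ?_
      by_cases h : j = i
      · simp only [h, if_true]
        exact (((hg.continuous_fderiv one_ne_zero).comp e.continuous).clm_comp
          continuous_const).clm_apply continuous_const
      · simp only [h, if_false]; exact continuous_const)
  have h1 : ∀ y : Fin (n + 1) → ℝ, (∑ j, (if j = i then (fderiv ℝ g (e y)).comp e else 0)
      (Pi.single j (1 : ℝ))) = fderiv ℝ g (WithLp.toLp 2 y) (bv i) := by
    intro y
    rw [Finset.sum_eq_single i]
    · simp only [if_true, ContinuousLinearMap.comp_apply]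
      rfl
    · intro j _ hj; simp [hj]
    · simp
  simp only [h1] at key
  rw [key]
  refine Finset.sum_eq_zero fun j _ => ?_
  by_cases h : j = i
  · subst h
    simp only [if_true]
    rw [sub_eq_zero]
    congr 1
    ext y
    -- The faces `x_j = L` and `x_j = 0` differ by one period.
    have : e (j.insertNth L y) = e (j.insertNth 0 y) + L • bv j := by
      ext k
      refine j.succAboveCases ?_ (fun k => ?_) k
      · simp [e]
      · simp [e]
    simp only [Pi.zero_apply]
    rw [this, hp]
  · simp [h]

/-! ### Periodic fields -/

section Periodic

variable {G : Type*}

lemma SpacePeriodic.comp {v : E n → G} (hv : SpacePeriodic L v) {H : Type*} (f : G → H) :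
    SpacePeriodic L (fun x => f (v x)) := fun x i => by simp only [hv x i]

lemma SpacePeriodic.comp₂ {G' : Type*} {v : E n → G} {w : E n → G'} (hv : SpacePeriodic L v)
    (hw : SpacePeriodic L w) {H : Type*} (f : G → G' → H) :
    SpacePeriodic L (fun x => f (v x) (w x)) := fun x i => by simp only [hv x i, hw x i]

lemma SpacePeriodic.add_int_smul {v : E n → G} (hv : SpacePeriodic L v) (x : E n) (i : Fin n)
    (k : ℤ) : v (x + (k * L) • bv i) = v x := by
  have hnat : ∀ (x : E n) (k : ℕ), v (x + ((k : ℝ) * L) • bv i) = v x := by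
    intro x k
    induction k with
    | zero => simp
    | succ k ih =>
      rw [← ih, ← hv (x + ((k : ℝ) * L) • bv i) i]
      congr 1
      push_cast
      module
  obtain ⟨k, rfl | rfl⟩ := k.eq_nat_or_neg
  · simp [hnat x k]
  · rw [← hnat _ k]
    congr 1
    push_cast
    module

lemma SpacePeriodic.add_lattice {v : E n → G} (hv : SpacePeriodic L v) (x : E n) (k : Fin n → ℤ) :
    v (x + ∑ i, ((k i : ℝ) * L) • bv i) = v x := by
  have : ∀ s : Finset (Fin n), v (x + ∑ i ∈ s, ((k i : ℝ) * L) • bv i) = v x := by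
    intro s
    induction s using Finset.induction_on with
    | empty => simp
    | insert a s ha ih =>
      rw [Finset.sum_insert ha, ← ih, add_comm (((k a : ℝ) * L) • bv a), ← add_assoc]
      exact hv.add_int_smul _ a (k a)
  exact this _

lemma SpacePeriodic.fderiv {v : E n → F} (hv : SpacePeriodic L v) :
    SpacePeriodic L (fderiv ℝ v) := by
  intro x i
  rw [← fderiv_comp_add_right]
  congr 1
  ext y
  exact hv y i

lemma SpacePeriodic.eq_of_sub_int_mul {v : E n → G} (hv : SpacePeriodic L v) {x y : E n}
    (h : ∀ i, ∃ k : ℤ, y i = x i + k * L) : v y = v x := by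
  choose k hk using h
  rw [← hv.add_lattice x k]
  congr 1
  ext i
  simp [hk, Finset.sum_apply, Pi.single_apply]

end Periodic

/-- The translate of a point into the half-open cell of periods. -/
lemma exists_mem_cell (hL : 0 < L) (x : E n) : ∃ y ∈ cell n L, ∀ i, ∃ k : ℤ, x i = y i + k * L := by
  refine ⟨WithLp.toLp 2 fun i => toIocMod hL 0 (x i), fun i => ?_, fun i => ⟨toIocDiv hL 0 (x i), ?_⟩⟩
  · simpa using toIocMod_mem_Ioc hL 0 (x i)
  · have := toIocMod_add_toIocDiv_zsmul hL 0 (x i)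
    simp only [zsmul_eq_mul] at this
    simp

/-! ### Integration by parts -/

/-- The derivative in a fixed direction. -/
def dirD (e : E n) (g : E n → F) (x : E n) : F := fderiv ℝ g x e

lemma dirD_contDiff {k : WithTop ℕ∞} {m : WithTop ℕ∞} {g : E n → F} (hg : ContDiff ℝ m g)
    (h : k + 1 ≤ m) (e : E n) : ContDiff ℝ k (dirD e g) :=
  (hg.fderiv_right h).clm_apply contDiff_const

lemma SpacePeriodic.dirD {v : E n → F} (hv : SpacePeriodic L v) (e : E n) :
    SpacePeriodic L (dirD e v) := hv.fderiv.comp (fun A => A e)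

lemma fderiv_fderiv_symm {g : E n → F} (hg : ContDiff ℝ 2 g) (x a b : E n) :
    fderiv ℝ (fderiv ℝ g) x a b = fderiv ℝ (fderiv ℝ g) x b a :=
  (hg.contDiffAt.isSymmSndFDerivAt (by simp)).eq a b

lemma fderiv_dirD {g : E n → F} (hg : ContDiff ℝ 2 g) (x e h : E n) :
    fderiv ℝ (dirD e g) x h = fderiv ℝ (fderiv ℝ g) x h e := by
  have h1 : DifferentiableAt ℝ (fderiv ℝ g) x :=
    (hg.fderiv_right (m := 1) (by norm_num)).differentiable one_ne_zero x
  have := (h1.hasFDerivAt.clm_apply (hasFDerivAt_const e x)).fderiv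
  change fderiv ℝ (fun y => fderiv ℝ g y e) x h = _
  rw [this]
  simp

lemma laplacian_eq_sum {g : E n → F} (hg : ContDiff ℝ 2 g) (x : E n) :
    Laplacian.laplacian g x = ∑ i, dirD (bv i) (dirD (bv i) g) x := by
  have := congrFun (InnerProductSpace.laplacian_eq_iteratedFDeriv_orthonormalBasis g
    (EuclideanSpace.basisFun (Fin n) ℝ)) x
  rw [this]
  refine Finset.sum_congr rfl fun i _ => ?_
  rw [iteratedFDeriv_two_apply]
  unfold dirD
  rw [show fderiv ℝ (fun x => fderiv ℝ g x (bv i)) x (bv i) = _ from fderiv_dirD hg x _ _]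
  simp

variable [CompleteSpace F]

lemma sum_coord_bv (a : E n) : ∑ i, a i • bv i = a := by
  ext j
  simp [Pi.single_apply]

lemma fderiv_apply_eq_sum (g : E n → F) (x a : E n) :
    fderiv ℝ g x a = ∑ i, a i • fderiv ℝ g x (bv i) := by
  conv_lhs => rw [← sum_coord_bv a]
  simp

lemma partialD_eq {v : E n → E n} (hv : ContDiff ℝ 1 v) (i j : Fin n) (x : E n) :
    partialD i j v x = (fderiv ℝ v x (bv i)) j := by
  have h := ((EuclideanSpace.proj j : E n →L[ℝ] ℝ).hasFDerivAt.comp x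
    ((hv.differentiable one_ne_zero) x).hasFDerivAt).fderiv
  unfold partialD
  exact congrArg (fun A => A (bv i)) h

/-- Since `div a = 0`, the integrand is the full divergence `∑ ∂ᵢ (aᵢ g)`. -/
theorem integral_advect_eq_zero (hL : 0 ≤ L) {a : E n → E n} {g : E n → F} (ha : ContDiff ℝ 1 a)
    (hg : ContDiff ℝ 1 g) (hap : SpacePeriodic L a) (hgp : SpacePeriodic L g)
    (hdiv : ∀ x, divergence a x = 0) : ∫ x in cell n L, advect a g x = 0 := by
  have hai : ∀ i, ContDiff ℝ 1 (fun x => a x i) := fun i => by fun_prop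
  have hcomp : ∀ i, ContDiff ℝ 1 (fun x => a x i • g x) := fun i => (hai i).smul hg
  have h1 : ∀ x, advect a g x = ∑ i, fderiv ℝ (fun x => a x i • g x) x (bv i) := by
    intro x
    have h2 : ∀ i, fderiv ℝ (fun x => a x i • g x) x (bv i)
        = a x i • fderiv ℝ g x (bv i) + partialD i i a x • g x := by
      intro i
      have := ((((hai i).differentiable one_ne_zero) x).hasFDerivAt.smul
        ((hg.differentiable one_ne_zero) x).hasFDerivAt).fderiv
      change fderiv ℝ ((fun x => a x i) • g) x (bv i) = _
      rw [this]
      simp [partialD]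
    simp only [h2, Finset.sum_add_distrib, ← Finset.sum_smul]
    have := hdiv x
    unfold divergence at this
    rw [this, zero_smul, add_zero]
    exact fderiv_apply_eq_sum g x (a x)
  simp only [h1]
  rw [integral_finsetSum]
  · exact Finset.sum_eq_zero fun i _ => integral_partial_eq_zero hL (hcomp i)
      (hap.comp₂ hgp fun a g => a i • g) i
  · intro i _
    exact integrableOn_cell (((hcomp i).continuous_fderiv one_ne_zero).clm_apply continuous_const)

theorem integral_laplacian_eq_zero (hL : 0 ≤ L) {g : E n → F} (hg : ContDiff ℝ 2 g)
    (hp : SpacePeriodic L g) : ∫ x in cell n L, Laplacian.laplacian g x = 0 := by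
  simp only [laplacian_eq_sum hg]
  have h1 : ∀ i, ContDiff ℝ 1 (dirD (bv i) g) := fun i => dirD_contDiff hg (by norm_num) _
  rw [integral_finsetSum]
  · exact Finset.sum_eq_zero fun i _ => integral_partial_eq_zero hL (h1 i) (hp.dirD _) i
  · intro i _
    exact integrableOn_cell ((dirD_contDiff (k := 0) (h1 i) (by norm_num) _).continuous)

lemma continuous_laplacian {g : E n → F} (hg : ContDiff ℝ 2 g) :
    Continuous (Laplacian.laplacian g) := by
  have : Laplacian.laplacian g = fun x => ∑ i, dirD (bv i) (dirD (bv i) g) x :=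
    funext (laplacian_eq_sum hg)
  rw [this]
  refine continuous_finsetSum _ fun i _ => ?_
  exact (dirD_contDiff (k := 0) (dirD_contDiff (k := 1) hg (by norm_num) _) (by norm_num) _).continuous

end

/-! ### Energy identities on the cell of periods -/

section

variable {n : ℕ} {L : ℝ} {F : Type*} [NormedAddCommGroup F] [InnerProductSpace ℝ F]
  [CompleteSpace F]

lemma fderiv_normSq {g : E n → F} (hg : ContDiff ℝ 1 g) (x e : E n) :
    fderiv ℝ (fun y => ‖g y‖ ^ 2) x e = 2 * ⟪g x, fderiv ℝ g x e⟫ := by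
  rw [((hg.differentiable one_ne_zero) x).hasFDerivAt.norm_sq.fderiv]
  simp

/-- Transport by a divergence-free field conserves the energy: the integrand is half the transport
of `‖g‖²`. -/
theorem integral_inner_advect_eq_zero (hL : 0 ≤ L) {a : E n → E n} {g : E n → F}
    (ha : ContDiff ℝ 1 a) (hg : ContDiff ℝ 1 g) (hap : SpacePeriodic L a)
    (hgp : SpacePeriodic L g) (hdiv : ∀ x, divergence a x = 0) :
    ∫ x in cell n L, ⟪g x, advect a g x⟫ = 0 := by
  have h := integral_advect_eq_zero hL ha (hg.norm_sq ℝ) hap (hgp.comp fun y => ‖y‖ ^ 2) hdiv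
  have h2 : ∀ x, advect a (fun y => ‖g y‖ ^ 2) x = 2 * ⟪g x, advect a g x⟫ :=
    fun x => fderiv_normSq hg x _
  simp only [h2] at h
  rw [integral_const_mul] at h
  linarith

/-- Integration by parts turns the integral into `-∑ ∫ ‖∂ᵢ g‖²`. -/
theorem integral_inner_laplacian_nonpos (hL : 0 ≤ L) {g : E n → F} (hg : ContDiff ℝ 2 g)
    (hp : SpacePeriodic L g) : ∫ x in cell n L, ⟪g x, Laplacian.laplacian g x⟫ ≤ 0 := by
  have hg1 : ContDiff ℝ 1 g := hg.of_le (by norm_num)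
  have h1 : ∀ i, ContDiff ℝ 1 (dirD (bv i) g) := fun i => dirD_contDiff hg (by norm_num) _
  have hinn : ∀ i, ContDiff ℝ 1 (fun x => ⟪g x, dirD (bv i) g x⟫) := fun i => hg1.inner ℝ (h1 i)
  have h2 : ∀ i x, ⟪g x, dirD (bv i) (dirD (bv i) g) x⟫ =
      fderiv ℝ (fun x => ⟪g x, dirD (bv i) g x⟫) x (bv i) - ‖dirD (bv i) g x‖ ^ 2 := by
    intro i x
    have := ((((hg1.differentiable one_ne_zero) x).hasFDerivAt).inner ℝ
      (((h1 i).differentiable one_ne_zero) x).hasFDerivAt).fderiv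
    rw [this]
    simp only [ContinuousLinearMap.comp_apply, ContinuousLinearMap.prod_apply, fderivInnerCLM_apply]
    rw [show fderiv ℝ g x (bv i) = dirD (bv i) g x from rfl,
      show fderiv ℝ (dirD (bv i) g) x (bv i) = dirD (bv i) (dirD (bv i) g) x from rfl,
      real_inner_self_eq_norm_sq]
    ring
  have hcd : ∀ i, Continuous fun x => fderiv ℝ (fun x => ⟪g x, dirD (bv i) g x⟫) x (bv i) :=
    fun i => ((hinn i).continuous_fderiv one_ne_zero).clm_apply continuous_const
  have hcn : ∀ i, Continuous fun x => ‖dirD (bv i) g x‖ ^ 2 := fun i => by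
    have := (h1 i).continuous
    fun_prop
  simp only [laplacian_eq_sum hg, inner_sum, h2]
  rw [integral_finsetSum]
  · refine Finset.sum_nonpos fun i _ => ?_
    rw [integral_sub (integrableOn_cell (hcd i)) (integrableOn_cell (hcn i)),
      integral_partial_eq_zero hL (hinn i) (hp.comp₂ (hp.dirD _) fun a b => ⟪a, b⟫) i]
    have : 0 ≤ ∫ x in cell n L, ‖dirD (bv i) g x‖ ^ 2 := integral_nonneg fun x => by positivity
    linarith
  · intro i _
    exact integrableOn_cell ((hcd i).sub (hcn i))

/-- Eliminates the pressure from energy estimates: `⟪a, ∇q⟫ = (a, ∇) q`, with `a` divergence-free.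
-/
theorem integral_inner_gradient_eq_zero (hL : 0 ≤ L) {a : E n → E n} {q : E n → ℝ}
    (ha : ContDiff ℝ 1 a) (hq : ContDiff ℝ 1 q) (hap : SpacePeriodic L a)
    (hqp : SpacePeriodic L q) (hdiv : ∀ x, divergence a x = 0) :
    ∫ x in cell n L, ⟪a x, gradient q x⟫ = 0 := by
  rw [← integral_advect_eq_zero hL ha hq hap hqp hdiv]
  congr 1
  ext x
  rw [real_inner_comm, gradient, InnerProductSpace.toDual_symm_apply]
  rfl

end

/-! ### Fourier series of periodic functions -/

section

variable {n : ℕ} {L : ℝ}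

/-- Fourier coefficients of a complex valued function. -/
def ccoeff (L : ℝ) (g : E n → ℂ) (m : Fin n → ℤ) : ℂ :=
  ((1 / L ^ n : ℝ) : ℂ) * ∫ x in cell n L, g x * mode L (-m) x

lemma coeff_eq_ccoeff (g : E n → ℝ) (m : Fin n → ℤ) :
    coeff L g m = ccoeff L (fun x => (g x : ℂ)) m := rfl

lemma mode_smul_eq_mFourier (hL : L ≠ 0) (m : Fin n → ℤ) (y : Fin n → ℝ) :
    mode L m (WithLp.toLp 2 (L • y)) =
      UnitAddTorus.mFourier m (fun i => (y i : UnitAddCircle)) := by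
  simp only [UnitAddTorus.mFourier, ContinuousMap.coe_mk, fourier_coe_apply, ← Complex.exp_sum, mode]
  congr 1
  push_cast
  simp only [Finset.mul_sum]
  refine Finset.sum_congr rfl fun i _ => ?_
  have : (L : ℂ) ≠ 0 := by exact_mod_cast hL
  simp only [Pi.smul_apply, smul_eq_mul]
  push_cast
  field_simp

lemma integral_cell_eq_unit (hL : 0 < L) {F : Type*} [NormedAddCommGroup F] [NormedSpace ℝ F]
    (g : E n → F) : ∫ x in cell n L, g x =
      L ^ n • ∫ y in {y : Fin n → ℝ | ∀ i, y i ∈ Ioc ((0 : Fin n → ℝ) i) ((0 : Fin n → ℝ) i + 1)},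
        g (WithLp.toLp 2 (L • y)) := by
  have h1 : ∫ x in cell n L, g x =
      ∫ y in {y : Fin n → ℝ | ∀ i, y i ∈ Ioc 0 L}, g (WithLp.toLp 2 y) := by
    have := (PiLp.volume_preserving_ofLp (Fin n)).setIntegral_preimage_emb
      (MeasurableEquiv.toLp 2 (Fin n → ℝ)).symm.measurableEmbedding
      (fun y => g (WithLp.toLp 2 y)) {y : Fin n → ℝ | ∀ i, y i ∈ Ioc 0 L}
    exact this
  rw [h1, Measure.setIntegral_comp_smul_of_pos volume (fun y => g (WithLp.toLp 2 y)) _ hL]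
  rw [Module.finrank_fin_fun, smul_smul, mul_inv_cancel₀ (by positivity), one_smul]
  congr 2
  ext y
  rw [Set.mem_smul_set_iff_inv_smul_mem₀ hL.ne']
  simp only [mem_ofPred_eq, Pi.smul_apply, smul_eq_mul, Pi.zero_apply, zero_add, mem_Ioc]
  refine forall_congr' fun i => and_congr ?_ ?_
  · rw [inv_mul_eq_div]; exact ⟨fun h => div_pos h hL, fun h => by
      have := mul_pos h hL; rwa [div_mul_cancel₀ _ hL.ne'] at this⟩
  · rw [inv_mul_eq_div, div_le_one hL]

/-- After rescaling by `L`, a periodic function factors through the open quotient map `ℝⁿ → (ℝ/ℤ)ⁿ`.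
This gives access to Fourier analysis on the torus. -/
lemma exists_torus_lift {g : E n → ℂ} (hg : Continuous g) (hp : SpacePeriodic L g) :
    ∃ G : C(UnitAddTorus (Fin n), ℂ), ∀ y : Fin n → ℝ,
      G (fun i => (y i : UnitAddCircle)) = g (WithLp.toLp 2 (L • y)) := by
  have hq : IsOpenQuotientMap (Pi.map fun (_ : Fin n) (t : ℝ) => (t : UnitAddCircle)) :=
    IsOpenQuotientMap.piMap fun _ => QuotientAddGroup.isOpenQuotientMap_mk
  let q : C(Fin n → ℝ, UnitAddTorus (Fin n)) := ⟨_, hq.continuous⟩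
  let f : C(Fin n → ℝ, ℂ) := ⟨fun y => g (WithLp.toLp 2 (L • y)),
    hg.comp ((PiLp.continuous_toLp 2 _).comp (continuous_const_smul L))⟩
  have hfac : Function.FactorsThrough f q := by
    intro y z hyz
    refine hp.eq_of_sub_int_mul fun i => ?_
    have h1 : ((y i : ℝ) : UnitAddCircle) = (z i : UnitAddCircle) := congrFun hyz i
    rw [← sub_eq_zero, ← AddCircle.coe_sub, AddCircle.coe_eq_zero_iff] at h1
    obtain ⟨k, hk⟩ := h1
    refine ⟨k, ?_⟩
    simp only [zsmul_eq_mul, mul_one] at hk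
    simp only [Pi.smul_apply, smul_eq_mul, hk]
    ring
  have hq' : Topology.IsQuotientMap q := hq.isQuotientMap
  refine ⟨hq'.lift f hfac, fun y => ?_⟩
  have := hq'.lift_comp f hfac
  exact DFunLike.congr_fun this y

/-- Parseval's identity. -/
theorem hasSum_sq_ccoeff (hL : 0 < L) {g : E n → ℂ} (hg : Continuous g) (hp : SpacePeriodic L g) :
    HasSum (fun m => ‖ccoeff L g m‖ ^ 2) (1 / L ^ n * ∫ x in cell n L, ‖g x‖ ^ 2) := by
  obtain ⟨G, hG⟩ := exists_torus_lift hg hp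
  have hLn : L ^ n ≠ 0 := by positivity
  -- Haar measure of total mass one corresponds to the factor `L⁻ⁿ` in the coefficients.
  let _ : MeasureSpace UnitAddCircle := ⟨AddCircle.haarAddCircle⟩
  have _ : IsProbabilityMeasure (volume : Measure UnitAddCircle) :=
    inferInstanceAs (IsProbabilityMeasure AddCircle.haarAddCircle)
  have key := UnitAddTorus.hasSum_sq_mFourierCoeff (ContinuousMap.toLp (E := ℂ) 2 volume ℂ G)
  have h1 : ∀ m, UnitAddTorus.mFourierCoeff (ContinuousMap.toLp (E := ℂ) 2 volume ℂ G) m =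
      ccoeff L g m := by
    intro m
    rw [UnitAddTorus.mFourierCoeff_toLp, UnitAddTorus.mFourierCoeff_eq_integral _ _ 0, ccoeff,
      integral_cell_eq_unit hL]
    rw [Complex.real_smul, ← mul_assoc, ← Complex.ofReal_mul, one_div, inv_mul_cancel₀ hLn,
      Complex.ofReal_one, one_mul]
    congr 1
    ext y
    rw [hG, mode_smul_eq_mFourier hL.ne', smul_eq_mul, mul_comm]
  have h2 : ∫ t, ‖(ContinuousMap.toLp (E := ℂ) 2 volume ℂ G : UnitAddTorus (Fin n) → ℂ) t‖ ^ 2 =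
      1 / L ^ n * ∫ x in cell n L, ‖g x‖ ^ 2 := by
    rw [integral_cell_eq_unit hL, smul_eq_mul, ← mul_assoc, one_div, inv_mul_cancel₀ hLn, one_mul]
    have : ∫ t, ‖(ContinuousMap.toLp (E := ℂ) 2 volume ℂ G : UnitAddTorus (Fin n) → ℂ) t‖ ^ 2 =
        ∫ t, ‖G t‖ ^ 2 := by
      refine integral_congr_ae ?_
      filter_upwards [ContinuousMap.coeFn_toLp (p := 2) (𝕜 := ℂ) volume G] with t ht
      rw [ht]
    rw [this, UnitAddTorus.integral_preimage (fun t => ‖G t‖ ^ 2) 0]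
    simp only [hG]
  simpa only [h1, h2] using key

/-! ### Modes -/

lemma mode_contDiff (m : Fin n → ℤ) {k : WithTop ℕ∞} : ContDiff ℝ k (mode L m : E n → ℂ) := by
  unfold mode
  refine (contDiff_const.mul ?_).cexp
  exact Complex.ofRealCLM.contDiff.comp
    (contDiff_const.mul (ContDiff.sum fun i _ => contDiff_const.mul (by fun_prop)))

lemma mode_neg_arg (m : Fin n → ℤ) (x : E n) : mode L (-m) x = (starRingEnd ℂ) (mode L m x) := by
  simp only [mode, ← Complex.exp_conj, map_mul, Complex.conj_I, Complex.conj_ofReal]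
  congr 1
  simp [Finset.sum_neg_distrib]

lemma mode_mul (m k : Fin n → ℤ) (x : E n) : mode L m x * mode L k x = mode L (m + k) x := by
  simp only [mode, ← Complex.exp_add, Pi.add_apply]
  congr 1
  push_cast
  simp only [add_mul, Finset.sum_add_distrib]
  ring

lemma mode_zero (x : E n) : mode L 0 x = 1 := by simp [mode]

lemma norm_mode (m : Fin n → ℤ) (x : E n) : ‖mode L m x‖ = 1 := by
  rw [mode, mul_comm]
  exact Complex.norm_exp_ofReal_mul_I _

lemma mode_periodic (hL : L ≠ 0) (m : Fin n → ℤ) : SpacePeriodic L (mode L m : E n → ℂ) := by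
  intro x i
  simp only [mode]
  rw [Complex.exp_eq_exp_iff_exists_int]
  refine ⟨m i, ?_⟩
  have : (L : ℂ) ≠ 0 := by exact_mod_cast hL
  have h2 : ∑ j, (m j : ℝ) * (x + L • EuclideanSpace.single i (1 : ℝ)) j
      = ∑ j, (m j : ℝ) * x j + m i * L := by
    simp [mul_add, Finset.sum_add_distrib]
  rw [h2]
  push_cast
  field_simp

lemma fderiv_mode (m : Fin n → ℤ) (x : E n) (i : Fin n) :
    fderiv ℝ (mode L m) x (bv i) = (Complex.I * ((2 * Real.pi / L * m i : ℝ) : ℂ)) * mode L m x := by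
  let l : E n →L[ℝ] ℝ := (2 * Real.pi / L) • ∑ j, (m j : ℝ) • (EuclideanSpace.proj j : E n →L[ℝ] ℝ)
  have hl : ∀ y, l y = 2 * Real.pi / L * ∑ j, (m j : ℝ) * y j := by
    intro y; simp [l]
  have h1 : HasFDerivAt (fun y => Complex.exp (Complex.I * ((l y : ℝ) : ℂ))) _ x :=
    (((Complex.ofRealCLM.comp l).hasFDerivAt (x := x)).const_mul Complex.I).cexp
  have h2 : (mode L m : E n → ℂ) = fun y => Complex.exp (Complex.I * ((l y : ℝ) : ℂ)) := by
    ext y; simp only [mode, hl]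
  rw [h2, h1.fderiv]
  simp only [smul_apply, ContinuousLinearMap.comp_apply,
    Complex.ofRealCLM_apply, smul_eq_mul]
  have : l (bv i) = 2 * Real.pi / L * m i := by
    rw [hl]; simp
  rw [this]
  ring

/-- For an index with `m i ≠ 0` the mode is a nonzero multiple of its own `i`-th derivative, whose
integral vanishes. -/
lemma integral_mode (hL : 0 < L) {m : Fin n → ℤ} (hm : m ≠ 0) :
    ∫ x in cell n L, mode L m x = 0 := by
  obtain ⟨i, hi⟩ := Function.ne_iff.mp hm
  have := integral_partial_eq_zero hL.le (mode_contDiff (L := L) m) (mode_periodic hL.ne' m) i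
  simp only [fderiv_mode] at this
  rw [integral_const_mul] at this
  rcases mul_eq_zero.mp this with h | h
  · exfalso
    simp only [mul_eq_zero, Complex.I_ne_zero, false_or, Complex.ofReal_eq_zero,
      div_eq_zero_iff, Real.pi_ne_zero, OfNat.ofNat_ne_zero, hL.ne', Int.cast_eq_zero] at h
    exact hi h
  · exact h

/-- Fourier coefficients of a derivative. -/
theorem coeff_dirD (hL : 0 < L) {g : E n → ℝ} (hg : ContDiff ℝ 1 g) (hp : SpacePeriodic L g)
    (i : Fin n) (m : Fin n → ℤ) :
    coeff L (dirD (bv i) g) m = Complex.I * ((2 * Real.pi / L * m i : ℝ) : ℂ) * coeff L g m := by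
  have hg' : ContDiff ℝ 1 (fun x => (g x : ℂ)) := Complex.ofRealCLM.contDiff.comp hg
  have hm := mode_contDiff (L := L) (-m) (k := 1)
  have h0 := integral_partial_eq_zero hL.le (hg'.mul hm)
    (hp.comp₂ (mode_periodic hL.ne' (-m)) fun a b => (a : ℂ) * b) i
  have h1 : ∀ x, fderiv ℝ (fun x => (g x : ℂ) * mode L (-m) x) x (bv i) =
      ((dirD (bv i) g x : ℝ) : ℂ) * mode L (-m) x +
      -(Complex.I * ((2 * Real.pi / L * m i : ℝ) : ℂ)) * ((g x : ℂ) * mode L (-m) x) := by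
    intro x
    have hd : HasFDerivAt (fun x => (g x : ℂ)) (Complex.ofRealCLM.comp (fderiv ℝ g x)) x :=
      Complex.ofRealCLM.hasFDerivAt.comp x ((hg.differentiable one_ne_zero) x).hasFDerivAt
    have := (hd.mul ((hm.differentiable one_ne_zero) x).hasFDerivAt).fderiv
    rw [show (fun x => (g x : ℂ) * mode L (-m) x) = (fun x => (g x : ℂ)) * mode L (-m) from rfl,
      this]
    simp only [add_apply, smul_apply, fderiv_mode,
      ContinuousLinearMap.comp_apply, Complex.ofRealCLM_apply, dirD, smul_eq_mul, Pi.neg_apply]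
    push_cast
    ring
  rw [integral_congr_ae (Filter.Eventually.of_forall h1), integral_add, integral_const_mul] at h0
  · simp only [coeff]
    linear_combination ((1 / L ^ n : ℝ) : ℂ) * h0
  · refine integrableOn_cell ((Complex.continuous_ofReal.comp ?_).mul hm.continuous)
    exact (dirD_contDiff (k := 0) hg (by norm_num) _).continuous
  · exact (integrableOn_cell (hg'.continuous.mul hm.continuous)).const_mul _

lemma coeff_conj (g : E n → ℝ) (m : Fin n → ℤ) :
    (starRingEnd ℂ) (coeff L g (-m)) = coeff L g m := by
  simp only [coeff, map_mul, Complex.conj_ofReal, ← integral_conj, mode_neg_arg, neg_neg]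

lemma coeff_sub {g h : E n → ℝ} (hg : Continuous g) (hh : Continuous h) (m : Fin n → ℤ) :
    coeff L (fun x => g x - h x) m = coeff L g m - coeff L h m := by
  have hm := (mode_contDiff (L := L) (-m) (k := 0)).continuous
  simp only [coeff, Complex.ofReal_sub, sub_mul]
  have h1 := integrableOn_cell (L := L) ((Complex.continuous_ofReal.comp hg).mul hm)
  have h2 := integrableOn_cell (L := L) ((Complex.continuous_ofReal.comp hh).mul hm)
  exact (congrArg _ (integral_sub h1 h2)).trans (mul_sub _ _ _)

lemma coeff_zero_eq (g : E n → ℝ) (h : ∫ x in cell n L, g x = 0) : coeff L g 0 = 0 := by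
  simp only [coeff, neg_zero, mode_zero, mul_one]
  rw [integral_complex_ofReal, h]
  simp

theorem hasSum_sq_coeff (hL : 0 < L) {g : E n → ℝ} (hg : Continuous g) (hp : SpacePeriodic L g) :
    HasSum (fun m => ‖coeff L g m‖ ^ 2) (1 / L ^ n * ∫ x in cell n L, g x ^ 2) := by
  have := hasSum_sq_ccoeff hL (Complex.continuous_ofReal.comp hg) (hp.comp fun r => (r : ℂ))
  simpa [coeff_eq_ccoeff, Function.comp_def] using this

/-! ### Absolutely convergent series of modes -/

section Series

variable {a : (Fin n → ℤ) → ℂ} (ha : Summable fun m => ‖a m‖)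
include ha

lemma continuous_modeSeries : Continuous fun x : E n => ∑' m, a m * mode L m x := by
  refine continuous_tsum (fun m => ?_) ha fun m x => ?_
  · exact continuous_const.mul (mode_contDiff (k := 0) m).continuous
  · rw [norm_mul, norm_mode, mul_one]

/-- Absolute convergence allows termwise integration, and orthogonality of the modes leaves the term
`m = k`. -/
lemma ccoeff_modeSeries (hL : 0 < L) (k : Fin n → ℤ) :
    ccoeff L (fun x => ∑' m, a m * mode L m x) k = a k := by
  have hLn : ((L ^ n : ℝ) : ℂ) ≠ 0 := by exact_mod_cast (by positivity : L ^ n ≠ 0)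
  have hcm : ∀ m : Fin n → ℤ, Continuous (mode L m : E n → ℂ) := fun m =>
    (mode_contDiff (k := 0) m).continuous
  have h1 : ∀ x : E n, (∑' m, a m * mode L m x) * mode L (-k) x =
      ∑' m, a m * mode L (m - k) x := by
    intro x
    rw [← tsum_mul_right]
    congr 1
    ext m
    rw [mul_assoc, mode_mul, sub_eq_add_neg]
  unfold ccoeff
  simp only [h1]
  rw [← integral_tsum_of_summable_integral_norm]
  · rw [tsum_eq_single k]
    · simp only [sub_self, mode_zero, mul_one, integral_const, measureReal_restrict_apply_univ,
        volume_cell hL.le, Complex.real_smul]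
      rw [← mul_assoc, ← Complex.ofReal_mul, one_div, inv_mul_cancel₀ (by positivity)]
      simp
    · intro m hm
      rw [integral_const_mul, integral_mode hL (sub_ne_zero.mpr hm), mul_zero]
  · intro m
    exact integrableOn_cell (continuous_const.mul (hcm _))
  · simp only [norm_mul, norm_mode, mul_one, integral_const, measureReal_restrict_apply_univ,
      smul_eq_mul]
    exact ha.mul_left _

end Series

/-! ### The potential series -/

lemma normSqZ_neg (m : Fin n → ℤ) : normSqZ (-m) = normSqZ m := by simp [normSqZ]

section Potential

variable {c : (Fin n → ℤ) → ℂ}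
  (hc : Summable fun m => ‖((1 / normSqZ m : ℝ) : ℂ) * c m‖)
  (hconj : ∀ m, (starRingEnd ℂ) (c (-m)) = -c m)

/-- The symmetry `conj c(-m) = -c(m)` makes the sum over `m` purely imaginary, as the reindexing `m
↦ -m` shows. Multiplied by `i` it is real, so the real part in `potentialSeries` discards nothing.
-/
lemma ofReal_potentialSeries (hconj : ∀ m, (starRingEnd ℂ) (c (-m)) = -c m) (x : E n) :
    ((potentialSeries L c x : ℝ) : ℂ) = Complex.I * ((L / (2 * Real.pi) : ℝ) : ℂ) *
      ∑' m : Fin n → ℤ, ((1 / normSqZ m : ℝ) : ℂ) * mode L m x * c m := by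
  unfold potentialSeries
  rw [← Complex.conj_eq_iff_re]
  simp only [map_mul, Complex.conj_I, Complex.conj_ofReal, Complex.conj_tsum]
  rw [← (Equiv.neg (Fin n → ℤ)).tsum_eq]
  simp only [Equiv.neg_apply, hconj, normSqZ_neg, mode_neg_arg, Complex.conj_conj, mul_neg,
    tsum_neg]
  ring

lemma potentialSeries_eq_modeSeries (hconj : ∀ m, (starRingEnd ℂ) (c (-m)) = -c m) (x : E n) :
    ((potentialSeries L c x : ℝ) : ℂ) =
      ∑' m : Fin n → ℤ, (Complex.I * ((L / (2 * Real.pi) : ℝ) : ℂ) *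
        (((1 / normSqZ m : ℝ) : ℂ) * c m)) * mode L m x := by
  rw [ofReal_potentialSeries hconj, ← tsum_mul_left]
  congr 1
  ext m
  ring

include hc hconj

lemma continuous_potentialSeries : Continuous (potentialSeries L c) := by
  have h := continuous_modeSeries (L := L) (n := n)
    (a := fun m => Complex.I * ((L / (2 * Real.pi) : ℝ) : ℂ) * (((1 / normSqZ m : ℝ) : ℂ) * c m))
    (by simp only [norm_mul _ (_ * c _)]; exact hc.mul_left _)
  have h2 := Complex.continuous_re.comp h
  refine h2.congr fun x => ?_
  simp only [Function.comp_apply, ← potentialSeries_eq_modeSeries hconj, Complex.ofReal_re]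

lemma coeff_potentialSeries (hL : 0 < L) (m : Fin n → ℤ) :
    coeff L (potentialSeries L c) m = Complex.I * ((L / (2 * Real.pi) : ℝ) : ℂ) *
        (((1 / normSqZ m : ℝ) : ℂ) * c m) := by
  rw [coeff_eq_ccoeff]
  simp only [potentialSeries_eq_modeSeries hconj]
  exact ccoeff_modeSeries (by simp only [norm_mul _ (_ * c _)]; exact hc.mul_left _) hL m

end Potential

lemma potentialSeries_periodic (hL : L ≠ 0) (c : (Fin n → ℤ) → ℂ) :
    SpacePeriodic L (potentialSeries L c) := by
  intro x i
  simp only [potentialSeries, mode_periodic hL _ x i]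

/-! ### Decay of Fourier coefficients -/

lemma abs_le_normSqZ (m : Fin n → ℤ) (i : Fin n) : ((m i : ℝ)) ^ 2 ≤ normSqZ m :=
  Finset.single_le_sum (f := fun i => ((m i : ℝ)) ^ 2) (fun _ _ => sq_nonneg _) (Finset.mem_univ i)

lemma normSqZ_nonneg (m : Fin n → ℤ) : 0 ≤ normSqZ m := Finset.sum_nonneg fun _ _ => sq_nonneg _

lemma one_le_normSqZ {m : Fin n → ℤ} (hm : m ≠ 0) : 1 ≤ normSqZ m := by
  obtain ⟨i, hi⟩ := Function.ne_iff.mp hm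
  refine le_trans ?_ (abs_le_normSqZ m i)
  have : 1 ≤ (m i) ^ 2 := by
    have := Int.one_le_abs hi
    nlinarith [sq_abs (m i)]
  exact_mod_cast this

/-- Comparison with the lattice sum of `‖m‖⁻⁶` in the sup norm, which converges because the rank is
below six. The term `m = 0` is zero since `1 / 0 = 0`. -/
lemma summable_inv_normSqZ_pow (hn : n < 6) :
    Summable fun m : Fin n → ℤ => (1 / normSqZ m) ^ 3 := by
  let Λ : Submodule ℤ (Fin n → ℝ) := Submodule.span ℤ (Set.range (Pi.basisFun ℝ (Fin n)))
  have hrank : Module.finrank ℤ Λ < 6 := by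
    rw [ZLattice.rank ℝ Λ, Module.finrank_fin_fun]; exact hn
  have hs := ZLattice.summable_norm_pow_inv Λ 6 hrank
  have hmem : ∀ m : Fin n → ℤ, (fun i => (m i : ℝ)) ∈ Λ := by
    intro m
    rw [show (fun i => (m i : ℝ)) = ∑ i, m i • (Pi.basisFun ℝ (Fin n) i) by
      ext j; simp [Finset.sum_apply, Pi.single_apply]]
    exact Submodule.sum_mem _ fun i _ => Submodule.smul_mem _ _ (Submodule.subset_span ⟨i, rfl⟩)
  have hinj : Function.Injective (fun m : Fin n → ℤ => (⟨_, hmem m⟩ : Λ)) := by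
    intro m k h
    ext i
    have : (m i : ℝ) = k i := congrFun (Subtype.ext_iff.mp h) i
    exact_mod_cast this
  refine Summable.of_nonneg_of_le (fun m => ?_) (fun m => ?_) (hs.comp_injective hinj)
  · have := normSqZ_nonneg m; positivity
  · simp only [Function.comp_apply]
    by_cases hm : m = 0
    · subst hm
      simp [normSqZ]
    have h1 := one_le_normSqZ hm
    have h2 : ‖(fun i => (m i : ℝ))‖ ^ 2 ≤ normSqZ m := by
      have h3 : ‖(fun i => (m i : ℝ))‖ ≤ Real.sqrt (normSqZ m) := by
        rw [pi_norm_le_iff_of_nonneg (Real.sqrt_nonneg _)]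
        intro i
        rw [Real.norm_eq_abs]
        exact Real.abs_le_sqrt (abs_le_normSqZ m i)
      calc _ ≤ Real.sqrt (normSqZ m) ^ 2 := by gcongr
        _ = _ := Real.sq_sqrt (normSqZ_nonneg m)
    have h4 : 0 < ‖(fun i => (m i : ℝ))‖ := by
      rw [norm_pos_iff]
      intro h
      apply hm
      ext i
      have : (m i : ℝ) = 0 := congrFun h i
      exact_mod_cast this
    calc (1 / normSqZ m) ^ 3 ≤ (1 / ‖(fun i => (m i : ℝ))‖ ^ 2) ^ 3 := by gcongr
      _ = ‖(fun i => (m i : ℝ))‖⁻¹ ^ 6 := by rw [one_div, ← inv_pow, ← pow_mul]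

/-- Two derivatives of `g` make `|m|² |ĝ(m)|` square summable, by Parseval. The term is at most
`|m|⁻¹ |ĝ(m)| = |m|⁻³ · (|m|² |ĝ(m)|)`, a product of two square summable sequences when `n < 6`.
Hence the Biot-Savart series of a `C²` vorticity converges absolutely. -/
theorem summable_coeff_div (hL : 0 < L) (hn : n < 6) {g : E n → ℝ} (hg : ContDiff ℝ 2 g)
    (hp : SpacePeriodic L g) (j : Fin n) :
    Summable fun m : Fin n → ℤ => ‖((1 / normSqZ m : ℝ) : ℂ) * (coeff L g m * (m j : ℂ))‖ := by
  have hlap : Summable fun m => ∑ i, ‖coeff L (dirD (bv i) (dirD (bv i) g)) m‖ ^ 2 := by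
    refine summable_sum fun i _ => ?_
    refine (hasSum_sq_coeff hL ?_ ((hp.dirD _).dirD _)).summable
    exact (dirD_contDiff (k := 0) (dirD_contDiff (k := 1) hg (by norm_num) _)
      (by norm_num) _).continuous
  have hb : ∀ i m, ‖coeff L (dirD (bv i) (dirD (bv i) g)) m‖ =
      (2 * Real.pi / L) ^ 2 * (m i : ℝ) ^ 2 * ‖coeff L g m‖ := by
    intro i m
    rw [coeff_dirD hL (dirD_contDiff hg (by norm_num) _) (hp.dirD _),
      coeff_dirD hL (hg.of_le (by norm_num)) hp]
    simp only [norm_mul, Complex.norm_I, Complex.norm_real, Real.norm_eq_abs, one_mul]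
    rw [← sq_abs (2 * Real.pi / L), ← sq_abs (m i : ℝ)]
    ring
  have hK : (0 : ℝ) < (2 * Real.pi / L) ^ 2 := by have := Real.pi_pos; positivity
  set K := (2 * Real.pi / L) ^ 2
  refine Summable.of_nonneg_of_le (fun m => norm_nonneg _) (fun m => ?_)
    (((summable_inv_normSqZ_pow hn).add (hlap.mul_left (n / K ^ 2))))
  by_cases hm : m = 0
  · subst hm
    simp only [normSqZ, Pi.zero_apply, Int.cast_zero, mul_zero, norm_zero]
    positivity
  have h1 := one_le_normSqZ hm
  have hs : (∑ i, ‖coeff L (dirD (bv i) (dirD (bv i) g)) m‖) = K * normSqZ m * ‖coeff L g m‖ := by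
    simp only [hb, normSqZ, Finset.mul_sum, Finset.sum_mul]
  -- Cauchy-Schwarz over the `n` pure second derivatives; this is the source of the factor `n / K ^
  -- 2`.
  have hcs := sq_sum_le_card_mul_sum_sq (s := Finset.univ)
    (f := fun i => ‖coeff L (dirD (bv i) (dirD (bv i) g)) m‖)
  rw [hs] at hcs
  simp only [Finset.card_univ, Fintype.card_fin] at hcs
  set r := normSqZ m with hr
  set A := ‖coeff L g m‖ with hA
  have hA0 : 0 ≤ A := norm_nonneg _
  have hmj : |(m j : ℝ)| ≤ Real.sqrt r := Real.abs_le_sqrt (abs_le_normSqZ m j)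
  have hn1 : ‖((1 / r : ℝ) : ℂ) * (coeff L g m * (m j : ℂ))‖ = 1 / r * (A * |(m j : ℝ)|) := by
    rw [norm_mul, norm_mul, Complex.norm_real, Real.norm_eq_abs, abs_of_nonneg (by positivity)]
    congr 2
    rw [← Complex.ofReal_intCast, Complex.norm_real, Real.norm_eq_abs]
  rw [hn1]
  have hS : (r * A) ^ 2 ≤ n / K ^ 2 * ∑ i, ‖coeff L (dirD (bv i) (dirD (bv i) g)) m‖ ^ 2 := by
    rw [div_mul_eq_mul_div, le_div_iff₀ (by positivity)]
    calc (r * A) ^ 2 * K ^ 2 = (K * r * A) ^ 2 := by ring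
      _ ≤ _ := hcs
  refine le_trans ?_ (add_le_add_right hS _)
  have hsq := Real.sq_sqrt (normSqZ_nonneg m)
  rw [← hr] at hsq
  have hs0 : 0 < Real.sqrt r := Real.sqrt_pos.mpr (by linarith)
  set s := Real.sqrt r
  rw [← hsq]
  calc 1 / s ^ 2 * (A * |(m j : ℝ)|) ≤ 1 / s ^ 2 * (A * s) := by gcongr
    _ = (1 / s) ^ 3 * (s ^ 2 * A) := by field_simp
    _ ≤ (1 / s ^ 2) ^ 3 + (s ^ 2 * A) ^ 2 := by
      have : (1 / s ^ 2) ^ 3 = ((1 / s) ^ 3) ^ 2 := by ring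
      rw [this]
      nlinarith [sq_nonneg ((1 / s) ^ 3 - s ^ 2 * A), sq_nonneg ((1 / s) ^ 3), sq_nonneg (s ^ 2 * A)]

end

/-! ### The Biot-Savart law in `L²` -/

section

section Scalar

variable {n : ℕ} {L : ℝ}

lemma coeff_finsetSum {ι : Type*} (s : Finset ι) {g : ι → E n → ℝ} (hg : ∀ i, Continuous (g i))
    (m : Fin n → ℤ) : coeff L (fun x => ∑ i ∈ s, g i x) m = ∑ i ∈ s, coeff L (g i) m := by
  have hm := (mode_contDiff (L := L) (-m) (k := 0)).continuous
  simp only [coeff, Complex.ofReal_sum, Finset.sum_mul, ← Finset.mul_sum]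
  congr 1
  exact integral_finsetSum s fun i _ =>
    integrableOn_cell (L := L) ((Complex.continuous_ofReal.comp (hg i)).mul hm)

lemma sum_coeff_eq_zero_of_divergence (hL : 0 < L) {v : E n → E n} (hv : ContDiff ℝ 1 v)
    (hp : SpacePeriodic L v) (hdiv : ∀ x, divergence v x = 0) (m : Fin n → ℤ) :
    ∑ i, (m i : ℂ) * coeff L (fun x => v x i) m = 0 := by
  have hvi : ∀ i, ContDiff ℝ 1 (fun x => v x i) := fun i => by fun_prop
  have h0 : (fun x => ∑ i, dirD (bv i) (fun y => v y i) x) = fun _ => 0 := funext hdiv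
  have h1 := coeff_finsetSum (L := L) Finset.univ (g := fun i => dirD (bv i) (fun y => v y i))
    (fun i => (dirD_contDiff (k := 0) (hvi i) (by norm_num) _).continuous) m
  rw [h0] at h1
  simp only [fun i => coeff_dirD hL (hvi i) (hp.comp fun y => y i) i m] at h1
  have h2 : coeff L (fun _ : E n => (0 : ℝ)) m = 0 := by simp [coeff]
  rw [h2] at h1
  have hk : (Complex.I * ((2 * Real.pi / L : ℝ) : ℂ)) ≠ 0 := by
    refine mul_ne_zero Complex.I_ne_zero ?_
    have := Real.pi_pos
    exact_mod_cast (by positivity : 2 * Real.pi / L ≠ 0)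
  have h3 : (Complex.I * ((2 * Real.pi / L : ℝ) : ℂ)) *
      ∑ i, (m i : ℂ) * coeff L (fun x => v x i) m = 0 := by
    rw [Finset.mul_sum]
    refine Eq.trans (Finset.sum_congr rfl fun i _ => ?_) h1.symm
    push_cast
    ring
  exact (mul_eq_zero.mp h3).resolve_left hk

lemma coeff_partial_sub (hL : 0 < L) {v : E n → E n} (hv : ContDiff ℝ 1 v)
    (hp : SpacePeriodic L v) (i j : Fin n) (m : Fin n → ℤ) :
    coeff L (fun x => partialD i j v x - partialD j i v x) m =
      Complex.I * ((2 * Real.pi / L : ℝ) : ℂ) *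
        ((m i : ℂ) * coeff L (fun x => v x j) m - (m j : ℂ) * coeff L (fun x => v x i) m) := by
  have hvi : ∀ i, ContDiff ℝ 1 (fun x => v x i) := fun i => by fun_prop
  have hc : ∀ i j, Continuous (partialD i j v) := fun i j =>
    (dirD_contDiff (k := 0) (hvi j) (by norm_num) (bv i)).continuous
  rw [coeff_sub (hc i j) (hc j i)]
  rw [show partialD i j v = dirD (bv i) (fun y => v y j) from rfl,
    show partialD j i v = dirD (bv j) (fun y => v y i) from rfl,
    coeff_dirD hL (hvi j) (hp.comp fun y => y j), coeff_dirD hL (hvi i) (hp.comp fun y => y i)]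
  push_cast
  ring

lemma integral_sq_le_of_coeff_le (hL : 0 < L) {g h k : E n → ℝ} (hg : Continuous g)
    (hh : Continuous h) (hk : Continuous k) (hgp : SpacePeriodic L g) (hhp : SpacePeriodic L h)
    (hkp : SpacePeriodic L k) {c : ℝ}
    (hle : ∀ m, ‖coeff L g m‖ ^ 2 ≤ c * (‖coeff L h m‖ ^ 2 + ‖coeff L k m‖ ^ 2)) :
    ∫ x in cell n L, g x ^ 2 ≤
      c * ((∫ x in cell n L, h x ^ 2) + ∫ x in cell n L, k x ^ 2) := by
  have h1 := hasSum_sq_coeff hL hg hgp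
  have h2 := ((hasSum_sq_coeff hL hh hhp).add (hasSum_sq_coeff hL hk hkp)).mul_left c
  have h3 := hasSum_le hle h1 h2
  have hLn : 0 < 1 / L ^ n := by positivity
  have : 1 / L ^ n * ∫ x in cell n L, g x ^ 2 ≤
      1 / L ^ n * (c * ((∫ x in cell n L, h x ^ 2) + ∫ x in cell n L, k x ^ 2)) := by
    linarith
  exact le_of_mul_le_mul_left this hLn

/-- Hypothesis `heq` says that the error has the Biot-Savart symbol applied to the vorticity defects
`h`, `k`. That symbol is bounded by a multiple of `|m|⁻¹ ≤ 1` for `m ≠ 0` and vanishes at `m = 0`,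
so Parseval transfers the bound to `L²`. -/
lemma integral_sq_sub_potentialSeries_le (hL : 0 < L) {v h k : E n → ℝ} (hv : Continuous v)
    (hh : Continuous h) (hk : Continuous k) (hvp : SpacePeriodic L v) (hhp : SpacePeriodic L h)
    (hkp : SpacePeriodic L k) {c : (Fin n → ℤ) → ℂ}
    (hc : Summable fun m => ‖((1 / normSqZ m : ℝ) : ℂ) * c m‖)
    (hconj : ∀ m, (starRingEnd ℂ) (c (-m)) = -c m) (i j : Fin n)
    (heq : ∀ m, coeff L v m - Complex.I * ((L / (2 * Real.pi) : ℝ) : ℂ) *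
        (((1 / normSqZ m : ℝ) : ℂ) * c m) = Complex.I * ((L / (2 * Real.pi) : ℝ) : ℂ) *
        (((1 / normSqZ m : ℝ) : ℂ) * ((m i : ℂ) * coeff L h m - (m j : ℂ) * coeff L k m))) :
    ∫ x in cell n L, (v x - potentialSeries L c x) ^ 2 ≤
      2 * (L / (2 * Real.pi)) ^ 2 *
        ((∫ x in cell n L, h x ^ 2) + ∫ x in cell n L, k x ^ 2) := by
  have hpc := continuous_potentialSeries (L := L) hc hconj
  refine integral_sq_le_of_coeff_le hL (hv.sub hpc) hh hk
    (hvp.comp₂ (potentialSeries_periodic hL.ne' c) fun a b => a - b) hhp hkp fun m => ?_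
  rw [show v - potentialSeries L c = fun x => v x - potentialSeries L c x from rfl,
    coeff_sub hv hpc, coeff_potentialSeries hc hconj hL, heq]
  have hnorm : ∀ l : Fin n, ‖(m l : ℂ)‖ ^ 2 ≤ normSqZ m := fun l => by
    rw [← Complex.ofReal_intCast, Complex.norm_real, Real.norm_eq_abs, sq_abs]
    exact abs_le_normSqZ m l
  by_cases hm : m = 0
  · subst hm
    simp only [normSqZ, Pi.zero_apply, Int.cast_zero]
    norm_num
    positivity
  have hr := one_le_normSqZ hm
  set r := normSqZ m
  set A := coeff L h m
  set B := coeff L k m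
  have h1 : ‖(m i : ℂ) * A - (m j : ℂ) * B‖ ^ 2 ≤ 2 * r * (‖A‖ ^ 2 + ‖B‖ ^ 2) := by
    have h2 : ‖(m i : ℂ) * A - (m j : ℂ) * B‖ ≤ ‖(m i : ℂ)‖ * ‖A‖ + ‖(m j : ℂ)‖ * ‖B‖ := by
      refine (norm_sub_le _ _).trans (le_of_eq ?_)
      rw [norm_mul, norm_mul]
    calc _ ≤ (‖(m i : ℂ)‖ * ‖A‖ + ‖(m j : ℂ)‖ * ‖B‖) ^ 2 := by gcongr
      _ ≤ 2 * (‖(m i : ℂ)‖ ^ 2 * ‖A‖ ^ 2 + ‖(m j : ℂ)‖ ^ 2 * ‖B‖ ^ 2) := by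
        nlinarith [sq_nonneg (‖(m i : ℂ)‖ * ‖A‖ - ‖(m j : ℂ)‖ * ‖B‖)]
      _ ≤ 2 * (r * ‖A‖ ^ 2 + r * ‖B‖ ^ 2) := by
        gcongr
        · exact hnorm i
        · exact hnorm j
      _ = _ := by ring
  rw [norm_mul, norm_mul, norm_mul, Complex.norm_I, Complex.norm_real, Complex.norm_real,
    Real.norm_eq_abs, Real.norm_eq_abs, one_mul, mul_pow, mul_pow, sq_abs, sq_abs]
  have h3 : (1 / r) ^ 2 * (2 * r * (‖A‖ ^ 2 + ‖B‖ ^ 2)) ≤ 2 * (‖A‖ ^ 2 + ‖B‖ ^ 2) := by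
    have h4 : (1 / r) ^ 2 * (2 * r * (‖A‖ ^ 2 + ‖B‖ ^ 2)) =
        (1 / r) * (2 * (‖A‖ ^ 2 + ‖B‖ ^ 2)) := by field_simp
    rw [h4]
    have h5 : 1 / r ≤ 1 := by rw [div_le_one (by linarith)]; exact hr
    exact mul_le_of_le_one_left (by positivity) h5
  calc (L / (2 * Real.pi)) ^ 2 * ((1 / r) ^ 2 * ‖(m i : ℂ) * A - (m j : ℂ) * B‖ ^ 2)
      ≤ (L / (2 * Real.pi)) ^ 2 * ((1 / r) ^ 2 * (2 * r * (‖A‖ ^ 2 + ‖B‖ ^ 2))) := by gcongr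
    _ ≤ (L / (2 * Real.pi)) ^ 2 * (2 * (‖A‖ ^ 2 + ‖B‖ ^ 2)) := by gcongr
    _ = _ := by ring

lemma integral_sq_eq_zero_of_coeff (hL : 0 < L) {g : E n → ℝ} (hg : Continuous g)
    (hgp : SpacePeriodic L g) (h : ∀ m, coeff L g m = 0) : ∫ x in cell n L, g x ^ 2 = 0 := by
  have h1 := hasSum_sq_coeff hL hg hgp
  simp only [h, norm_zero, ne_eq, OfNat.ofNat_ne_zero, not_false_eq_true, zero_pow] at h1
  have h2 := h1.unique hasSum_zero
  have hLn : 1 / L ^ n ≠ 0 := by positivity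
  exact (mul_eq_zero.mp h2).resolve_left hLn

/-- The scalar prefactor of `U` times that of differentiation on the Fourier side. The sign cancels
against `m × (m × a) = m (m · a) - |m|² a`. -/
lemma I_mul_L_mul_I_mul_inv (hL : 0 < L) : Complex.I * ((L / (2 * Real.pi) : ℝ) : ℂ) *
    (Complex.I * ((2 * Real.pi / L : ℝ) : ℂ)) = -1 := by
  have h : ((L / (2 * Real.pi) : ℝ) : ℂ) * ((2 * Real.pi / L : ℝ) : ℂ) = 1 := by
    rw [← Complex.ofReal_mul, show L / (2 * Real.pi) * (2 * Real.pi / L) = 1 by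
      have := Real.pi_pos; field_simp]
    simp
  linear_combination (((L / (2 * Real.pi) : ℝ) : ℂ) * ((2 * Real.pi / L : ℝ) : ℂ)) *
    Complex.I_mul_I - h

lemma coeff_apply_zero_eq {v : E n → E n} (hv : Continuous v) (h : ∫ x in cell n L, v x = 0)
    (i : Fin n) : coeff L (fun x => v x i) 0 = 0 := by
  refine coeff_zero_eq _ ?_
  have := (EuclideanSpace.proj i : E n →L[ℝ] ℝ).integral_comp_comm
    (integrableOn_cell (L := L) hv)
  rw [h] at this
  simpa using this

lemma conj_coeff_mul (g : E n → ℝ) (m : Fin n → ℤ) (i : Fin n) :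
    (starRingEnd ℂ) (coeff L g (-m) * ((-m) i : ℂ)) = -(coeff L g m * (m i : ℂ)) := by
  rw [map_mul, coeff_conj]
  simp

lemma inv_normSqZ_mul {m : Fin n → ℤ} (hm : m ≠ 0) :
    ((1 / normSqZ m : ℝ) : ℂ) * ∑ i, (m i : ℂ) ^ 2 = 1 := by
  have h := one_le_normSqZ hm
  have h1 : ((normSqZ m : ℝ) : ℂ) = ∑ i, (m i : ℂ) ^ 2 := by simp [normSqZ]
  rw [← h1, ← Complex.ofReal_mul, one_div, inv_mul_cancel₀ (by linarith)]
  simp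

end Scalar

/-! ### The planar Biot-Savart law -/

section TwoDim

variable {L : ℝ}

lemma curl2_continuous {v : E 2 → E 2} (hv : ContDiff ℝ 1 v) : Continuous (curl2 v) := by
  have hvi : ∀ i, ContDiff ℝ 1 (fun x => v x i) := fun i => by fun_prop
  exact (dirD_contDiff (k := 0) (hvi 1) (by norm_num) (bv 0)).continuous.sub
    (dirD_contDiff (k := 0) (hvi 0) (by norm_num) (bv 1)).continuous

lemma curl2_periodic {v : E 2 → E 2} (hp : SpacePeriodic L v) : SpacePeriodic L (curl2 v) :=
  ((hp.comp fun y => y 1).dirD (bv 0)).comp₂ ((hp.comp fun y => y 0).dirD (bv 1)) fun a b => a - b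

lemma biotSavart2_summable (hL : 0 < L) {ω : E 2 → ℝ} (hω : ContDiff ℝ 2 ω)
    (hωp : SpacePeriodic L ω) (j : Fin 2) : Summable fun m : Fin 2 → ℤ =>
      ‖((1 / normSqZ m : ℝ) : ℂ) * (coeff L ω m * (m j : ℂ))‖ :=
  summable_coeff_div hL (by norm_num) hω hωp j

lemma biotSavart2_continuous (hL : 0 < L) {ω : E 2 → ℝ} (hω : ContDiff ℝ 2 ω)
    (hωp : SpacePeriodic L ω) : Continuous (biotSavart2 L ω) := by
  refine (PiLp.continuous_toLp 2 _).comp (continuous_pi fun i => ?_)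
  fin_cases i
  · exact continuous_potentialSeries (biotSavart2_summable hL hω hωp 1)
      fun m => conj_coeff_mul ω m 1
  · exact (continuous_potentialSeries (biotSavart2_summable hL hω hωp 0)
      fun m => conj_coeff_mul ω m 0).neg

lemma biotSavart2_periodic (hL : 0 < L) (ω : E 2 → ℝ) : SpacePeriodic L (biotSavart2 L ω) := by
  intro x i
  simp only [biotSavart2, potentialSeries_periodic hL.ne' _ x i]

lemma coeff_curl2 (hL : 0 < L) {v : E 2 → E 2} (hv : ContDiff ℝ 1 v) (hp : SpacePeriodic L v)
    (m : Fin 2 → ℤ) : coeff L (curl2 v) m = Complex.I * ((2 * Real.pi / L : ℝ) : ℂ) *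
      ((m 0 : ℂ) * coeff L (fun x => v x 1) m - (m 1 : ℂ) * coeff L (fun x => v x 0) m) :=
  coeff_partial_sub hL hv hp 0 1 m

/-- A divergence-free `v` of zero mean is recovered from its curl, so `v - U ω` is `U` of the defect
`curl v - ω`. No zero mean of `ω` is required, because the symbol of `U` is zero at `m = 0`. -/
theorem integral_sq_sub_biotSavart2_le (hL : 0 < L) {v : E 2 → E 2} {ω : E 2 → ℝ}
    (hv : ContDiff ℝ 1 v) (hvp : SpacePeriodic L v) (hdiv : ∀ x, divergence v x = 0)
    (hmean : ∫ x in cell 2 L, v x = 0) (hω : ContDiff ℝ 2 ω) (hωp : SpacePeriodic L ω) :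
    ∫ x in cell 2 L, ‖v x - biotSavart2 L ω x‖ ^ 2 ≤
      4 * (L / (2 * Real.pi)) ^ 2 * ∫ x in cell 2 L, ‖curl2 v x - ω x‖ ^ 2 := by
  have hvc : ∀ i, Continuous (fun x => v x i) := fun i => by have := hv.continuous; fun_prop
  have hm0 := coeff_apply_zero_eq hv.continuous hmean
  have hηc : Continuous fun x => curl2 v x - ω x := (curl2_continuous hv).sub hω.continuous
  have hηp : SpacePeriodic L fun x => curl2 v x - ω x := (curl2_periodic hvp).comp₂ hωp (· - ·)
  have hcη : ∀ m, coeff L (fun x => curl2 v x - ω x) m = Complex.I * ((2 * Real.pi / L : ℝ) : ℂ) *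
      ((m 0 : ℂ) * coeff L (fun x => v x 1) m - (m 1 : ℂ) * coeff L (fun x => v x 0) m)
      - coeff L ω m := fun m => by
    rw [coeff_sub (curl2_continuous hv) hω.continuous, coeff_curl2 hL hv hvp]
  have hz : Continuous fun _ : E 2 => (0 : ℝ) := continuous_const
  have hzp : SpacePeriodic L fun _ : E 2 => (0 : ℝ) := fun _ _ => rfl
  have hz0 : ∀ m, coeff L (fun _ : E 2 => (0 : ℝ)) m = 0 := fun m => by simp [coeff]
  have hIK := I_mul_L_mul_I_mul_inv hL
  -- The planar vorticity is scalar, so the second defect in the general estimate is the zero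
  -- function. Each of the two velocity components contributes the factor `2`, hence the constant
  -- `4`.
  have e0 := integral_sq_sub_potentialSeries_le hL (hvc 0) hηc hz (hvp.comp fun y => y 0) hηp hzp
    (biotSavart2_summable hL hω hωp 1) (fun m => conj_coeff_mul ω m 1) 1 1 (fun m => by
      rw [hz0, hcη]
      by_cases hm : m = 0
      · subst hm; simp [normSqZ, hm0]
      have hρ := inv_normSqZ_mul hm
      have hd := sum_coeff_eq_zero_of_divergence hL hv hvp hdiv m
      rw [Fin.sum_univ_two] at hd hρ
      -- Uses `m₁ (m₀ v̂₁ - m₁ v̂₀) = -|m|² v̂₀`, which follows from `m · v̂ = 0`.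
      linear_combination (-(((1 / normSqZ m : ℝ) : ℂ) * m 1 * (m 0 * coeff L (fun x => v x 1) m -
        m 1 * coeff L (fun x => v x 0) m))) * hIK + ((1 / normSqZ m : ℝ) : ℂ) * m 0 * hd
        - coeff L (fun x => v x 0) m * hρ)
  -- The second component of `U ω` is minus a potential series, so it is compared through `-v₁`.
  have e1 := integral_sq_sub_potentialSeries_le hL (hvc 1).neg hηc hz
    (hvp.comp fun y => -y 1) hηp hzp
    (biotSavart2_summable hL hω hωp 0) (fun m => conj_coeff_mul ω m 0) 0 0 (fun m => by
      have hneg : coeff L (-fun x => v x 1) m = -coeff L (fun x => v x 1) m := by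
        have := coeff_sub (L := L) hz (hvc 1) m
        simp only [hz0, zero_sub] at this
        exact this
      rw [hz0, hcη, hneg]
      by_cases hm : m = 0
      · subst hm; simp [normSqZ, hm0]
      have hρ := inv_normSqZ_mul hm
      have hd := sum_coeff_eq_zero_of_divergence hL hv hvp hdiv m
      rw [Fin.sum_univ_two] at hd hρ
      linear_combination (-(((1 / normSqZ m : ℝ) : ℂ) * m 0 * (m 0 * coeff L (fun x => v x 1) m -
        m 1 * coeff L (fun x => v x 0) m))) * hIK - ((1 / normSqZ m : ℝ) : ℂ) * m 1 * hd
        + coeff L (fun x => v x 1) m * hρ)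
  have hp0 := continuous_potentialSeries (L := L) (biotSavart2_summable hL hω hωp 1)
    fun m => conj_coeff_mul ω m 1
  have hp1 := continuous_potentialSeries (L := L) (biotSavart2_summable hL hω hωp 0)
    fun m => conj_coeff_mul ω m 0
  have hsplit : ∀ x, ‖v x - biotSavart2 L ω x‖ ^ 2 =
      (v x 0 - potentialSeries L (fun m => coeff L ω m * (m 1 : ℂ)) x) ^ 2 +
      ((-fun x => v x 1) x - potentialSeries L (fun m => coeff L ω m * (m 0 : ℂ)) x) ^ 2 := by
    intro x
    rw [EuclideanSpace.real_norm_sq_eq, Fin.sum_univ_two]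
    simp only [biotSavart2, PiLp.sub_apply, Pi.neg_apply]
    simp
    ring
  simp only [hsplit]
  rw [integral_add (integrableOn_cell (((hvc 0).fun_sub hp0).fun_pow 2))
    (integrableOn_cell (((hvc 1).neg.fun_sub hp1).fun_pow 2))]
  simp only [Real.norm_eq_abs, sq_abs]
  simp only [ne_eq, OfNat.ofNat_ne_zero, not_false_eq_true, zero_pow, integral_zero,
    add_zero] at e0 e1
  linarith

/-- On the Fourier side `curl ∘ U` is the identity for `m ≠ 0` and zero at `m = 0`; this is why zero
mean is needed. Smoothness of `U ω` is assumed here: in the application it comes from the exact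
solution having this terminal value. -/
theorem curl2_biotSavart2 (hL : 0 < L) {ω : E 2 → ℝ} (hω : ContDiff ℝ 2 ω)
    (hωp : SpacePeriodic L ω) (hmean : ∫ x in cell 2 L, ω x = 0)
    (hU : ContDiff ℝ 1 (biotSavart2 L ω)) :
    ∫ x in cell 2 L, ‖curl2 (biotSavart2 L ω) x - ω x‖ ^ 2 = 0 := by
  have hUp := biotSavart2_periodic hL ω
  simp only [Real.norm_eq_abs, sq_abs]
  refine integral_sq_eq_zero_of_coeff hL ((curl2_continuous hU).sub hω.continuous)
    ((curl2_periodic hUp).comp₂ hωp (· - ·)) fun m => ?_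
  rw [coeff_sub (curl2_continuous hU) hω.continuous, coeff_curl2 hL hU hUp]
  have h0 : coeff L (fun x => biotSavart2 L ω x 0) m = _ :=
    coeff_potentialSeries (biotSavart2_summable hL hω hωp 1) (fun m => conj_coeff_mul ω m 1) hL m
  have h1 : coeff L (fun x => biotSavart2 L ω x 1) m =
      -(Complex.I * ((L / (2 * Real.pi) : ℝ) : ℂ) *
        (((1 / normSqZ m : ℝ) : ℂ) * (coeff L ω m * (m 0 : ℂ)))) := by
    have hp1 := continuous_potentialSeries (L := L) (biotSavart2_summable hL hω hωp 0)
      fun m => conj_coeff_mul ω m 0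
    have := coeff_sub (L := L) (continuous_const (y := (0 : ℝ))) hp1 m
    rw [coeff_potentialSeries (biotSavart2_summable hL hω hωp 0)
      (fun m => conj_coeff_mul ω m 0) hL m, show coeff L (fun _ : E 2 => (0 : ℝ)) m = 0 by
        simp [coeff], zero_sub] at this
    rw [← this]
    simp [biotSavart2]
  rw [h0, h1]
  by_cases hm : m = 0
  · subst hm
    simp [coeff_zero_eq ω hmean]
  have hρ := inv_normSqZ_mul hm
  rw [Fin.sum_univ_two] at hρ
  have hIK := I_mul_L_mul_I_mul_inv hL
  linear_combination -(((1 / normSqZ m : ℝ) : ℂ) * (m 0 ^ 2 + m 1 ^ 2) * coeff L ω m) * hIK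
    + coeff L ω m * hρ

end TwoDim

/-! ### The Biot-Savart law in dimension three -/

section ThreeDim

variable {L : ℝ}

/-- Indices are cyclic in `Fin 3`: with `b = a + 1` and `c = a + 2` one computation serves all three
components. -/
lemma curl3_apply (v : E 3 → E 3) (x : E 3) : ∀ a b c : Fin 3, b = a + 1 → c = a + 2 →
    curl3 v x a = partialD b c v x - partialD c b v x := by
  intro a b c hb hc
  subst hb hc
  fin_cases a <;> rfl

lemma partialD_continuous {n : ℕ} {v : E n → E n} (hv : ContDiff ℝ 1 v) (i j : Fin n) :
    Continuous (partialD i j v) :=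
  (dirD_contDiff (k := 0) (m := 1) (g := fun y => v y j) (by fun_prop) (by norm_num) (bv i)).continuous

lemma curl3_continuous {v : E 3 → E 3} (hv : ContDiff ℝ 1 v) : Continuous (curl3 v) := by
  refine (PiLp.continuous_toLp 2 _).comp (continuous_pi fun i => ?_)
  fin_cases i
  · exact (partialD_continuous hv 1 2).sub (partialD_continuous hv 2 1)
  · exact (partialD_continuous hv 2 0).sub (partialD_continuous hv 0 2)
  · exact (partialD_continuous hv 0 1).sub (partialD_continuous hv 1 0)

lemma partialD_periodic {n : ℕ} {v : E n → E n} (hp : SpacePeriodic L v) (i j : Fin n) :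
    SpacePeriodic L (partialD i j v) := (hp.comp fun y => y j).dirD (bv i)

lemma curl3_periodic {v : E 3 → E 3} (hp : SpacePeriodic L v) : SpacePeriodic L (curl3 v) := by
  intro x i
  simp only [curl3, partialD_periodic hp _ _ x i]

lemma biotSavart3_summable (hL : 0 < L) {ω : E 3 → E 3} (hω : ContDiff ℝ 2 ω)
    (hωp : SpacePeriodic L ω) (b c : Fin 3) : Summable fun m : Fin 3 → ℤ =>
      ‖((1 / normSqZ m : ℝ) : ℂ) * (coeff L (fun y => ω y c) m * (m b : ℂ) -
        coeff L (fun y => ω y b) m * (m c : ℂ))‖ := by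
  have h1 := summable_coeff_div hL (by norm_num) (g := fun y => ω y c) (by fun_prop)
    (hωp.comp fun y => y c) b
  have h2 := summable_coeff_div hL (by norm_num) (g := fun y => ω y b) (by fun_prop)
    (hωp.comp fun y => y b) c
  refine Summable.of_nonneg_of_le (fun m => norm_nonneg _) (fun m => ?_) (h1.add h2)
  rw [mul_sub]
  exact norm_sub_le _ _

lemma biotSavart3_conj (ω : E 3 → E 3) (b c : Fin 3) (m : Fin 3 → ℤ) :
    (starRingEnd ℂ) (coeff L (fun y => ω y c) (-m) * ((-m) b : ℂ) -
        coeff L (fun y => ω y b) (-m) * ((-m) c : ℂ)) =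
      -(coeff L (fun y => ω y c) m * (m b : ℂ) - coeff L (fun y => ω y b) m * (m c : ℂ)) := by
  rw [map_sub, conj_coeff_mul, conj_coeff_mul]
  ring

lemma biotSavart3_apply (ω : E 3 → E 3) (x : E 3) : ∀ a b c : Fin 3, b = a + 1 → c = a + 2 →
    biotSavart3 L ω x a = potentialSeries L (fun m =>
      coeff L (fun y => ω y c) m * (m b : ℂ) - coeff L (fun y => ω y b) m * (m c : ℂ)) x := by
  intro a b c hb hc
  subst hb hc
  fin_cases a <;> rfl

lemma biotSavart3_continuous (hL : 0 < L) {ω : E 3 → E 3} (hω : ContDiff ℝ 2 ω)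
    (hωp : SpacePeriodic L ω) : Continuous (biotSavart3 L ω) := by
  refine (PiLp.continuous_toLp 2 _).comp (continuous_pi fun i => ?_)
  fin_cases i <;>
  exact continuous_potentialSeries (biotSavart3_summable hL hω hωp _ _) (biotSavart3_conj ω _ _)

lemma biotSavart3_periodic (hL : 0 < L) (ω : E 3 → E 3) : SpacePeriodic L (biotSavart3 L ω) := by
  intro x i
  simp only [biotSavart3, potentialSeries_periodic hL.ne' _ x i]

lemma sum_fin3 {R : Type*} [AddCommMonoid R] (f : Fin 3 → R) {a b c : Fin 3} (hb : b = a + 1)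
    (hc : c = a + 2) : ∑ i, f i = f a + f b + f c := by
  subst hb hc
  fin_cases a
  · exact Fin.sum_univ_three f
  · rw [Fin.sum_univ_three, add_assoc, add_comm]; rfl
  · rw [Fin.sum_univ_three, add_comm, ← add_assoc]; rfl

lemma coeff_curl3 (hL : 0 < L) {v : E 3 → E 3} (hv : ContDiff ℝ 1 v) (hp : SpacePeriodic L v)
    {a b c : Fin 3} (hb : b = a + 1) (hc : c = a + 2) (m : Fin 3 → ℤ) :
    coeff L (fun x => curl3 v x a) m = Complex.I * ((2 * Real.pi / L : ℝ) : ℂ) *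
      ((m b : ℂ) * coeff L (fun x => v x c) m - (m c : ℂ) * coeff L (fun x => v x b) m) := by
  simp only [curl3_apply v _ a b c hb hc]
  exact coeff_partial_sub hL hv hp b c m

lemma integral_sq_sub_biotSavart3_apply_le (hL : 0 < L) {v ω : E 3 → E 3}
    (hv : ContDiff ℝ 1 v) (hvp : SpacePeriodic L v) (hdiv : ∀ x, divergence v x = 0)
    (hmean : ∫ x in cell 3 L, v x = 0) (hω : ContDiff ℝ 2 ω) (hωp : SpacePeriodic L ω)
    {a b c : Fin 3} (hb : b = a + 1) (hc : c = a + 2) :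
    ∫ x in cell 3 L, (v x a - biotSavart3 L ω x a) ^ 2 ≤ 2 * (L / (2 * Real.pi)) ^ 2 *
      ((∫ x in cell 3 L, (curl3 v x c - ω x c) ^ 2) +
        ∫ x in cell 3 L, (curl3 v x b - ω x b) ^ 2) := by
  have hvc : ∀ i, Continuous (fun x => v x i) := fun i => by have := hv.continuous; fun_prop
  have hωc : ∀ i, Continuous (fun x => ω x i) := fun i => by have := hω.continuous; fun_prop
  have hcc : ∀ i, Continuous (fun x => curl3 v x i) := fun i => by
    exact (EuclideanSpace.proj i : E 3 →L[ℝ] ℝ).continuous.comp (curl3_continuous hv)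
  have hper : ∀ i, SpacePeriodic L (fun x => curl3 v x i - ω x i) := fun i =>
    (curl3_periodic hvp).comp₂ hωp fun y z => y i - z i
  have hm0 := coeff_apply_zero_eq hv.continuous hmean
  have hIK := I_mul_L_mul_I_mul_inv hL
  simp only [biotSavart3_apply ω _ a b c hb hc]
  refine integral_sq_sub_potentialSeries_le (h := fun x => curl3 v x c - ω x c)
    (k := fun x => curl3 v x b - ω x b) hL (hvc a) ((hcc c).sub (hωc c))
    ((hcc b).sub (hωc b)) (hvp.comp fun y => y a) (hper c) (hper b)
    (biotSavart3_summable hL hω hωp b c) (biotSavart3_conj ω b c) b c fun m => ?_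
  rw [coeff_sub (hcc c) (hωc c), coeff_sub (hcc b) (hωc b),
    coeff_curl3 hL hv hvp (a := c) (b := a) (c := b) (by subst hc; fin_cases a <;> rfl)
      (by subst hb hc; fin_cases a <;> rfl),
    coeff_curl3 hL hv hvp (a := b) (b := c) (c := a) (by subst hb hc; fin_cases a <;> rfl)
      (by subst hb; fin_cases a <;> rfl)]
  by_cases hm : m = 0
  · subst hm; simp [normSqZ, hm0]
  have hρ := inv_normSqZ_mul hm
  have hd := sum_coeff_eq_zero_of_divergence hL hv hvp hdiv m
  rw [sum_fin3 _ hb hc] at hd hρ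
  linear_combination (-(((1 / normSqZ m : ℝ) : ℂ) *
    (m b * (m a * coeff L (fun x => v x b) m - m b * coeff L (fun x => v x a) m) -
    m c * (m c * coeff L (fun x => v x a) m - m a * coeff L (fun x => v x c) m)))) * hIK
    + ((1 / normSqZ m : ℝ) : ℂ) * m a * hd - coeff L (fun x => v x a) m * hρ

lemma integral_norm_sq_eq_sum {n : ℕ} {g : E n → E n} (hg : Continuous g) :
    ∫ x in cell n L, ‖g x‖ ^ 2 = ∑ i, ∫ x in cell n L, (g x i) ^ 2 := by
  simp only [EuclideanSpace.real_norm_sq_eq]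
  exact integral_finsetSum _ fun i _ => integrableOn_cell (by fun_prop)

/-- Every component of the vorticity defect enters two of the three componentwise estimates, which
doubles the constant `2` to `4`. -/
theorem integral_sq_sub_biotSavart3_le (hL : 0 < L) {v ω : E 3 → E 3}
    (hv : ContDiff ℝ 1 v) (hvp : SpacePeriodic L v) (hdiv : ∀ x, divergence v x = 0)
    (hmean : ∫ x in cell 3 L, v x = 0) (hω : ContDiff ℝ 2 ω) (hωp : SpacePeriodic L ω) :
    ∫ x in cell 3 L, ‖v x - biotSavart3 L ω x‖ ^ 2 ≤
      4 * (L / (2 * Real.pi)) ^ 2 * ∫ x in cell 3 L, ‖curl3 v x - ω x‖ ^ 2 := by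
  have h : ∀ {a b c : Fin 3}, b = a + 1 → c = a + 2 → _ := fun {a b c} hb hc =>
    integral_sq_sub_biotSavart3_apply_le hL hv hvp hdiv hmean hω hωp (a := a) (b := b) (c := c)
      hb hc
  rw [integral_norm_sq_eq_sum (hv.continuous.fun_sub (biotSavart3_continuous hL hω hωp)),
    integral_norm_sq_eq_sum ((curl3_continuous hv).fun_sub hω.continuous)]
  simp only [PiLp.sub_apply, Fin.sum_univ_three]
  have h0 := h (a := 0) rfl rfl
  have h1 := h (a := 1) rfl rfl
  have h2 := h (a := 2) rfl rfl
  simp only [Fin.isValue, show (0 : Fin 3) + 1 = 1 from rfl, show (0 : Fin 3) + 2 = 2 from rfl,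
    show (1 : Fin 3) + 1 = 2 from rfl, show (1 : Fin 3) + 2 = 0 from rfl,
    show (2 : Fin 3) + 1 = 0 from rfl, show (2 : Fin 3) + 2 = 1 from rfl] at h0 h1 h2
  linarith

/-- The coefficient of `curl (U ω)` is `ω̂ - |m|⁻² m (m · ω̂)` for `m ≠ 0`: the projection onto
divergence-free fields. Zero divergence and zero mean of `ω` make it the identity. -/
theorem curl3_biotSavart3 (hL : 0 < L) {ω : E 3 → E 3} (hω : ContDiff ℝ 2 ω)
    (hωp : SpacePeriodic L ω) (hmean : ∫ x in cell 3 L, ω x = 0)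
    (hdiv : ∀ x, divergence ω x = 0) (hU : ContDiff ℝ 1 (biotSavart3 L ω)) :
    ∫ x in cell 3 L, ‖curl3 (biotSavart3 L ω) x - ω x‖ ^ 2 = 0 := by
  have hUp := biotSavart3_periodic hL ω
  have hωc : ∀ i, Continuous (fun x => ω x i) := fun i => by have := hω.continuous; fun_prop
  have hcc : ∀ i, Continuous (fun x => curl3 (biotSavart3 L ω) x i) := fun i => by
    exact (EuclideanSpace.proj i : E 3 →L[ℝ] ℝ).continuous.comp (curl3_continuous hU)
  have hU1 : ∀ {a b c : Fin 3}, b = a + 1 → c = a + 2 → ∀ m,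
      coeff L (fun x => biotSavart3 L ω x a) m = _ := fun {a b c} hb hc m => by
    simp only [biotSavart3_apply ω _ a b c hb hc]
    exact coeff_potentialSeries (biotSavart3_summable hL hω hωp b c) (biotSavart3_conj ω b c) hL m
  rw [integral_norm_sq_eq_sum ((curl3_continuous hU).fun_sub hω.continuous)]
  refine Finset.sum_eq_zero fun a _ => ?_
  obtain ⟨b, hb⟩ : ∃ b, b = a + 1 := ⟨_, rfl⟩
  obtain ⟨c, hc⟩ : ∃ c, c = a + 2 := ⟨_, rfl⟩
  refine integral_sq_eq_zero_of_coeff hL ((hcc a).sub (hωc a))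
    ((curl3_periodic hUp).comp₂ hωp fun y z => y a - z a) fun m => ?_
  change coeff L (fun x => curl3 (biotSavart3 L ω) x a - ω x a) m = 0
  rw [coeff_sub (hcc a) (hωc a), coeff_curl3 hL hU hUp hb hc,
    hU1 (a := c) (b := a) (c := b) (by subst hc; fin_cases a <;> rfl)
      (by subst hb hc; fin_cases a <;> rfl),
    hU1 (a := b) (b := c) (c := a) (by subst hb hc; fin_cases a <;> rfl)
      (by subst hb; fin_cases a <;> rfl)]
  by_cases hm : m = 0
  · subst hm
    simp [coeff_apply_zero_eq hω.continuous hmean]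
  have hρ := inv_normSqZ_mul hm
  have hd := sum_coeff_eq_zero_of_divergence hL (hω.of_le (by norm_num)) hωp hdiv m
  rw [sum_fin3 _ hb hc] at hρ hd
  have hIK := I_mul_L_mul_I_mul_inv hL
  linear_combination (((1 / normSqZ m : ℝ) : ℂ) *
    (m b * (coeff L (fun x => ω x b) m * m a - coeff L (fun x => ω x a) m * m b) -
    m c * (coeff L (fun x => ω x a) m * m c - coeff L (fun x => ω x c) m * m a))) * hIK
    + coeff L (fun x => ω x a) m * hρ - ((1 / normSqZ m : ℝ) : ℂ) * m a * hd

end ThreeDim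

end

/-! ### Time dependent fields -/

section

/-- The time-space slab `[a, b] × ℝⁿ`. -/
def slab (n : ℕ) (a b : ℝ) : Set (ℝ × E n) := Icc a b ×ˢ univ

section Slab

variable {n : ℕ} {L a b : ℝ} {F : Type*} [NormedAddCommGroup F] [NormedSpace ℝ F]
  {V : ℝ → E n → F}

lemma uniqueDiffOn_slab (hab : a < b) : UniqueDiffOn ℝ (slab n a b) :=
  (uniqueDiffOn_Icc hab).prod uniqueDiffOn_univ

lemma slab_mem_nhds {t : ℝ} (ht : t ∈ Ioo a b) (x : E n) : slab n a b ∈ nhds (t, x) :=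
  prod_mem_nhds (Icc_mem_nhds ht.1 ht.2) Filter.univ_mem

lemma slab_mono {a' b' : ℝ} (h : Icc a' b' ⊆ Icc a b) : slab n a' b' ⊆ slab n a b :=
  prod_mono h subset_rfl

lemma contDiff_slice {k : WithTop ℕ∞} (hV : ContDiffOn ℝ k (fun z : ℝ × E n => V z.1 z.2) (slab n a b))
    {t : ℝ} (ht : t ∈ Icc a b) : ContDiff ℝ k (V t) := by
  rw [← contDiffOn_univ]
  exact hV.comp (f := fun x : E n => (t, x)) (by fun_prop) fun x _ => ⟨ht, mem_univ x⟩

lemma fderiv_slice (hV : ContDiffOn ℝ 1 (fun z : ℝ × E n => V z.1 z.2) (slab n a b))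
    {t : ℝ} (ht : t ∈ Icc a b) (x : E n) : fderiv ℝ (V t) x =
      (fderivWithin ℝ (fun z : ℝ × E n => V z.1 z.2) (slab n a b) (t, x)).comp
        (ContinuousLinearMap.inr ℝ ℝ (E n)) := by
  have h1 := ((hV.differentiableOn one_ne_zero) (t, x) ⟨ht, mem_univ x⟩).hasFDerivWithinAt
  have h2 : HasFDerivWithinAt (fun y : E n => (t, y)) (ContinuousLinearMap.inr ℝ ℝ (E n)) univ x :=
    (hasFDerivAt_prodMk_right t x).hasFDerivWithinAt
  have h3 := h1.comp x h2 (fun y _ => ⟨ht, mem_univ y⟩)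
  rw [hasFDerivWithinAt_univ] at h3
  exact h3.fderiv

lemma contDiffOn_fderiv_slice (hab : a < b) {k m : WithTop ℕ∞} (hk : k + 1 ≤ m)
    (hV : ContDiffOn ℝ m (fun z : ℝ × E n => V z.1 z.2) (slab n a b)) :
    ContDiffOn ℝ k (fun z : ℝ × E n => fderiv ℝ (V z.1) z.2) (slab n a b) := by
  have h1 := hV.fderivWithin (uniqueDiffOn_slab hab) hk
  have h2 : ContDiffOn ℝ k (fun z : ℝ × E n =>
      (fderivWithin ℝ (fun z : ℝ × E n => V z.1 z.2) (slab n a b) z).comp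
        (ContinuousLinearMap.inr ℝ ℝ (E n))) (slab n a b) := h1.clm_comp contDiffOn_const
  refine h2.congr fun z hz => ?_
  exact fderiv_slice (hV.of_le (le_trans le_add_self hk)) hz.1 z.2

lemma hasDerivWithinAt_slice (hV : ContDiffOn ℝ 1 (fun z : ℝ × E n => V z.1 z.2) (slab n a b))
    {t : ℝ} (ht : t ∈ Icc a b) (x : E n) : HasDerivWithinAt (fun s => V s x)
      (fderivWithin ℝ (fun z : ℝ × E n => V z.1 z.2) (slab n a b) (t, x) (1, 0)) (Icc a b) t := by
  have h1 := ((hV.differentiableOn one_ne_zero) (t, x) ⟨ht, mem_univ x⟩).hasFDerivWithinAt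
  have h2 : HasDerivWithinAt (fun s : ℝ => (s, x)) ((1 : ℝ), (0 : E n)) (Icc a b) t :=
    (hasDerivWithinAt_id t _).prodMk (hasDerivWithinAt_const t _ x)
  have hm : MapsTo (fun s : ℝ => (s, x)) (Icc a b) (slab n a b) := fun s hs => ⟨hs, mem_univ x⟩
  exact h1.comp_hasDerivWithinAt t h2 hm

lemma hasDerivAt_slice (hV : ContDiffOn ℝ 1 (fun z : ℝ × E n => V z.1 z.2) (slab n a b))
    {t : ℝ} (ht : t ∈ Ioo a b) (x : E n) : HasDerivAt (fun s => V s x)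
      (fderivWithin ℝ (fun z : ℝ × E n => V z.1 z.2) (slab n a b) (t, x) (1, 0)) t :=
  (hasDerivWithinAt_slice hV (Ioo_subset_Icc_self ht) x).hasDerivAt (Icc_mem_nhds ht.1 ht.2)

/-- Exchange of the time derivative with the space derivative, from symmetry of the second
derivative in `(t, x)` at interior times. It allows an evolution equation to be differentiated in
space. -/
lemma hasDerivAt_fderiv_slice
    (hV : ContDiffOn ℝ 2 (fun z : ℝ × E n => V z.1 z.2) (slab n a b)) {t : ℝ} (ht : t ∈ Ioo a b)
    (x : E n) {V' : E n → F} (hV' : ∀ y, HasDerivAt (fun s => V s y) (V' y) t) :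
    HasDerivAt (fun s => fderiv ℝ (V s) x) (fderiv ℝ V' x) t := by
  set W := fun z : ℝ × E n => V z.1 z.2 with hW
  have hV1 : ContDiffOn ℝ 1 W (slab n a b) := hV.of_le (by norm_num)
  have hWat : ∀ y, ContDiffAt ℝ 2 W (t, y) := fun y => hV.contDiffAt (slab_mem_nhds ht y)
  have hDW : ∀ y, HasFDerivAt (fderiv ℝ W) (fderiv ℝ (fderiv ℝ W) (t, y)) (t, y) := fun y =>
    (((hWat y).fderiv_right (m := 1) (by norm_num)).differentiableAt one_ne_zero).hasFDerivAt
  have hev : ∀ s ∈ Ioo a b, ∀ y, fderivWithin ℝ W (slab n a b) (s, y) = fderiv ℝ W (s, y) :=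
    fun s hs y => fderivWithin_of_mem_nhds (slab_mem_nhds hs y)
  have h1 : (fun s => fderiv ℝ (V s) x) =ᶠ[nhds t]
      fun s => (fderiv ℝ W (s, x)).comp (ContinuousLinearMap.inr ℝ ℝ (E n)) := by
    filter_upwards [Ioo_mem_nhds ht.1 ht.2] with s hs
    rw [fderiv_slice hV1 (Ioo_subset_Icc_self hs) x, ← hW, hev s hs]
  have h2 : HasDerivAt (fun s : ℝ => (s, x)) ((1 : ℝ), (0 : E n)) t :=
    (hasDerivAt_id t).prodMk (hasDerivAt_const t x)
  have h3 : HasDerivAt (fun s => fderiv ℝ W (s, x)) (fderiv ℝ (fderiv ℝ W) (t, x) (1, 0)) t :=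
    (hDW x).comp_hasDerivAt t h2
  have h4 := h3.clm_comp (hasDerivAt_const t (ContinuousLinearMap.inr ℝ ℝ (E n)))
  refine (h4.congr_of_eventuallyEq h1).congr_deriv ?_
  have h5 : V' = fun y => fderiv ℝ W (t, y) (1, 0) := by
    ext y
    rw [← hev t ht y]
    exact (hV' y).unique (hasDerivAt_slice hV1 ht y)
  have h6 : HasFDerivAt (fun y => fderiv ℝ W (t, y))
      ((fderiv ℝ (fderiv ℝ W) (t, x)).comp (ContinuousLinearMap.inr ℝ ℝ (E n))) x :=
    (hDW x).comp x (hasFDerivAt_prodMk_right t x)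
  have h7 := (h6.clm_apply (hasFDerivAt_const ((1 : ℝ), (0 : E n)) x)).fderiv
  rw [h5, h7]
  ext h
  simp only [ContinuousLinearMap.comp_zero, add_zero, zero_add, ContinuousLinearMap.comp_apply,
    ContinuousLinearMap.inr_apply, ContinuousLinearMap.flip_apply]
  exact ((hWat x).isSymmSndFDerivAt (by simp)).eq _ _

lemma continuousOn_integral_cell {g : ℝ → E n → F}
    (hg : ContinuousOn (fun z : ℝ × E n => g z.1 z.2) (slab n a b)) :
    ContinuousOn (fun t => ∫ x in cell n L, g t x) (Icc a b) := by
  obtain ⟨A, hA⟩ := (isCompact_Icc.prod isCompact_closedCell).exists_bound_of_continuousOn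
    (f := fun z : ℝ × E n => g z.1 z.2) (s := Icc a b ×ˢ closedCell n L)
    (hg.mono (prod_mono subset_rfl (subset_univ _)))
  have hc : ∀ t ∈ Icc a b, Continuous (g t) := fun t ht => by
    rw [← continuousOn_univ]
    exact hg.comp (f := fun x : E n => (t, x)) (by fun_prop) fun x _ => ⟨ht, mem_univ x⟩
  refine continuousOn_of_dominated (bound := fun _ => A) (fun t ht => ?_) (fun t ht => ?_)
    (integrable_const _) ?_
  · exact (hc t ht).aestronglyMeasurable
  · filter_upwards [ae_restrict_mem measurableSet_cell] with x hx
    exact hA (t, x) ⟨ht, cell_subset_closedCell hx⟩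
  · refine Filter.Eventually.of_forall fun x => ?_
    exact hg.comp (f := fun t : ℝ => (t, x)) (by fun_prop) fun t ht => ⟨ht, mem_univ x⟩

/-- Differentiation under the integral; the dominating constant is a bound for the time derivative
on the compact set `[a, b]` times the closed cell. -/
theorem hasDerivAt_integral_cell (hab : a < b)
    (hV : ContDiffOn ℝ 1 (fun z : ℝ × E n => V z.1 z.2) (slab n a b)) {t : ℝ} (ht : t ∈ Ioo a b)
    {V' : E n → F} (hV' : ∀ x, HasDerivAt (fun s => V s x) (V' x) t) :
    HasDerivAt (fun s => ∫ x in cell n L, V s x) (∫ x in cell n L, V' x) t := by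
  set W := fun z : ℝ × E n => V z.1 z.2
  set D : ℝ → E n → F := fun s x => fderivWithin ℝ W (slab n a b) (s, x) (1, 0)
  have hD : ContinuousOn (fun z : ℝ × E n => D z.1 z.2) (slab n a b) :=
    (hV.continuousOn_fderivWithin (uniqueDiffOn_slab hab) le_rfl).clm_apply continuousOn_const
  obtain ⟨A, hA⟩ := (isCompact_Icc.prod isCompact_closedCell).exists_bound_of_continuousOn
    (f := fun z : ℝ × E n => D z.1 z.2) (s := Icc a b ×ˢ closedCell n L)
    (hD.mono (prod_mono subset_rfl (subset_univ _)))
  have hVD : V' = D t := by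
    ext x
    exact (hV' x).unique (hasDerivAt_slice hV ht x)
  have hDt : Continuous (D t) := by
    rw [← continuousOn_univ]
    exact hD.comp (f := fun x : E n => (t, x)) (by fun_prop)
      fun x _ => ⟨Ioo_subset_Icc_self ht, mem_univ x⟩
  rw [hVD]
  refine (hasDerivAt_integral_of_dominated_loc_of_deriv_le (bound := fun _ => A) (F' := D)
    (Ioo_mem_nhds ht.1 ht.2) ?_ ?_ ?_ ?_ (integrable_const _) ?_).2
  · filter_upwards [Ioo_mem_nhds ht.1 ht.2] with s hs
    exact (contDiff_slice hV (Ioo_subset_Icc_self hs)).continuous.aestronglyMeasurable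
  · exact integrableOn_cell (contDiff_slice hV (Ioo_subset_Icc_self ht)).continuous
  · exact hDt.aestronglyMeasurable
  · filter_upwards [ae_restrict_mem measurableSet_cell] with x hx s hs
    exact hA (s, x) ⟨Ioo_subset_Icc_self hs, cell_subset_closedCell hx⟩
  · exact Filter.Eventually.of_forall fun x s hs => hasDerivAt_slice hV hs x

end Slab

/-! ### The energy estimate -/

/-- A backward Grönwall inequality. -/
lemma backward_gronwall {a b κ β : ℝ} (hκ : 0 ≤ κ) (hβ : 0 ≤ β) {y y' : ℝ → ℝ}
    (hy : ContinuousOn y (Icc a b)) (hd : ∀ t ∈ Ioo a b, HasDerivAt y (y' t) t)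
    (hle : ∀ t ∈ Ioo a b, -(κ * y t + β) ≤ y' t) {t : ℝ} (ht : t ∈ Icc a b) :
    y t ≤ Real.exp (κ * (b - t)) * (y b + β * (b - t)) := by
  -- The lower bound on `y'` makes `ψ` monotone: its derivative is at least `β (e^{κb} - e^{κt}) ≥
  -- 0`. Comparing `ψ t` with `ψ b` gives the claim.
  set ψ : ℝ → ℝ := fun t => Real.exp (κ * t) * y t + β * Real.exp (κ * b) * t
  have hψd : ∀ t ∈ Ioo a b, HasDerivAt ψ (Real.exp (κ * t) * κ * y t + Real.exp (κ * t) * y' t +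
      β * Real.exp (κ * b)) t := by
    intro t ht
    have h1 : HasDerivAt (fun t => Real.exp (κ * t)) (Real.exp (κ * t) * κ) t := by
      simpa using ((hasDerivAt_id t).const_mul κ).exp
    have h2 := (h1.mul (hd t ht)).add ((hasDerivAt_id t).const_mul (β * Real.exp (κ * b)))
    refine h2.congr_deriv ?_
    simp
  have hmono : MonotoneOn ψ (Icc a b) := by
    refine monotoneOn_of_deriv_nonneg (convex_Icc a b) ?_ ?_ ?_
    · exact ((Continuous.continuousOn (by fun_prop)).mul hy).add
        (Continuous.continuousOn (by fun_prop))
    · rw [interior_Icc]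
      exact fun t ht => (hψd t ht).differentiableAt.differentiableWithinAt
    · rw [interior_Icc]
      intro t ht
      rw [(hψd t ht).deriv]
      have h1 := hle t ht
      have h2 : Real.exp (κ * t) ≤ Real.exp (κ * b) :=
        Real.exp_le_exp.mpr (mul_le_mul_of_nonneg_left ht.2.le hκ)
      have h3 := Real.exp_pos (κ * t)
      have h4 : 0 ≤ Real.exp (κ * t) * (y' t + (κ * y t + β)) := mul_nonneg h3.le (by linarith)
      nlinarith [mul_le_mul_of_nonneg_left h2 hβ]
  have hb : b ∈ Icc a b := ⟨ht.1.trans ht.2, le_rfl⟩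
  have h := hmono ht hb ht.2
  have he : Real.exp (κ * b) = Real.exp (κ * (b - t)) * Real.exp (κ * t) := by
    rw [← Real.exp_add]; ring_nf
  have h' : Real.exp (κ * t) * y t ≤
      Real.exp (κ * t) * (Real.exp (κ * (b - t)) * (y b + β * (b - t))) := by
    simp only [ψ] at h
    rw [he] at h
    linarith
  exact le_of_mul_le_mul_left h' (Real.exp_pos _)

section Energy

variable {n : ℕ} {L a b : ℝ} {F : Type*} [NormedAddCommGroup F] [InnerProductSpace ℝ F]
  [CompleteSpace F]

/-- Pair the equation with `2 η`: diffusion contributes a nonnegative term to `d/dt ∫ ‖η‖²`,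
transport contributes nothing, and `R` is controlled by hypothesis. Time runs backwards, so a lower
bound on the derivative is what Grönwall needs. -/
theorem energy_estimate (hL : 0 ≤ L) (hab : a < b) {c κ β : ℝ} (hc : 0 ≤ c) (hκ : 0 ≤ κ)
    (hβ : 0 ≤ β) {η R : ℝ → E n → F} {v : ℝ → E n → E n}
    (hη : ContDiffOn ℝ 2 (fun z : ℝ × E n => η z.1 z.2) (slab n a b))
    (hηp : ∀ t ∈ Icc a b, SpacePeriodic L (η t))
    (hv : ∀ t ∈ Ioo a b, ContDiff ℝ 1 (v t)) (hvp : ∀ t ∈ Ioo a b, SpacePeriodic L (v t))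
    (hdiv : ∀ t ∈ Ioo a b, ∀ x, divergence (v t) x = 0)
    (heq : ∀ t ∈ Ioo a b, ∀ x, HasDerivAt (fun s => η s x)
      (-(c • Laplacian.laplacian (η t) x) + advect (v t) (η t) x + R t x) t)
    (hR : ∀ t ∈ Ioo a b, Continuous (R t) → -(κ * (∫ x in cell n L, ‖η t x‖ ^ 2) + β) ≤
      2 * ∫ x in cell n L, ⟪η t x, R t x⟫) {t : ℝ} (ht : t ∈ Icc a b) :
    ∫ x in cell n L, ‖η t x‖ ^ 2 ≤
      Real.exp (κ * (b - t)) * ((∫ x in cell n L, ‖η b x‖ ^ 2) + β * (b - t)) := by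
  have hη1 : ContDiffOn ℝ 1 (fun z : ℝ × E n => η z.1 z.2) (slab n a b) := hη.of_le (by norm_num)
  have hsq : ContDiffOn ℝ 1 (fun z : ℝ × E n => ‖η z.1 z.2‖ ^ 2) (slab n a b) := hη1.norm_sq ℝ
  refine backward_gronwall (y := fun t => ∫ x in cell n L, ‖η t x‖ ^ 2)
    (y' := fun t => ∫ x in cell n L, 2 * ⟪η t x,
      -(c • Laplacian.laplacian (η t) x) + advect (v t) (η t) x + R t x⟫) hκ hβ
    (continuousOn_integral_cell (g := fun t x => ‖η t x‖ ^ 2) hsq.continuousOn) ?_ ?_ ht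
  · intro s hs
    refine hasDerivAt_integral_cell hab (V := fun t x => ‖η t x‖ ^ 2) hsq hs fun x => ?_
    exact (heq s hs x).norm_sq
  · intro s hs
    have hs' := Ioo_subset_Icc_self hs
    have hηs : ContDiff ℝ 2 (η s) := contDiff_slice hη hs'
    have hηs1 : ContDiff ℝ 1 (η s) := hηs.of_le (by norm_num)
    have cη := hηs.continuous
    have cΔ := continuous_laplacian hηs
    have cA : Continuous (advect (v s) (η s)) :=
      (hηs1.continuous_fderiv one_ne_zero).clm_apply (hv s hs).continuous
    -- The right-hand side equals the time derivative of a `C²` field, hence is continuous in `x`.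
    -- So `R` is continuous automatically, and the hypothesis on `R` may assume it.
    have cD : Continuous fun x =>
        -(c • Laplacian.laplacian (η s) x) + advect (v s) (η s) x + R s x := by
      have h1 : ContinuousOn (fun z : ℝ × E n =>
          fderivWithin ℝ (fun z : ℝ × E n => η z.1 z.2) (slab n a b) z (1, 0)) (slab n a b) :=
        (hη1.continuousOn_fderivWithin (uniqueDiffOn_slab hab) le_rfl).clm_apply
          continuousOn_const
      have h2 : Continuous fun x : E n =>
          fderivWithin ℝ (fun z : ℝ × E n => η z.1 z.2) (slab n a b) (s, x) (1, 0) := by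
        rw [← continuousOn_univ]
        exact h1.comp (f := fun x : E n => (s, x)) (by fun_prop) fun x _ => ⟨hs', mem_univ x⟩
      refine h2.congr fun x => ?_
      exact (hasDerivAt_slice hη1 hs x).unique (heq s hs x)
    have cR : Continuous (R s) := by
      refine (((cD.fun_add (cΔ.fun_const_smul c)).fun_sub cA)).congr fun x => ?_
      abel
    have hsplit : ∀ x, 2 * ⟪η s x, -(c • Laplacian.laplacian (η s) x) + advect (v s) (η s) x
        + R s x⟫ = -(2 * c) * ⟪η s x, Laplacian.laplacian (η s) x⟫ +
          2 * ⟪η s x, advect (v s) (η s) x⟫ + 2 * ⟪η s x, R s x⟫ := by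
      intro x
      rw [inner_add_right, inner_add_right, inner_neg_right, inner_smul_right]
      ring
    simp only [hsplit]
    have i1 : IntegrableOn (fun x => -(2 * c) * ⟪η s x, Laplacian.laplacian (η s) x⟫) (cell n L) :=
      integrableOn_cell (continuous_const.mul (cη.inner cΔ))
    have i2 : IntegrableOn (fun x => 2 * ⟪η s x, advect (v s) (η s) x⟫) (cell n L) :=
      integrableOn_cell (continuous_const.mul (cη.inner cA))
    have i3 : IntegrableOn (fun x => 2 * ⟪η s x, R s x⟫) (cell n L) :=
      integrableOn_cell (continuous_const.mul (cη.inner cR))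
    rw [integral_add (i1.fun_add i2) i3, integral_add i1 i2, integral_const_mul, integral_const_mul,
      integral_const_mul, integral_inner_advect_eq_zero hL (hv s hs) hηs1 (hvp s hs)
        (hηp s hs') (hdiv s hs)]
    have h1 := integral_inner_laplacian_nonpos hL hηs (hηp s hs')
    have h2 := hR s hs cR
    nlinarith [mul_nonneg hc (neg_nonneg.mpr h1)]

end Energy

end

/-! ### First order operators with constant coefficients -/

section

section DiffOp

variable {n : ℕ} {L : ℝ} {F : Type*} [NormedAddCommGroup F] [NormedSpace ℝ F]

/-- The first order differential operator `v ↦ C (Dv)`. -/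
def diffOp (C : (E n →L[ℝ] E n) →L[ℝ] F) (v : E n → E n) (x : E n) : F := C (fderiv ℝ v x)

variable (C : (E n →L[ℝ] E n) →L[ℝ] F)

lemma contDiff_diffOp {k m : WithTop ℕ∞} {v : E n → E n} (hv : ContDiff ℝ m v) (h : k + 1 ≤ m) :
    ContDiff ℝ k (diffOp C v) := C.contDiff.comp (hv.fderiv_right h)

lemma SpacePeriodic.diffOp {v : E n → E n} (hv : SpacePeriodic L v) :
    SpacePeriodic L (diffOp C v) := hv.fderiv.comp C

lemma fderiv_diffOp {v : E n → E n} (hv : ContDiff ℝ 2 v) (x h : E n) :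
    fderiv ℝ (diffOp C v) x h = C (fderiv ℝ (fderiv ℝ v) x h) := by
  have h1 : DifferentiableAt ℝ (fderiv ℝ v) x :=
    (hv.fderiv_right (m := 1) (by norm_num)).differentiable one_ne_zero x
  have h2 : HasFDerivAt (diffOp C v) (C.comp (fderiv ℝ (fderiv ℝ v) x)) x :=
    C.hasFDerivAt.comp x h1.hasFDerivAt
  rw [h2.fderiv]
  rfl

lemma dirD_diffOp {v : E n → E n} (hv : ContDiff ℝ 2 v) (e : E n) :
    dirD e (diffOp C v) = diffOp C (dirD e v) := by
  ext x
  rw [dirD, fderiv_diffOp C hv, diffOp]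
  congr 1
  ext1 h
  rw [fderiv_dirD hv, fderiv_fderiv_symm hv]

lemma laplacian_diffOp {v : E n → E n} (hv : ContDiff ℝ 3 v) (x : E n) :
    Laplacian.laplacian (diffOp C v) x = C (fderiv ℝ (Laplacian.laplacian v) x) := by
  have hv2 : ContDiff ℝ 2 v := hv.of_le (by norm_num)
  have h1 : ∀ e, ContDiff ℝ 2 (dirD e v) := fun e => dirD_contDiff hv (by norm_num) e
  have h2 : ∀ e, ContDiff ℝ 1 (dirD e (dirD e v)) := fun e => dirD_contDiff (h1 e) (by norm_num) e
  have h3 : Laplacian.laplacian v = fun x => ∑ i, dirD (bv i) (dirD (bv i) v) x :=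
    funext (laplacian_eq_sum hv2)
  rw [laplacian_eq_sum (contDiff_diffOp C hv (by norm_num)), h3, fderiv_fun_sum
    fun i _ => (h2 (bv i)).differentiable one_ne_zero x, map_sum]
  refine Finset.sum_congr rfl fun i _ => ?_
  rw [dirD_diffOp C hv2, dirD_diffOp C (h1 _)]
  rfl

lemma differentiable_laplacian {v : E n → F} (hv : ContDiff ℝ 3 v) :
    Differentiable ℝ (Laplacian.laplacian v) := by
  have hv2 : ContDiff ℝ 2 v := hv.of_le (by norm_num)
  have h3 : Laplacian.laplacian v = fun x => ∑ i, dirD (bv i) (dirD (bv i) v) x :=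
    funext (laplacian_eq_sum hv2)
  rw [h3]
  refine Differentiable.fun_sum fun i _ => ?_
  exact (dirD_contDiff (k := 1) (dirD_contDiff (k := 2) hv (by norm_num) _)
    (by norm_num) _).differentiable one_ne_zero

lemma hasFDerivAt_advect {a : E n → E n} {v : E n → F} (ha : ContDiff ℝ 1 a) (hv : ContDiff ℝ 2 v)
    (x : E n) : HasFDerivAt (advect a v)
      ((fderiv ℝ v x).comp (fderiv ℝ a x) + fderiv ℝ (fderiv ℝ v) x (a x)) x := by
  have h1 : DifferentiableAt ℝ (fderiv ℝ v) x :=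
    (hv.fderiv_right (m := 1) (by norm_num)).differentiable one_ne_zero x
  refine (h1.hasFDerivAt.clm_apply ((ha.differentiable one_ne_zero) x).hasFDerivAt).congr_fderiv ?_
  congr 1
  ext1 h
  rw [ContinuousLinearMap.flip_apply, fderiv_fderiv_symm hv]

/-- The commutator of `C` with transport is the product of Jacobians. It yields vortex stretching
for `C` a curl and `tr (Dv ∘ Da)` for the divergence. -/
lemma diffOp_advect {a v : E n → E n} (ha : ContDiff ℝ 1 a) (hv : ContDiff ℝ 2 v) (x : E n) :
    C (fderiv ℝ (advect a v) x) =
      C ((fderiv ℝ v x).comp (fderiv ℝ a x)) + advect a (diffOp C v) x := by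
  rw [(hasFDerivAt_advect ha hv x).fderiv, map_add, advect, fderiv_diffOp C hv]

lemma inner_gradient (q : E n → ℝ) (x k : E n) : ⟪gradient q x, k⟫ = fderiv ℝ q x k := by
  rw [gradient, InnerProductSpace.toDual_symm_apply]

lemma gradient_eq_sum (q : E n → ℝ) : gradient q = fun x => ∑ i, dirD (bv i) q x • bv i := by
  ext1 x
  refine ext_inner_right ℝ fun k => ?_
  rw [inner_gradient, sum_inner, fderiv_apply_eq_sum]
  refine Finset.sum_congr rfl fun i _ => ?_
  rw [inner_smul_left, EuclideanSpace.inner_single_left]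
  simp [dirD, mul_comm]

lemma contDiff_gradient {q : E n → ℝ} (hq : ContDiff ℝ 2 q) : ContDiff ℝ 1 (gradient q) := by
  rw [gradient_eq_sum]
  exact ContDiff.sum fun i _ => (dirD_contDiff hq (by norm_num) _).smul contDiff_const

lemma inner_fderiv_gradient {q : E n → ℝ} (hq : ContDiff ℝ 2 q) (x h k : E n) :
    ⟪fderiv ℝ (gradient q) x h, k⟫ = fderiv ℝ (fderiv ℝ q) x h k := by
  have h1 := (((contDiff_gradient hq).differentiable one_ne_zero x).hasFDerivAt.inner ℝ
    (hasFDerivAt_const k x)).fderiv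
  have h2 : (fun y => ⟪gradient q y, k⟫) = dirD k q := funext fun y => inner_gradient q y k
  rw [h2] at h1
  have h3 := DFunLike.congr_fun h1 h
  rw [fderiv_dirD hq] at h3
  simpa using h3.symm

/-- The Jacobian of a gradient is a Hessian, hence symmetric. This removes the pressure from the
vorticity equation. -/
lemma diffOp_gradient (hC : ∀ A : E n →L[ℝ] E n, (∀ h k, ⟪A h, k⟫ = ⟪A k, h⟫) → C A = 0)
    {q : E n → ℝ} (hq : ContDiff ℝ 2 q) (x : E n) : C (fderiv ℝ (gradient q) x) = 0 := by
  refine hC _ fun h k => ?_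
  rw [inner_fderiv_gradient hq, inner_fderiv_gradient hq, fderiv_fderiv_symm hq]

theorem integral_diffOp_eq_zero [CompleteSpace F] (hL : 0 ≤ L) {f : E n → E n}
    (hf : ContDiff ℝ 1 f) (hp : SpacePeriodic L f) : ∫ x in cell n L, diffOp C f x = 0 := by
  have hc := hf.continuous_fderiv one_ne_zero
  have h1 : ∫ x in cell n L, fderiv ℝ f x = 0 := by
    ext1 h
    rw [ContinuousLinearMap.integral_apply (integrableOn_cell hc)]
    simp only [fun x => fderiv_apply_eq_sum f x h]
    rw [integral_finsetSum _ fun i _ => integrableOn_cell (by fun_prop)]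
    refine Finset.sum_eq_zero fun i _ => ?_
    rw [integral_smul, integral_partial_eq_zero hL hf hp i, smul_zero]
  simp only [diffOp]
  rw [C.integral_comp_comm (integrableOn_cell hc), h1, map_zero]

/-- The matrix entry `∂ᵢ vⱼ` of a Jacobian. -/
def entry (i j : Fin n) : (E n →L[ℝ] E n) →L[ℝ] ℝ :=
  (EuclideanSpace.proj j : E n →L[ℝ] ℝ).comp (ContinuousLinearMap.apply ℝ (E n) (bv i))

lemma entry_apply (i j : Fin n) (A : E n →L[ℝ] E n) : entry i j A = A (bv i) j := rfl

lemma partialD_eq_entry {v : E n → E n} (hv : ContDiff ℝ 1 v) (i j : Fin n) (x : E n) :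
    partialD i j v x = entry i j (fderiv ℝ v x) := partialD_eq hv i j x

/-- The trace of a Jacobian. -/
def traceOp (n : ℕ) : (E n →L[ℝ] E n) →L[ℝ] ℝ := ∑ i, entry i i

lemma traceOp_apply (A : E n →L[ℝ] E n) : traceOp n A = ∑ i, entry i i A := by
  simp [traceOp]

lemma divergence_eq_diffOp {v : E n → E n} (hv : ContDiff ℝ 1 v) :
    divergence v = diffOp (traceOp n) v := by
  ext x
  simp only [divergence, diffOp, traceOp_apply, partialD_eq_entry hv]

lemma entry_comp (A B : E n →L[ℝ] E n) (i j : Fin n) :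
    entry i j (A.comp B) = ∑ k, entry i k B * entry k j A := by
  simp only [entry_apply, ContinuousLinearMap.comp_apply]
  conv_lhs => rw [← sum_coord_bv (B (bv i))]
  simp

lemma traceOp_comp_comm (A B : E n →L[ℝ] E n) :
    traceOp n (A.comp B) = traceOp n (B.comp A) := by
  simp only [traceOp_apply, entry_comp]
  rw [Finset.sum_comm]
  exact Finset.sum_congr rfl fun i _ => Finset.sum_congr rfl fun j _ => mul_comm _ _

lemma entry_symm {A : E n →L[ℝ] E n} (hA : ∀ h k, ⟪A h, k⟫ = ⟪A k, h⟫) (i j : Fin n) :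
    entry i j A = entry j i A := by
  have := hA (bv i) (bv j)
  simpa [entry_apply, EuclideanSpace.inner_single_right] using this

/-- A continuous function that is zero almost everywhere vanishes on the open cube. Any point of the
half-open cell is a limit of points on the segment to the centre `z`, and periodicity covers the
rest of space. -/
lemma eq_zero_of_integral_sq_eq_zero (hL : 0 < L) {g : E n → F} (hg : Continuous g)
    (hp : SpacePeriodic L g) (h : ∫ x in cell n L, ‖g x‖ ^ 2 = 0) (x : E n) : g x = 0 := by
  have hc : Continuous fun x => ‖g x‖ ^ 2 := by fun_prop
  set U : Set (E n) := {x | ∀ i, x i ∈ Ioo 0 L}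
  have hU : IsOpen U := by
    have : U = ⋂ i, (fun x : E n => x i) ⁻¹' Ioo 0 L := by ext; simp [U]
    rw [this]
    exact isOpen_iInter_of_finite fun i => isOpen_Ioo.preimage (by fun_prop)
  have hUc : U ⊆ cell n L := fun x hx i => Ioo_subset_Ioc_self (hx i)
  have h1 : (fun x => ‖g x‖ ^ 2) =ᵐ[volume.restrict (cell n L)] 0 :=
    (setIntegral_eq_zero_iff_of_nonneg_ae (Filter.Eventually.of_forall fun x => by positivity)
      (integrableOn_cell hc)).mp h
  have h2 : (fun x => ‖g x‖ ^ 2) =ᵐ[volume.restrict U] 0 :=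
    Filter.EventuallyEq.filter_mono h1 (ae_mono (Measure.restrict_mono hUc le_rfl))
  have h3 : EqOn (fun x => ‖g x‖ ^ 2) 0 U :=
    Measure.eqOn_open_of_ae_eq h2 hU hc.continuousOn continuousOn_const
  obtain ⟨y, hy, hxy⟩ := exists_mem_cell hL x
  rw [hp.eq_of_sub_int_mul hxy]
  set z : E n := WithLp.toLp 2 fun _ => L / 2
  have hseg : ∀ s ∈ Ioo (0 : ℝ) 1, ‖g (y + s • (z - y))‖ ^ 2 = 0 := by
    intro s hs
    refine h3 fun i => ?_
    have h4 := hy i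
    simp only [PiLp.add_apply, PiLp.smul_apply, PiLp.sub_apply, smul_eq_mul, z]
    constructor
    · nlinarith [mul_pos hs.1 hL, mul_nonneg (sub_nonneg.mpr hs.2.le) h4.1.le]
    · nlinarith [mul_pos hs.1 hL, mul_nonneg (sub_nonneg.mpr hs.2.le) (sub_nonneg.mpr h4.2)]
  have hcs : Continuous fun s : ℝ => ‖g (y + s • (z - y))‖ ^ 2 := by fun_prop
  have h5 : (0 : ℝ) ∈ closure (Ioo (0 : ℝ) 1) := by
    rw [closure_Ioo (by norm_num)]; exact ⟨le_rfl, zero_le_one⟩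
  have h6 : ‖g (y + (0 : ℝ) • (z - y))‖ ^ 2 = 0 :=
    (EqOn.closure (f := fun s : ℝ => ‖g (y + s • (z - y))‖ ^ 2) (g := fun _ => 0)
      hseg hcs continuous_const) h5
  simpa using h6

end DiffOp

end

section

variable {n : ℕ} {L σ T M : ℝ} {f : ℝ → E n → E n} {φ : E n → E n} {u v : ℝ → E n → E n}
  {p q : ℝ → E n → ℝ}

/-! ### Consequences of the momentum equation -/

lemma IsNSESolution.smooth_slab (h : IsNSESolution L σ T f φ u p) :
    ContDiffOn ℝ 3 (fun z : ℝ × E n => u z.1 z.2) (slab n 0 T) := h.smooth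

lemma IsNSESolution.contDiff (h : IsNSESolution L σ T f φ u p) {t : ℝ} (ht : t ∈ Icc 0 T) :
    ContDiff ℝ 3 (u t) := contDiff_slice h.smooth_slab ht

lemma IsNSESolution.hasDerivAt (h : IsNSESolution L σ T f φ u p) {t : ℝ} (ht : t ∈ Ioo 0 T)
    (x : E n) : HasDerivAt (fun s => u s x)
      (-((σ ^ 2 / 2) • Laplacian.laplacian (u t) x) + advect (u t) (u t) x
        + gradient (p t) x - f t x) t :=
  (h.momentum t (Ioo_subset_Ico_self ht) x).hasDerivAt (Icc_mem_nhds ht.1 ht.2)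

section Vorticity

variable {F : Type*} [NormedAddCommGroup F] [NormedSpace ℝ F] (C : (E n →L[ℝ] E n) →L[ℝ] F)
  (B : F →L[ℝ] (E n →L[ℝ] E n) →L[ℝ] F)

/-- The vorticity equation, for a curl `C` with stretching term `B`. -/
theorem IsNSESolution.hasDerivAt_diffOp
    (hC : ∀ A : E n →L[ℝ] E n, (∀ h k, ⟪A h, k⟫ = ⟪A k, h⟫) → C A = 0)
    (hB : ∀ A : E n →L[ℝ] E n, traceOp n A = 0 → C (A.comp A) = -B (C A) A)
    (hu : IsNSESolution L σ T f φ u p) {t : ℝ} (ht : t ∈ Ioo 0 T) (hf : ContDiff ℝ 2 (f t))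
    (x : E n) : HasDerivAt (fun s => diffOp C (u s) x)
      (-((σ ^ 2 / 2) • Laplacian.laplacian (diffOp C (u t)) x) + advect (u t) (diffOp C (u t)) x
        - B (diffOp C (u t) x) (fderiv ℝ (u t) x) - diffOp C (f t) x) t := by
  have ht' := Ioo_subset_Icc_self ht
  have h3 := hu.contDiff ht'
  have h2 : ContDiff ℝ 2 (u t) := h3.of_le (by norm_num)
  have h1 : ContDiff ℝ 1 (u t) := h3.of_le (by norm_num)
  have hp2 := hu.smooth_pressure t (Ioo_subset_Ico_self ht)
  have key := C.hasFDerivAt.comp_hasDerivAt t (hasDerivAt_fderiv_slice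
    (hu.smooth_slab.of_le (by norm_num)) ht x fun y => hu.hasDerivAt ht y)
  refine key.congr_deriv ?_
  have d1 := ((differentiable_laplacian h3) x).hasFDerivAt.const_smul (σ ^ 2 / 2)
  have d2 := (hasFDerivAt_advect h1 h2 x).differentiableAt.hasFDerivAt
  have d3 := ((contDiff_gradient hp2).differentiable one_ne_zero x).hasFDerivAt
  have d4 := (hf.differentiable two_ne_zero x).hasFDerivAt
  have d := (((d1.neg.add d2).add d3).sub d4).fderiv
  have d' : fderiv ℝ (fun y => -((σ ^ 2 / 2) • Laplacian.laplacian (u t) y) +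
      advect (u t) (u t) y + gradient (p t) y - f t y) x = _ := d
  rw [d', map_sub, map_add, map_add, map_neg, map_smul, ← laplacian_diffOp C h3,
    diffOp_advect C h1 h2, diffOp_gradient C hC hp2, hB]
  · simp only [diffOp]
    abel
  · have := congrFun (divergence_eq_diffOp h1) x
    rw [hu.incompressible t ht' x] at this
    exact this.symm

end Vorticity

/-! ### Stability of the Navier-Stokes problem -/

lemma advect_fun_sub {F : Type*} [NormedAddCommGroup F] [NormedSpace ℝ F] {a : E n → E n}
    {v w : E n → F} (hv : ContDiff ℝ 1 v)
    (hw : ContDiff ℝ 1 w) (x : E n) :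
    advect a (fun y => v y - w y) x = advect a v x - advect a w x := by
  unfold advect
  rw [fderiv_fun_sub ((hv.differentiable one_ne_zero) x) ((hw.differentiable one_ne_zero) x)]
  rfl

lemma divergence_sub {v w : E n → E n} (hv : ContDiff ℝ 1 v) (hw : ContDiff ℝ 1 w) (x : E n) :
    divergence (fun y => v y - w y) x = divergence v x - divergence w x := by
  rw [divergence_eq_diffOp hv, divergence_eq_diffOp hw, divergence_eq_diffOp (hv.sub hw)]
  unfold diffOp
  rw [← map_sub]
  congr 1
  exact fderiv_fun_sub ((hv.differentiable one_ne_zero) x) ((hw.differentiable one_ne_zero) x)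

lemma laplacian_fun_sub {F : Type*} [NormedAddCommGroup F] [NormedSpace ℝ F] {v w : E n → F}
    (hv : ContDiff ℝ 2 v) (hw : ContDiff ℝ 2 w) (x : E n) :
    Laplacian.laplacian (fun y => v y - w y) x =
      Laplacian.laplacian v x - Laplacian.laplacian w x :=
  hv.contDiffAt.laplacian_sub hw.contDiffAt

/-- For `η = u - v` write `(u, ∇)u - (v, ∇)v = (u, ∇)η + (η, ∇)v`. The first term is transport by
`u` and the second is bounded by `M ‖η‖`. The common force cancels, so only `∇v` has to be bounded.
-/
theorem stability (hL : 0 ≤ L) {τ : ℝ} (hτ : 0 < τ) (hτT : τ ≤ T) {ψ : E n → E n} (hM : 0 ≤ M)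
    (hu : IsNSESolution L σ T f φ u p) (hv : IsNSESolution L σ τ f ψ v q)
    (hbound : ∀ t ∈ Icc 0 τ, ∀ x, ‖fderiv ℝ (v t) x‖ ≤ M) {t : ℝ} (ht : t ∈ Icc 0 τ) :
    ∫ x in cell n L, ‖u t x - v t x‖ ^ 2 ≤
      Real.exp (2 * M * τ) * ∫ x in cell n L, ‖u τ x - v τ x‖ ^ 2 := by
  have hsub : Icc 0 τ ⊆ Icc 0 T := Icc_subset_Icc_right hτT
  have hsub' : Ioo 0 τ ⊆ Ioo 0 T := Ioo_subset_Ioo_right hτT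
  have hus := hu.smooth_slab.mono (slab_mono hsub)
  have key := energy_estimate (c := σ ^ 2 / 2) (κ := 2 * M) (β := 0)
    (η := fun t x => u t x - v t x) (v := u)
    (R := fun t x => fderiv ℝ (v t) x (u t x - v t x) + gradient (p t) x - gradient (q t) x)
    hL hτ (by positivity) (by positivity) le_rfl
    ((hus.sub hv.smooth_slab).of_le (by norm_num))
    (fun t ht => (hu.periodic t (hsub ht)).comp₂ (hv.periodic t ht) fun a b => a - b)
    (fun t ht => (hu.contDiff (hsub (Ioo_subset_Icc_self ht))).of_le (by norm_num))
    (fun t ht => hu.periodic t (hsub (Ioo_subset_Icc_self ht)))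
    (fun t ht => hu.incompressible t (hsub (Ioo_subset_Icc_self ht))) ?_ ?_ ht
  · refine key.trans ?_
    rw [zero_mul, add_zero]
    have h0 : 0 ≤ ∫ x in cell n L, ‖u τ x - v τ x‖ ^ 2 := integral_nonneg fun x => by positivity
    gcongr
    linarith [ht.1]
  · intro s hs x
    have hs' := Ioo_subset_Icc_self hs
    have hus3 := hu.contDiff (hsub hs')
    have hvs3 := hv.contDiff hs'
    refine ((hu.hasDerivAt (hsub' hs) x).fun_sub (hv.hasDerivAt hs x)).congr_deriv ?_
    rw [laplacian_fun_sub (hus3.of_le (by norm_num)) (hvs3.of_le (by norm_num)),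
      advect_fun_sub (hus3.of_le (by norm_num)) (hvs3.of_le (by norm_num)), smul_sub]
    simp only [advect, map_sub]
    abel
  · intro s hs cR
    have hs' := Ioo_subset_Icc_self hs
    have hus1 : ContDiff ℝ 1 (u s) := (hu.contDiff (hsub hs')).of_le (by norm_num)
    have hvs1 : ContDiff ℝ 1 (v s) := (hv.contDiff hs').of_le (by norm_num)
    have hη1 : ContDiff ℝ 1 (fun x => u s x - v s x) := hus1.sub hvs1
    have cη := hη1.continuous
    have hηp : SpacePeriodic L (fun x => u s x - v s x) :=
      (hu.periodic s (hsub hs')).comp₂ (hv.periodic s hs') fun a b => a - b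
    have hηd : ∀ x, divergence (fun x => u s x - v s x) x = 0 := fun x => by
      rw [divergence_sub hus1 hvs1, hu.incompressible s (hsub hs'), hv.incompressible s hs',
        sub_zero]
    have hp2 := hu.smooth_pressure s (Ioo_subset_Ico_self (hsub' hs))
    have hq2 := hv.smooth_pressure s (Ioo_subset_Ico_self hs)
    have gp := (contDiff_gradient hp2).continuous
    have gq := (contDiff_gradient hq2).continuous
    have cD : Continuous fun x => fderiv ℝ (v s) x (u s x - v s x) :=
      (hvs1.continuous_fderiv one_ne_zero).clm_apply cη
    have i1 := integrableOn_cell (L := L) (cη.inner (𝕜 := ℝ) cD)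
    have i2 := integrableOn_cell (L := L) (cη.inner (𝕜 := ℝ) gp)
    have i3 := integrableOn_cell (L := L) (cη.inner (𝕜 := ℝ) gq)
    have e : ∫ x in cell n L, ⟪u s x - v s x, fderiv ℝ (v s) x (u s x - v s x) + gradient (p s) x
        - gradient (q s) x⟫ = ∫ x in cell n L, ⟪u s x - v s x, fderiv ℝ (v s) x (u s x - v s x)⟫ := by
      have e1 := integral_inner_gradient_eq_zero hL hη1 (hp2.of_le (by norm_num)) hηp
        (hu.periodic_pressure s (Ioo_subset_Ico_self (hsub' hs))) hηd
      have e2 := integral_inner_gradient_eq_zero hL hη1 (hq2.of_le (by norm_num)) hηp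
        (hv.periodic_pressure s (Ioo_subset_Ico_self hs)) hηd
      have e3 : ∀ x, ⟪u s x - v s x, fderiv ℝ (v s) x (u s x - v s x) + gradient (p s) x
        - gradient (q s) x⟫ = ⟪u s x - v s x, fderiv ℝ (v s) x (u s x - v s x)⟫ +
          ⟪u s x - v s x, gradient (p s) x⟫ - ⟪u s x - v s x, gradient (q s) x⟫ := fun x => by
        rw [inner_sub_right, inner_add_right]
      simp only [e3]
      rw [integral_sub (i1.fun_add i2) i3, integral_add i1 i2, e1, e2]
      ring
    rw [e]
    have h1 : ∫ x in cell n L, -(M * ‖u s x - v s x‖ ^ 2) ≤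
        ∫ x in cell n L, ⟪u s x - v s x, fderiv ℝ (v s) x (u s x - v s x)⟫ := by
      refine integral_mono (integrableOn_cell (by fun_prop)) i1 fun x => ?_
      have h2 := abs_real_inner_le_norm (u s x - v s x) (fderiv ℝ (v s) x (u s x - v s x))
      have h3 := (fderiv ℝ (v s) x).le_of_opNorm_le (hbound s hs' x) (u s x - v s x)
      have h4 := mul_le_mul_of_nonneg_left h3 (norm_nonneg (u s x - v s x))
      have h5 := neg_abs_le ⟪u s x - v s x, fderiv ℝ (v s) x (u s x - v s x)⟫
      nlinarith
    rw [integral_neg, integral_const_mul] at h1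
    linarith

/-! ### Bounds on the derivatives -/

section Bounds

variable (hT : 0 < T) (hv : ContDiffOn ℝ 3 (fun z : ℝ × E n => v z.1 z.2) (slab n 0 T))
  (hM : DerivativesBoundedBy M T v)
include hT hv hM

lemma norm_fderivWithin_le_of_bounded {z : ℝ × E n} (hz : z ∈ slab n 0 T) :
    ‖fderivWithin ℝ (fun z : ℝ × E n => v z.1 z.2) (slab n 0 T) z‖ ≤ M := by
  rw [← norm_iteratedFDerivWithin_one _ (uniqueDiffOn_slab hT z hz)]
  exact hM 1 (by norm_num) z hz

lemma norm_fderivWithin_fderivWithin_le_of_bounded {z : ℝ × E n} (hz : z ∈ slab n 0 T) :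
    ‖fderivWithin ℝ (fderivWithin ℝ (fun z : ℝ × E n => v z.1 z.2) (slab n 0 T)) (slab n 0 T) z‖
      ≤ M := by
  rw [← norm_iteratedFDerivWithin_one _ (uniqueDiffOn_slab hT z hz),
    norm_iteratedFDerivWithin_fderivWithin (uniqueDiffOn_slab hT) hz]
  exact hM 2 le_rfl z hz

lemma norm_fderiv_slice_le {t : ℝ} (ht : t ∈ Icc 0 T) (x : E n) : ‖fderiv ℝ (v t) x‖ ≤ M := by
  have hz : ((t, x) : ℝ × E n) ∈ slab n 0 T := ⟨ht, mem_univ x⟩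
  rw [fderiv_slice (hv.of_le (by norm_num)) ht]
  have h1 := norm_fderivWithin_le_of_bounded hT hv hM hz
  refine (ContinuousLinearMap.opNorm_comp_le _ _).trans ?_
  refine (mul_le_of_le_one_right (norm_nonneg _) (ContinuousLinearMap.norm_inr_le_one _ _ _)).trans h1

/-- Contains the mixed derivative in `t` and `x`, hence gives the Lipschitz dependence of the
spatial gradient on time. -/
lemma norm_fderivWithin_slice_fderiv_le {z : ℝ × E n} (hz : z ∈ slab n 0 T) :
    ‖fderivWithin ℝ (fun z : ℝ × E n => fderiv ℝ (v z.1) z.2) (slab n 0 T) z‖ ≤ M := by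
  set W := fun z : ℝ × E n => v z.1 z.2 with hW
  have hu := uniqueDiffOn_slab (n := n) hT z hz
  have h1 : ContDiffOn ℝ 2 (fderivWithin ℝ W (slab n 0 T)) (slab n 0 T) :=
    hv.fderivWithin (uniqueDiffOn_slab hT) (by norm_num)
  have h2 := ((h1.differentiableOn two_ne_zero) z hz).hasFDerivWithinAt
  have h3 := h2.clm_comp (hasFDerivWithinAt_const (ContinuousLinearMap.inr ℝ ℝ (E n)) z _)
  have h4 := (h3.congr (fun y hy => fderiv_slice (hv.of_le (by norm_num)) hy.1 y.2)
    (fderiv_slice (hv.of_le (by norm_num)) hz.1 z.2)).fderivWithin hu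
  have hM0 : 0 ≤ M := (norm_nonneg _).trans (norm_fderivWithin_le_of_bounded hT hv hM hz)
  rw [h4]
  refine ContinuousLinearMap.opNorm_le_bound _ hM0 fun k => ?_
  simp only [ContinuousLinearMap.comp_zero, zero_add, ContinuousLinearMap.comp_apply]
  have h5 := norm_fderivWithin_fderivWithin_le_of_bounded hT hv hM hz
  have h6 := ContinuousLinearMap.le_of_opNorm_le _ h5 k
  refine le_trans ?_ h6
  simp only [ContinuousLinearMap.flip_apply, ContinuousLinearMap.compL_apply]
  refine (ContinuousLinearMap.opNorm_comp_le _ _).trans ?_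
  exact mul_le_of_le_one_right (norm_nonneg _) (ContinuousLinearMap.norm_inr_le_one _ _ _)

lemma norm_fderiv_fderiv_slice_le {t : ℝ} (ht : t ∈ Icc 0 T) (x : E n) :
    ‖fderiv ℝ (fderiv ℝ (v t)) x‖ ≤ M := by
  have hz : ((t, x) : ℝ × E n) ∈ slab n 0 T := ⟨ht, mem_univ x⟩
  have h0 : ContDiffOn ℝ 1 (fun z : ℝ × E n => fderiv ℝ (v z.1) z.2) (slab n 0 T) :=
    contDiffOn_fderiv_slice hT (by norm_num) hv
  rw [show fderiv ℝ (fderiv ℝ (v t)) x = _ from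
    fderiv_slice (V := fun t x => fderiv ℝ (v t) x) h0 ht x]
  have h1 := norm_fderivWithin_slice_fderiv_le hT hv hM hz
  refine (ContinuousLinearMap.opNorm_comp_le _ _).trans ?_
  refine (mul_le_of_le_one_right (norm_nonneg _) (ContinuousLinearMap.norm_inr_le_one _ _ _)).trans h1

lemma norm_slice_sub_le {s t : ℝ} (hs : s ∈ Icc 0 T) (ht : t ∈ Icc 0 T) (x : E n) :
    ‖v t x - v s x‖ ≤ M * ‖t - s‖ := by
  refine Convex.norm_image_sub_le_of_norm_hasDerivWithin_le (f := fun t => v t x)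
    (fun r hr => hasDerivWithinAt_slice (hv.of_le (by norm_num)) hr x) (fun r hr => ?_)
    (convex_Icc 0 T) hs ht
  have hz : ((r, x) : ℝ × E n) ∈ slab n 0 T := ⟨hr, mem_univ x⟩
  have h1 := norm_fderivWithin_le_of_bounded hT hv hM hz
  refine (ContinuousLinearMap.le_of_opNorm_le _ h1 _).trans ?_
  exact mul_le_of_le_one_right ((norm_nonneg _).trans h1) (by simp [Prod.norm_def])

lemma norm_fderiv_slice_sub_le {s t : ℝ} (hs : s ∈ Icc 0 T) (ht : t ∈ Icc 0 T) (x : E n) :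
    ‖fderiv ℝ (v t) x - fderiv ℝ (v s) x‖ ≤ M * ‖t - s‖ := by
  have h0 : ContDiffOn ℝ 1 (fun z : ℝ × E n => fderiv ℝ (v z.1) z.2) (slab n 0 T) :=
    contDiffOn_fderiv_slice hT (by norm_num) hv
  refine Convex.norm_image_sub_le_of_norm_hasDerivWithin_le (f := fun t => fderiv ℝ (v t) x)
    (fun r hr => hasDerivWithinAt_slice (V := fun t x => fderiv ℝ (v t) x) h0 hr x)
    (fun r hr => ?_) (convex_Icc 0 T) hs ht
  have hz : ((r, x) : ℝ × E n) ∈ slab n 0 T := ⟨hr, mem_univ x⟩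
  have h1 := norm_fderivWithin_slice_fderiv_le hT hv hM hz
  have hM0 : 0 ≤ M := (norm_nonneg _).trans (norm_fderivWithin_le_of_bounded hT hv hM hz)
  refine (ContinuousLinearMap.le_of_opNorm_le _ h1 _).trans ?_
  exact mul_le_of_le_one_right hM0 (by simp [Prod.norm_def])

end Bounds

end

/-! ### The local error -/

section

section LocalError

variable {n : ℕ} {L σ M : ℝ} {f : ℝ → E n → E n} {φ : E n → E n} {v : ℝ → E n → E n}
  {q : ℝ → E n → ℝ} {F : Type*} [NormedAddCommGroup F] [InnerProductSpace ℝ F] [CompleteSpace F]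
  (C : (E n →L[ℝ] E n) →L[ℝ] F) (B : F →L[ℝ] (E n →L[ℝ] E n) →L[ℝ] F)

/-- The vorticity of the exact solution and the vorticity with frozen velocity differ by `O(h²)`. -/
theorem local_error (hL : 0 ≤ L)
    (hC : ∀ A : E n →L[ℝ] E n, (∀ h k, ⟪A h, k⟫ = ⟪A k, h⟫) → C A = 0)
    (hB : ∀ A : E n →L[ℝ] E n, traceOp n A = 0 → C (A.comp A) = -B (C A) A)
    (hBn : ∀ ω A, ‖B ω A‖ ≤ ‖ω‖ * ‖A‖)
    {a b : ℝ} (ha : 0 ≤ a) (hab : a < b) (hM0 : 0 ≤ M) (hv : IsNSESolution L σ b f φ v q)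
    (hM : DerivativesBoundedBy M b v) (hf : ∀ t ∈ Ico 0 b, ContDiff ℝ 2 (f t))
    {w : ℝ → E n → F} (hw : ContDiffOn ℝ 3 (fun z : ℝ × E n => w z.1 z.2) (slab n a b))
    (hwp : ∀ t ∈ Icc a b, SpacePeriodic L (w t))
    (heq : ∀ t ∈ Ioo a b, ∀ x, HasDerivAt (fun s => w s x)
      (-((σ ^ 2 / 2) • Laplacian.laplacian (w t) x) + advect (v b) (w t) x
        - B (w t x) (fderiv ℝ (v b) x) - diffOp C (f t) x) t)
    (hend : ∫ x in cell n L, ‖diffOp C (v b) x - w b x‖ ^ 2 = 0) {t : ℝ} (ht : t ∈ Icc a b) :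
    ∫ x in cell n L, ‖diffOp C (v t) x - w t x‖ ^ 2 ≤
      Real.exp (2 * M * (b - a) + 1) * (2 * ‖C‖ * M * M) ^ 2 * L ^ n * (b - a) ^ 4 := by
  have hb : 0 < b := ha.trans_lt hab
  have hh : 0 < b - a := sub_pos.mpr hab
  set h := b - a
  set K := 2 * ‖C‖ * M * M
  have hK0 : 0 ≤ K := by positivity
  have hsub : Icc a b ⊆ Icc 0 b := Icc_subset_Icc_left ha
  have hb0 : b ∈ Icc 0 b := ⟨hb.le, le_rfl⟩
  have hvs := hv.smooth_slab
  have hvb : ContDiff ℝ 3 (v b) := hv.contDiff hb0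
  have hωs : ContDiffOn ℝ 2 (fun z : ℝ × E n => diffOp C (v z.1) z.2) (slab n a b) :=
    C.contDiff.comp_contDiffOn
      ((contDiffOn_fderiv_slice hb (by norm_num) hvs).mono (slab_mono hsub))
  have hvsl : ∀ {t}, t ∈ Icc a b → ContDiff ℝ 3 (v t) := fun ht => hv.contDiff (hsub ht)
  have hωt : ∀ {t}, t ∈ Icc a b → ContDiff ℝ 2 (diffOp C (v t)) := fun ht =>
    contDiff_diffOp C (hvsl ht) (by norm_num)
  have hwt : ∀ {t}, t ∈ Icc a b → ContDiff ℝ 3 (w t) := fun ht => contDiff_slice hw ht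
  -- The first two terms of `R` come from freezing the velocity and its gradient; together they are
  -- at most `K * h`. The last term is linear in the defect and costs `2 * M` in `κ`. The extra `1 /
  -- h` in `κ` only contributes a factor `e` over a step of length `h`, whereas `β` becomes of order
  -- `h³`.
  have key := energy_estimate (c := σ ^ 2 / 2) (κ := 2 * M + 1 / h) (β := h * (K * h) ^ 2 * L ^ n)
    (η := fun t x => diffOp C (v t) x - w t x) (v := fun _ => v b)
    (R := fun t x => advect (fun x => v t x - v b x) (diffOp C (v t)) x
      - B (diffOp C (v t) x) (fderiv ℝ (v t) x - fderiv ℝ (v b) x)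
      - B (diffOp C (v t) x - w t x) (fderiv ℝ (v b) x))
    hL hab (by positivity) (by positivity) (by positivity)
    (hωs.sub (hw.of_le (by norm_num)))
    (fun t ht => ((hv.periodic t (hsub ht)).diffOp C).comp₂ (hwp t ht) fun a b => a - b)
    (fun t _ => hvb.of_le (by norm_num))
    (fun t _ => hv.periodic b hb0) (fun t _ => hv.incompressible b hb0) ?_ ?_ ht
  · refine key.trans ?_
    rw [hend, zero_add]
    have h1 : b - t ≤ h := by simp only [h]; linarith [ht.1]
    have h2 : 0 ≤ b - t := sub_nonneg.mpr ht.2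
    calc Real.exp ((2 * M + 1 / h) * (b - t)) * (h * (K * h) ^ 2 * L ^ n * (b - t))
        ≤ Real.exp ((2 * M + 1 / h) * h) * (h * (K * h) ^ 2 * L ^ n * h) := by gcongr
      _ = Real.exp (2 * M * h + 1) * K ^ 2 * L ^ n * h ^ 4 := by
        rw [show (2 * M + 1 / h) * h = 2 * M * h + 1 by field_simp]
        ring
  · intro s hs x
    have hs' := Ioo_subset_Icc_self hs
    have hs0 : s ∈ Ioo 0 b := ⟨ha.trans_lt hs.1, hs.2⟩
    refine ((hv.hasDerivAt_diffOp C B hC hB hs0 (hf s (Ioo_subset_Ico_self hs0)) x).fun_sub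
      (heq s hs x)).congr_deriv ?_
    rw [laplacian_fun_sub (hωt hs') ((hwt hs').of_le (by norm_num)),
      advect_fun_sub ((hωt hs').of_le (by norm_num)) ((hwt hs').of_le (by norm_num)), smul_sub]
    simp only [advect, map_sub, sub_apply]
    abel
  · intro s hs cR
    have hs' := Ioo_subset_Icc_self hs
    have cη : Continuous fun x => diffOp C (v s) x - w s x :=
      (hωt hs').continuous.sub (hwt hs').continuous
    have hpt : ∀ x, -((2 * M + 1 / h) * ‖diffOp C (v s) x - w s x‖ ^ 2 + h * (K * h) ^ 2) ≤
        2 * ⟪diffOp C (v s) x - w s x, advect (fun x => v s x - v b x) (diffOp C (v s)) x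
          - B (diffOp C (v s) x) (fderiv ℝ (v s) x - fderiv ℝ (v b) x)
          - B (diffOp C (v s) x - w s x) (fderiv ℝ (v b) x)⟫ := by
      intro x
      set η := diffOp C (v s) x - w s x
      have hbs : ‖s - b‖ ≤ h := by
        rw [Real.norm_eq_abs, abs_sub_comm, abs_of_nonneg (by linarith [hs.2])]
        simp only [h]; linarith [hs.1]
      have b1 : ‖v s x - v b x‖ ≤ M * h :=
        (norm_slice_sub_le hb hvs hM hb0 (hsub hs') x).trans (by gcongr)
      have b2 : ‖fderiv ℝ (v s) x - fderiv ℝ (v b) x‖ ≤ M * h :=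
        (norm_fderiv_slice_sub_le hb hvs hM hb0 (hsub hs') x).trans (by gcongr)
      have b3 : ‖diffOp C (v s) x‖ ≤ ‖C‖ * M :=
        C.le_of_opNorm_le_of_le le_rfl (norm_fderiv_slice_le hb hvs hM (hsub hs') x)
      have b4 : ‖fderiv ℝ (v b) x‖ ≤ M := norm_fderiv_slice_le hb hvs hM hb0 x
      have b5 : ‖advect (fun x => v s x - v b x) (diffOp C (v s)) x‖ ≤ ‖C‖ * M * (M * h) := by
        rw [advect, fderiv_diffOp C ((hvsl hs').of_le (by norm_num)), mul_assoc]
        refine C.le_of_opNorm_le_of_le le_rfl ?_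
        exact (fderiv ℝ (fderiv ℝ (v s)) x).le_of_opNorm_le_of_le
          (norm_fderiv_fderiv_slice_le hb hvs hM (hsub hs') x) b1
      have b6 : ‖B (diffOp C (v s) x) (fderiv ℝ (v s) x - fderiv ℝ (v b) x)‖ ≤
          ‖C‖ * M * (M * h) := (hBn _ _).trans (by gcongr)
      have b7 : ‖B η (fderiv ℝ (v b) x)‖ ≤ ‖η‖ * M := (hBn _ _).trans (by gcongr)
      have b8 : ‖advect (fun x => v s x - v b x) (diffOp C (v s)) x
          - B (diffOp C (v s) x) (fderiv ℝ (v s) x - fderiv ℝ (v b) x)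
          - B η (fderiv ℝ (v b) x)‖ ≤ K * h + M * ‖η‖ := by
        refine (norm_sub_le _ _).trans ?_
        have := norm_sub_le (advect (fun x => v s x - v b x) (diffOp C (v s)) x)
          (B (diffOp C (v s) x) (fderiv ℝ (v s) x - fderiv ℝ (v b) x))
        simp only [K]
        linarith
      have b9 := abs_le.mp ((abs_real_inner_le_norm η _).trans
        (mul_le_mul_of_nonneg_left b8 (norm_nonneg η)))
      -- Young's inequality with weight `1 / h`, matching the choice of `κ` and `β`.
      have b10 : 2 * (‖η‖ * (K * h)) ≤ 1 / h * ‖η‖ ^ 2 + h * (K * h) ^ 2 := by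
        have : 1 / h * ‖η‖ ^ 2 + h * (K * h) ^ 2 - 2 * (‖η‖ * (K * h)) =
            1 / h * (‖η‖ - h * (K * h)) ^ 2 := by field_simp; ring
        have h0 : 0 ≤ 1 / h * (‖η‖ - h * (K * h)) ^ 2 := by positivity
        linarith
      linarith [b9.1]
    have hint := integral_mono (μ := volume.restrict (cell n L))
      (integrableOn_cell (L := L) (by fun_prop)) (integrableOn_cell (L := L) (by fun_prop)) hpt
    rw [integral_neg, integral_add (integrableOn_cell (by fun_prop)) (integrable_const _),
      integral_const_mul, integral_const, integral_const_mul, measureReal_restrict_apply_univ,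
      volume_cell hL, smul_eq_mul] at hint
    linarith

end LocalError

/-! ### Conserved properties of the approximation -/

section Conserved

variable {n : ℕ} {L a b c : ℝ}

/-- In the equation for `div w`, transport and stretching produce `tr (Dw ∘ Dv)` and `tr (Dv ∘ Dw)`,
which cancel. As `div v = 0` and `div g = 0`, what remains is a transport-diffusion equation without
source and with zero terminal data. -/
theorem divergence_eq_zero_of_frozen (hL : 0 < L) (hab : a < b) (hc : 0 ≤ c) {v : E n → E n}
    (hv : ContDiff ℝ 2 v) (hvp : SpacePeriodic L v) (hdiv : ∀ x, divergence v x = 0)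
    {g w : ℝ → E n → E n} (hw : ContDiffOn ℝ 3 (fun z : ℝ × E n => w z.1 z.2) (slab n a b))
    (hwp : ∀ t ∈ Icc a b, SpacePeriodic L (w t)) (hg : ∀ t ∈ Ioo a b, ContDiff ℝ 1 (g t))
    (hgdiv : ∀ t ∈ Ioo a b, ∀ x, divergence (g t) x = 0)
    (heq : ∀ t ∈ Ioo a b, ∀ x, HasDerivAt (fun s => w s x)
      (-(c • Laplacian.laplacian (w t) x) + advect v (w t) x - advect (w t) v x - g t x) t)
    (hend : ∀ x, divergence (w b) x = 0) {t : ℝ} (ht : t ∈ Icc a b) (x : E n) :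
    divergence (w t) x = 0 := by
  have hwt : ∀ {t}, t ∈ Icc a b → ContDiff ℝ 3 (w t) := fun ht => contDiff_slice hw ht
  have hdt : ∀ {t}, t ∈ Icc a b → divergence (w t) = diffOp (traceOp n) (w t) := fun ht =>
    divergence_eq_diffOp ((hwt ht).of_le (by norm_num))
  have hv1 : ContDiff ℝ 1 v := hv.of_le (by norm_num)
  have hds : ContDiffOn ℝ 2 (fun z : ℝ × E n => diffOp (traceOp n) (w z.1) z.2) (slab n a b) :=
    (traceOp n).contDiff.comp_contDiffOn (contDiffOn_fderiv_slice hab (by norm_num) hw)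
  have key := energy_estimate (c := c) (κ := 0) (β := 0) (R := fun _ _ => 0)
    (η := fun t => diffOp (traceOp n) (w t)) (v := fun _ => v) hL.le hab hc le_rfl le_rfl hds
    (fun t ht => (hwp t ht).diffOp _) (fun t _ => hv1) (fun t _ => hvp) (fun t _ => hdiv) ?_ ?_ ht
  · have hb : b ∈ Icc a b := ⟨hab.le, le_rfl⟩
    have h0 : ∀ x, diffOp (traceOp n) (w b) x = 0 := fun x => by rw [← hdt hb]; exact hend x
    simp only [h0, norm_zero, ne_eq, OfNat.ofNat_ne_zero, not_false_eq_true, zero_pow,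
      integral_zero, zero_mul, add_zero, mul_zero] at key
    rw [hdt ht]
    have hcont : Continuous (diffOp (traceOp n) (w t)) :=
      (contDiff_diffOp (k := 0) _ (hwt ht) (by norm_num)).continuous
    exact eq_zero_of_integral_sq_eq_zero hL hcont ((hwp t ht).diffOp _)
      (le_antisymm key (integral_nonneg fun x => by positivity)) x
  · intro s hs x
    have hs' := Ioo_subset_Icc_self hs
    have w3 := hwt hs'
    have w2 : ContDiff ℝ 2 (w s) := w3.of_le (by norm_num)
    have w1 : ContDiff ℝ 1 (w s) := w3.of_le (by norm_num)
    have d1 := ((differentiable_laplacian w3) x).hasFDerivAt.const_smul c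
    have d2 := (hasFDerivAt_advect hv1 w2 x).differentiableAt.hasFDerivAt
    have d3 := (hasFDerivAt_advect w1 hv x).differentiableAt.hasFDerivAt
    have d4 := ((hg s hs).differentiable one_ne_zero x).hasFDerivAt
    have d := (((d1.neg.add d2).sub d3).sub d4).fderiv
    have d' : fderiv ℝ (fun y => -(c • Laplacian.laplacian (w s) y) +
      advect v (w s) y - advect (w s) v y - g s y) x = _ := d
    refine ((traceOp n).hasFDerivAt.comp_hasDerivAt s (hasDerivAt_fderiv_slice
      (hw.of_le (by norm_num)) hs x fun y => heq s hs y)).congr_deriv ?_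
    have hgd : traceOp n (fderiv ℝ (g s) x) = 0 := by
      have := hgdiv s hs x
      rwa [divergence_eq_diffOp (hg s hs)] at this
    have hvd : advect (w s) (diffOp (traceOp n) v) x = 0 := by
      have : diffOp (traceOp n) v = fun _ => 0 := by
        rw [← divergence_eq_diffOp hv1]; exact funext hdiv
      simp [advect, this]
    rw [d', map_sub, map_sub, map_add, map_neg, map_smul, ← laplacian_diffOp _ w3,
      diffOp_advect _ hv1 w2, diffOp_advect _ w1 hv, hgd, hvd, traceOp_comp_comm (fderiv ℝ v x)]
    ring
  · intro s hs _
    simp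

variable {F : Type*} [NormedAddCommGroup F] [InnerProductSpace ℝ F] [CompleteSpace F]

/-- Diffusion, transport and `S` all integrate to zero, so the mean is constant in time. The
stretching term, when present, is put into `S`. -/
theorem integral_eq_zero_of_frozen (hL : 0 ≤ L) (hab : a < b) {v : E n → E n}
    (hv : ContDiff ℝ 1 v) (hvp : SpacePeriodic L v) (hdiv : ∀ x, divergence v x = 0)
    {S w : ℝ → E n → F} (hw : ContDiffOn ℝ 3 (fun z : ℝ × E n => w z.1 z.2) (slab n a b))
    (hwp : ∀ t ∈ Icc a b, SpacePeriodic L (w t)) (hS : ∀ t ∈ Ioo a b, Continuous (S t))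
    (hSint : ∀ t ∈ Ioo a b, ∫ x in cell n L, S t x = 0)
    (heq : ∀ t ∈ Ioo a b, ∀ x, HasDerivAt (fun s => w s x)
      (-(c • Laplacian.laplacian (w t) x) + advect v (w t) x - S t x) t)
    (hend : ∫ x in cell n L, w b x = 0) {t : ℝ} (ht : t ∈ Icc a b) :
    ∫ x in cell n L, w t x = 0 := by
  have hd : ∀ s ∈ Ioo a b, HasDerivAt (fun t => ∫ x in cell n L, w t x) 0 s := by
    intro s hs
    have hs' := Ioo_subset_Icc_self hs
    have w3 : ContDiff ℝ 3 (w s) := contDiff_slice hw hs'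
    have w2 : ContDiff ℝ 2 (w s) := w3.of_le (by norm_num)
    have w1 : ContDiff ℝ 1 (w s) := w3.of_le (by norm_num)
    refine (hasDerivAt_integral_cell hab (hw.of_le (by norm_num)) hs
      fun x => heq s hs x).congr_deriv ?_
    have i1 : IntegrableOn (fun x => -(c • Laplacian.laplacian (w s) x)) (cell n L) :=
      integrableOn_cell ((continuous_laplacian w2).const_smul c).neg
    have i2 : IntegrableOn (advect v (w s)) (cell n L) :=
      integrableOn_cell ((w1.continuous_fderiv one_ne_zero).clm_apply hv.continuous)
    rw [integral_sub (i1.fun_add i2) (integrableOn_cell (hS s hs)), integral_add i1 i2,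
      integral_neg, integral_smul, integral_laplacian_eq_zero hL w2 (hwp s hs'),
      integral_advect_eq_zero hL hv w1 hvp (hwp s hs') hdiv, hSint s hs]
    simp
  -- Grönwall with zero constants, applied to the squared norm of the mean, gives the constancy up
  -- to the endpoints.
  have h := backward_gronwall (κ := 0) (β := 0) le_rfl le_rfl
    (y := fun t => ‖∫ x in cell n L, w t x‖ ^ 2) (y' := fun _ => 0)
    ((continuousOn_integral_cell hw.continuousOn).norm.pow 2)
    (fun s hs => ((hd s hs).norm_sq).congr_deriv (by simp)) (fun s _ => by simp) ht
  simp only [hend, norm_zero, ne_eq, OfNat.ofNat_ne_zero, not_false_eq_true, zero_pow, zero_mul,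
    add_zero, mul_zero] at h
  have h2 := le_antisymm h (sq_nonneg _)
  simpa using h2

end Conserved

end

/-! ### The global error -/

section

section Nodes

variable {T : ℝ} {N : ℕ}

lemma node_succ_sub (k : ℕ) : node T N (k + 1) - node T N k = T / N := by
  simp only [node]; push_cast; ring

lemma node_nonneg (hT : 0 ≤ T) (k : ℕ) : 0 ≤ node T N k := by unfold node; positivity

lemma node_self (hN : 0 < N) : node T N N = T := by
  have : (N : ℝ) ≠ 0 := by positivity
  simp only [node]; field_simp

lemma node_lt_succ (hT : 0 < T) (hN : 0 < N) (k : ℕ) : node T N k < node T N (k + 1) := by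
  have h1 := node_succ_sub (T := T) (N := N) k
  have h2 : 0 < T / N := by positivity
  linarith

lemma node_le (hT : 0 ≤ T) (hN : 0 < N) {k : ℕ} (hk : k ≤ N) : node T N k ≤ T := by
  have h1 : (k : ℝ) ≤ N := by exact_mod_cast hk
  exact (mul_le_mul_of_nonneg_right h1 (by positivity)).trans_eq (node_self hN)

end Nodes

/-! ### The `L²` norm on the cell -/

section L2

variable {n : ℕ} {L : ℝ} {F : Type*} [NormedAddCommGroup F]

lemma eLpNorm_eq_sqrt {g : E n → F} (hg : Continuous g) :
    eLpNorm g 2 (volume.restrict (cell n L)) =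
      ENNReal.ofReal (Real.sqrt (∫ x in cell n L, ‖g x‖ ^ 2)) := by
  have hm : MemLp g 2 (volume.restrict (cell n L)) := by
    rw [memLp_two_iff_integrable_sq_norm hg.aestronglyMeasurable]
    exact (hg.norm.pow 2).continuousOn.integrableOn_compact isCompact_closedCell
      |>.mono_set cell_subset_closedCell
  rw [hm.eLpNorm_eq_integral_rpow_norm (by norm_num) (by norm_num), Real.sqrt_eq_rpow]
  simp

lemma eLpNorm_le_of_integral_le {g : E n → F} (hg : Continuous g) {c : ℝ} (hc : 0 ≤ c)
    (h : ∫ x in cell n L, ‖g x‖ ^ 2 ≤ c ^ 2) :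
    eLpNorm g 2 (volume.restrict (cell n L)) ≤ ENNReal.ofReal c := by
  rw [eLpNorm_eq_sqrt hg]
  exact ENNReal.ofReal_le_ofReal (Real.sqrt_le_iff.mpr ⟨hc, h⟩)

lemma eLpNorm_fun_sub_le_add {u v w : E n → F} (hu : Continuous u) (hv : Continuous v)
    (hw : Continuous w) {c d : ℝ} (hc : 0 ≤ c) (hd : 0 ≤ d)
    (h1 : eLpNorm (fun x => u x - v x) 2 (volume.restrict (cell n L)) ≤ ENNReal.ofReal c)
    (h2 : eLpNorm (fun x => v x - w x) 2 (volume.restrict (cell n L)) ≤ ENNReal.ofReal d) :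
    eLpNorm (fun x => u x - w x) 2 (volume.restrict (cell n L)) ≤ ENNReal.ofReal (c + d) := by
  have h3 : (fun x => u x - w x) = (fun x => u x - v x) + fun x => v x - w x := by
    ext1 x; simp
  rw [h3, ENNReal.ofReal_add hc hd]
  exact (eLpNorm_add_le (hu.sub hv).aestronglyMeasurable (hv.sub hw).aestronglyMeasurable
    (by norm_num)).trans (add_le_add h1 h2)

end L2

/-! ### The telescoping sum of one-step errors -/

section Global

variable {n : ℕ} {F : Type*} [NormedAddCommGroup F] [InnerProductSpace ℝ F] [CompleteSpace F]
  (C : (E n →L[ℝ] E n) →L[ℝ] F) (B : F →L[ℝ] (E n →L[ℝ] E n) →L[ℝ] F)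

/-- First order convergence, for an abstract curl `C`, stretching `B` and Biot-Savart law `U`. -/
theorem global_error (L T σ M : ℝ) (hL : 0 < L) (hT : 0 < T)
    (hC : ∀ A : E n →L[ℝ] E n, (∀ h k, ⟪A h, k⟫ = ⟪A k, h⟫) → C A = 0)
    (hB : ∀ A : E n →L[ℝ] E n, traceOp n A = 0 → C (A.comp A) = -B (C A) A)
    (hBn : ∀ ω A, ‖B ω A‖ ≤ ‖ω‖ * ‖A‖)
    (U : (E n → F) → E n → E n) {R : ℝ} (hR : 0 ≤ R)
    (hU : ∀ (v : E n → E n) (ω : E n → F), ContDiff ℝ 1 v → SpacePeriodic L v →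
      (∀ x, divergence v x = 0) → ∫ x in cell n L, v x = 0 → ContDiff ℝ 2 ω → SpacePeriodic L ω →
      ∫ x in cell n L, ‖v x - U ω x‖ ^ 2 ≤ R ^ 2 * ∫ x in cell n L, ‖diffOp C v x - ω x‖ ^ 2)
    (hUc : ∀ ω : E n → F, ContDiff ℝ 2 ω → SpacePeriodic L ω → Continuous (U ω)) :
    ∃ K : ℝ, ∀ (f : ℝ → E n → E n) (φ : E n → E n) (u : ℝ → E n → E n) (p : ℝ → E n → ℝ),
      (∀ t ∈ Ico 0 T, ContDiff ℝ 2 (f t)) → IsNSESolution L σ T f φ u p →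
      ∀ (N : ℕ), 0 < N → ∀ w : ℕ → ℝ → E n → F,
      (∀ k < N, ContDiffOn ℝ 3 (fun z : ℝ × E n => w k z.1 z.2)
        (slab n (node T N k) (node T N (k + 1)))) →
      (∀ k < N, ∀ t ∈ Icc (node T N k) (node T N (k + 1)), SpacePeriodic L (w k t)) →
      (∀ k < N, ∀ t ∈ Ioo (node T N k) (node T N (k + 1)), ∀ x, HasDerivAt (fun s => w k s x)
        (-((σ ^ 2 / 2) • Laplacian.laplacian (w k t) x)
          + advect (U (w k (node T N (k + 1)))) (w k t) x
          - B (w k t x) (fderiv ℝ (U (w k (node T N (k + 1)))) x) - diffOp C (f t) x) t) →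
      w (N - 1) (node T N N) = diffOp C φ →
      (∀ k, k + 1 < N → w k (node T N (k + 1)) = w (k + 1) (node T N (k + 1))) →
      (∀ k < N, ∫ x in cell n L, ‖diffOp C (U (w k (node T N (k + 1)))) x
        - w k (node T N (k + 1)) x‖ ^ 2 = 0) →
      (∀ k < N, ∃ (v : ℝ → E n → E n) (q : ℝ → E n → ℝ),
          IsNSESolution L σ (node T N (k + 1)) f (U (w k (node T N (k + 1)))) v q ∧
          DerivativesBoundedBy M (node T N (k + 1)) v) →
      ∀ k < N, ∀ t ∈ Icc (node T N k) (node T N (k + 1)),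
        eLpNorm (fun x => u t x - U (w k t) x) 2 (volume.restrict (cell n L))
          ≤ ENNReal.ofReal (K * (T / N)) := by
  -- `S` is the amplification by the exact flow on `[0, T]`, and `D * h ^ 2` bounds the one-step
  -- velocity error. The final factor `T` is the number of steps times `h`.
  set S := Real.exp (M * T)
  set D := R * (Real.sqrt (Real.exp (2 * M * T + 1) * L ^ n) * (2 * ‖C‖ * M * M))
  refine ⟨(S + 1) * D * T, ?_⟩
  intro f φ u p hf hu N hN w hws hwp hweq hterm hmatch hnode hsol
  choose! v q hv hb using hsol
  have hpos : ∀ k, 0 < node T N (k + 1) := fun k =>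
    (node_nonneg hT.le k).trans_lt (node_lt_succ hT hN k)
  have hleT : ∀ {k}, k < N → node T N (k + 1) ≤ T := fun hk => node_le hT.le hN hk
  -- `M` is arbitrary in the statement; its sign follows from the bound assumed for the solution `v
  -- 0`.
  have hM : 0 ≤ M := by
    have h0 : ((0 : ℝ), (0 : E n)) ∈ (Icc 0 (node T N (0 + 1)) ×ˢ univ : Set (ℝ × E n)) :=
      ⟨⟨le_rfl, (hpos 0).le⟩, mem_univ _⟩
    exact (norm_nonneg _).trans (hb 0 hN 0 (by norm_num) _ h0)
  set h := T / N with hh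
  have hh0 : 0 < h := by positivity
  have hD0 : 0 ≤ D := by positivity
  have hS0 : 0 < S := Real.exp_pos _
  have hNh : N * h = T := by rw [hh]; field_simp
  have hhT : h ≤ T := by
    rw [← hNh]
    have : (1 : ℝ) ≤ N := by exact_mod_cast hN
    nlinarith
  have hlast : ∀ k, node T N (k + 1) ∈ Icc 0 (node T N (k + 1)) := fun k => ⟨(hpos k).le, le_rfl⟩
  have hgrad : ∀ k < N, ∀ t ∈ Icc 0 (node T N (k + 1)), ∀ x, ‖fderiv ℝ (v k t) x‖ ≤ M :=
    fun k hk t ht x => norm_fderiv_slice_le (hpos k) (hv k hk).smooth_slab (hb k hk) ht x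
  have hw2 : ∀ k < N, ∀ t ∈ Icc (node T N k) (node T N (k + 1)), ContDiff ℝ 2 (w k t) :=
    fun k hk t ht => (contDiff_slice (hws k hk) ht).of_le (by norm_num)
  have hIcc : ∀ k, Icc (node T N k) (node T N (k + 1)) ⊆ Icc 0 (node T N (k + 1)) := fun k =>
    Icc_subset_Icc_left (node_nonneg hT.le k)
  have hcv : ∀ k < N, ∀ t ∈ Icc 0 (node T N (k + 1)), Continuous (v k t) := fun k hk t ht =>
    ((hv k hk).contDiff ht).continuous
  have hcu : ∀ t ∈ Icc 0 T, Continuous (u t) := fun t ht => (hu.contDiff ht).continuous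
  have hlocal : ∀ k < N, ∀ t ∈ Icc (node T N k) (node T N (k + 1)),
      ∫ x in cell n L, ‖v k t x - U (w k t) x‖ ^ 2 ≤ (D * h ^ 2) ^ 2 := by
    intro k hk t ht
    have hvk := hv k hk
    have ht0 := hIcc k ht
    have h1 := hU (v k t) (w k t) ((hvk.contDiff ht0).of_le (by norm_num)) (hvk.periodic t ht0)
      (hvk.incompressible t ht0) (hvk.zero_average t ht0) (hw2 k hk t ht) (hwp k hk t ht)
    have h2 := local_error C B hL.le hC hB hBn (node_nonneg hT.le k) (node_lt_succ hT hN k) hM hvk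
      (hb k hk) (fun t ht => hf t ⟨ht.1, ht.2.trans_le (hleT hk)⟩) (hws k hk) (hwp k hk)
      (fun t ht x => by rw [hvk.terminal]; exact hweq k hk t ht x)
      (by rw [hvk.terminal]; exact hnode k hk) ht
    rw [node_succ_sub, ← hh] at h2
    refine h1.trans ((mul_le_mul_of_nonneg_left h2 (sq_nonneg R)).trans ?_)
    have h3 : (D * h ^ 2) ^ 2 = R ^ 2 * (Real.exp (2 * M * T + 1) * (2 * ‖C‖ * M * M) ^ 2 *
        L ^ n * h ^ 4) := by
      have := Real.sq_sqrt (by positivity : 0 ≤ Real.exp (2 * M * T + 1) * L ^ n)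
      simp only [D]
      rw [mul_pow, mul_pow, mul_pow, this]
      ring
    rw [h3]
    gcongr
  have hlocal' : ∀ k < N, ∀ t ∈ Icc (node T N k) (node T N (k + 1)),
      eLpNorm (fun x => v k t x - U (w k t) x) 2 (volume.restrict (cell n L)) ≤
        ENNReal.ofReal (D * h ^ 2) := fun k hk t ht =>
    eLpNorm_le_of_integral_le ((hcv k hk t (hIcc k ht)).sub
      (hUc _ (hw2 k hk t ht) (hwp k hk t ht))) (by positivity) (hlocal k hk t ht)
  have hexp : ∀ k < N, Real.exp (2 * M * node T N (k + 1)) ≤ S ^ 2 := fun k hk => by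
    rw [← Real.exp_nat_mul]
    refine Real.exp_le_exp.mpr ?_
    push_cast
    nlinarith [hleT hk]
  -- Descending induction on `k`, with `j` the number of later steps: each of them contributes one
  -- amplified one-step error.
  have hglob : ∀ j k, k + j + 1 = N → ∀ t ∈ Icc 0 (node T N (k + 1)),
      eLpNorm (fun x => u t x - v k t x) 2 (volume.restrict (cell n L)) ≤
        ENNReal.ofReal (j * (S * (D * h ^ 2))) := by
    intro j
    induction j with
    | zero =>
      intro k hkN t ht
      have hk : k < N := by omega
      have hkN' : k + 1 = N := by omega
      refine eLpNorm_le_of_integral_le ((hcu t ⟨ht.1, ht.2.trans (hleT hk)⟩).sub (hcv k hk t ht))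
        (by positivity) ?_
      refine (stability hL.le (hpos k) (hleT hk) hM hu (hv k hk) (hgrad k hk) ht).trans ?_
      -- On the last step `v k` has terminal value `U (curl φ)`. The estimate `hU` with `v = φ` and
      -- `ω = curl φ` shows that it agrees with `φ` in `L²`, so the fan starts with no error.
      have hTT : T ∈ Icc 0 T := ⟨hT.le, le_rfl⟩
      have hφ3 : ContDiff ℝ 3 φ := by rw [← hu.terminal]; exact hu.contDiff hTT
      have hφp : SpacePeriodic L φ := by rw [← hu.terminal]; exact hu.periodic T hTT
      have h1 := hU φ (diffOp C φ) (hφ3.of_le (by norm_num)) hφp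
        (by rw [← hu.terminal]; exact hu.incompressible T hTT)
        (by rw [← hu.terminal]; exact hu.zero_average T hTT)
        (contDiff_diffOp C hφ3 (by norm_num)) (hφp.diffOp C)
      have h2 : v k (node T N (k + 1)) = U (diffOp C φ) := by
        rw [(hv k hk).terminal, ← hterm, hkN', show N - 1 = k by omega]
      have h3 : u (node T N (k + 1)) = φ := by rw [hkN', node_self hN, hu.terminal]
      rw [h2, h3]
      simp only [sub_self, norm_zero, ne_eq, OfNat.ofNat_ne_zero, not_false_eq_true, zero_pow,
        integral_zero, mul_zero] at h1
      have := mul_le_mul_of_nonneg_left h1 (Real.exp_pos (2 * M * node T N (k + 1))).le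
      simpa using this
    | succ j ih =>
      intro k hkN t ht
      have hk : k < N := by omega
      have hk1 : k + 1 < N := by omega
      have hle : node T N (k + 1) ≤ node T N (k + 1 + 1) := (node_lt_succ hT hN (k + 1)).le
      have ht1 : t ∈ Icc 0 (node T N (k + 1 + 1)) := ⟨ht.1, ht.2.trans hle⟩
      have h1 := ih (k + 1) (by omega) t ht1
      have h2 : eLpNorm (fun x => v (k + 1) t x - v k t x) 2 (volume.restrict (cell n L)) ≤
          ENNReal.ofReal (S * (D * h ^ 2)) := by
        refine eLpNorm_le_of_integral_le ((hcv _ hk1 t ht1).sub (hcv k hk t ht))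
          (by positivity) ?_
        refine (stability hL.le (hpos k) hle hM (hv _ hk1) (hv k hk) (hgrad k hk) ht).trans ?_
        -- By matching, the terminal value of `v k` is the approximation of step `k + 1` at its left
        -- end, where `v (k + 1)` is within one local error of it.
        rw [(hv k hk).terminal, hmatch k hk1, mul_pow]
        exact mul_le_mul (hexp k hk) (hlocal (k + 1) hk1 _ ⟨le_rfl, hle⟩)
          (integral_nonneg fun x => by positivity) (by positivity)
      have h3 := eLpNorm_fun_sub_le_add (hcu t ⟨ht.1, ht.2.trans (hleT hk)⟩) (hcv _ hk1 t ht1)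
        (hcv k hk t ht) (by positivity) (by positivity) h1 h2
      refine h3.trans (le_of_eq ?_)
      push_cast
      ring_nf
  intro k hk t ht
  have ht0 := hIcc k ht
  have h1 := hglob (N - 1 - k) k (by omega) t ht0
  refine (eLpNorm_fun_sub_le_add (hcu t ⟨ht0.1, ht0.2.trans (hleT hk)⟩) (hcv k hk t ht0)
    (hUc _ (hw2 k hk t ht) (hwp k hk t ht)) (by positivity) (by positivity) h1
    (hlocal' k hk t ht)).trans (ENNReal.ofReal_le_ofReal ?_)
  have h4 : ((N - 1 - k : ℕ) : ℝ) ≤ N := by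
    exact_mod_cast (by omega : N - 1 - k ≤ N)
  have h5 : (1 : ℝ) ≤ N := by exact_mod_cast hN
  -- One factor of `h ^ 2` is spent on the number of steps through `N * h = T`.
  calc ((N - 1 - k : ℕ) : ℝ) * (S * (D * h ^ 2)) + D * h ^ 2
      ≤ N * (S * (D * h ^ 2)) + N * (D * h ^ 2) :=
        add_le_add (mul_le_mul_of_nonneg_right h4 (by positivity))
          (le_mul_of_one_le_left (by positivity) h5)
    _ = (S + 1) * D * (N * h) * h := by ring
    _ = (S + 1) * D * T * h := by rw [hNh]

end Global

end

/-! ### The planar curl and the curl in dimension three -/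

section

/-- The planar curl as a function of the Jacobian. -/
def curlOp2 : (E 2 →L[ℝ] E 2) →L[ℝ] ℝ := entry 0 1 - entry 1 0

lemma curlOp2_apply (A : E 2 →L[ℝ] E 2) : curlOp2 A = entry 0 1 A - entry 1 0 A := rfl

lemma curl2_eq_diffOp {v : E 2 → E 2} (hv : ContDiff ℝ 1 v) : curl2 v = diffOp curlOp2 v := by
  ext x
  simp only [curl2, partialD_eq_entry hv, diffOp, curlOp2_apply]

lemma curlOp2_eq_zero {A : E 2 →L[ℝ] E 2} (hA : ∀ h k, ⟪A h, k⟫ = ⟪A k, h⟫) : curlOp2 A = 0 := by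
  rw [curlOp2_apply, entry_symm hA, sub_self]

/-- Rests on the identity `curl (A²) = (tr A) (curl A)` in the plane, the reason why there is no
stretching there. -/
lemma curlOp2_comp_self {A : E 2 →L[ℝ] E 2} (hA : traceOp 2 A = 0) :
    curlOp2 (A.comp A) = 0 := by
  simp only [traceOp_apply, Fin.sum_univ_two] at hA
  simp only [curlOp2_apply, entry_comp, Fin.sum_univ_two]
  linear_combination (entry 0 1 A - entry 1 0 A) * hA

/-- The curl in dimension three as a function of the Jacobian. -/
def curlOp3 : (E 3 →L[ℝ] E 3) →L[ℝ] E 3 :=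
  ((EuclideanSpace.equiv (Fin 3) ℝ).symm : (Fin 3 → ℝ) →L[ℝ] E 3).comp
    (ContinuousLinearMap.pi ![entry 1 2 - entry 2 1, entry 2 0 - entry 0 2, entry 0 1 - entry 1 0])

lemma curlOp3_apply (A : E 3 →L[ℝ] E 3) : curlOp3 A = !₂[entry 1 2 A - entry 2 1 A,
    entry 2 0 A - entry 0 2 A, entry 0 1 A - entry 1 0 A] := by
  ext i
  fin_cases i <;> rfl

lemma curl3_eq_diffOp {v : E 3 → E 3} (hv : ContDiff ℝ 1 v) : curl3 v = diffOp curlOp3 v := by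
  ext1 x
  simp only [curl3, partialD_eq_entry hv, diffOp, curlOp3_apply]

lemma curlOp3_eq_zero {A : E 3 →L[ℝ] E 3} (hA : ∀ h k, ⟪A h, k⟫ = ⟪A k, h⟫) : curlOp3 A = 0 := by
  rw [curlOp3_apply, entry_symm hA 1 2, entry_symm hA 2 0, entry_symm hA 0 1]
  ext i
  fin_cases i <;> simp

lemma clm_apply_eq_entry {n : ℕ} (A : E n →L[ℝ] E n) (a : E n) (j : Fin n) :
    A a j = ∑ i, a i * entry i j A := by
  conv_lhs => rw [← sum_coord_bv a]
  simp [entry_apply]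

/-- Rests on `curl (A²) + A (curl A) = (tr A) (curl A)`, an identity for arbitrary `3 × 3` matrices.
It produces the stretching term. -/
lemma curlOp3_comp_self {A : E 3 →L[ℝ] E 3} (hA : traceOp 3 A = 0) :
    curlOp3 (A.comp A) = -A (curlOp3 A) := by
  simp only [traceOp_apply, Fin.sum_univ_three] at hA
  ext i
  rw [PiLp.neg_apply, clm_apply_eq_entry]
  simp only [curlOp3_apply, entry_comp, Fin.sum_univ_three]
  fin_cases i
  · simp
    linear_combination (entry 1 2 A - entry 2 1 A) * hA
  · simp
    linear_combination (entry 2 0 A - entry 0 2 A) * hA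
  · simp
    linear_combination (entry 0 1 A - entry 1 0 A) * hA

/-- Second derivatives cancel in pairs by symmetry. This makes both the source and the terminal
vorticity divergence-free. -/
lemma divergence_diffOp_curlOp3 {f : E 3 → E 3} (hf : ContDiff ℝ 2 f) (x : E 3) :
    divergence (diffOp curlOp3 f) x = 0 := by
  rw [divergence_eq_diffOp (contDiff_diffOp curlOp3 hf (by norm_num)), diffOp, traceOp_apply,
    Fin.sum_univ_three]
  simp only [entry_apply, fderiv_diffOp curlOp3 hf, curlOp3_apply]
  rw [fderiv_fderiv_symm hf x (bv 1) (bv 0), fderiv_fderiv_symm hf x (bv 2) (bv 0),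
    fderiv_fderiv_symm hf x (bv 2) (bv 1)]
  simp

/-! ### First order convergence -/

/-! ### Recovery of the vorticity from its velocity at the nodes -/

section Nodes

variable {L T σ : ℝ} {N : ℕ}

lemma curl2_biotSavart2_node (hL : 0 < L) (hT : 0 < T) (hN : 0 < N) {f : ℝ → E 2 → E 2}
    {φ : E 2 → E 2} {w : ℕ → ℝ → E 2 → ℝ} (hf : ∀ t ∈ Ico 0 T, ContDiff ℝ 2 (f t) ∧
      SpacePeriodic L (f t)) (hφ : ContDiff ℝ 3 φ) (hφp : SpacePeriodic L φ)
    (hw : IsVorticityApprox2 L σ T N f φ w)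
    (hU : ∀ k < N, ContDiff ℝ 3 (biotSavart2 L (w k (node T N (k + 1)))) ∧
      ∀ x, divergence (biotSavart2 L (w k (node T N (k + 1)))) x = 0) :
    ∀ k < N, ∫ x in cell 2 L, ‖diffOp curlOp2 (biotSavart2 L (w k (node T N (k + 1)))) x
        - w k (node T N (k + 1)) x‖ ^ 2 = 0 := by
  have hlt := node_lt_succ hT hN
  have hmean : ∀ j k, k + j + 1 = N → ∫ x in cell 2 L, w k (node T N (k + 1)) x = 0 := by
    intro j
    induction j with
    | zero =>
      intro k hk
      have h1 : w k (node T N (k + 1)) = curl2 φ := by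
        rw [← hw.terminal, show k + 1 = N by omega, show N - 1 = k by omega]
      rw [h1, curl2_eq_diffOp (hφ.of_le (by norm_num))]
      exact integral_diffOp_eq_zero _ hL.le (hφ.of_le (by norm_num)) hφp
    | succ j ih =>
      intro k hk
      rw [hw.matching k (by omega)]
      have hk1 : k + 1 < N := by omega
      have hfs : ∀ s ∈ Ioo (node T N (k + 1)) (node T N (k + 1 + 1)), s ∈ Ico 0 T := fun s hs =>
        ⟨(node_nonneg hT.le _).trans hs.1.le, hs.2.trans_le (node_le hT.le hN hk1)⟩
      refine integral_eq_zero_of_frozen (S := fun t => curl2 (f t)) (c := σ ^ 2 / 2) hL.le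
        (hlt (k + 1))
        ((hU _ hk1).1.of_le (by norm_num)) (biotSavart2_periodic hL _) (hU _ hk1).2
        (hw.smooth _ hk1) (hw.periodic _ hk1)
        (fun s hs => curl2_continuous ((hf s (hfs s hs)).1.of_le (by norm_num)))
        (fun s hs => ?_) (fun s hs x => ?_) (ih (k + 1) (by omega)) ⟨le_rfl, (hlt _).le⟩
      · have hf1 : ContDiff ℝ 1 (f s) := (hf s (hfs s hs)).1.of_le (by norm_num)
        simp only [curl2_eq_diffOp hf1]
        exact integral_diffOp_eq_zero _ hL.le hf1 (hf s (hfs s hs)).2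
      · exact (hw.equation _ hk1 s (Ioo_subset_Ico_self hs) x).hasDerivAt
          (Icc_mem_nhds hs.1 hs.2)
  intro k hk
  have hU1 : ContDiff ℝ 1 (biotSavart2 L (w k (node T N (k + 1)))) :=
    (hU k hk).1.of_le (by norm_num)
  have ht : node T N (k + 1) ∈ Icc (node T N k) (node T N (k + 1)) := ⟨(hlt k).le, le_rfl⟩
  rw [← curl2_eq_diffOp hU1]
  exact curl2_biotSavart2 hL ((contDiff_slice (hw.smooth k hk) ht).of_le (by norm_num))
    (hw.periodic k hk _ ht) (hmean (N - 1 - k) k (by omega)) hU1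

/-- Divergence and mean are propagated together from `t_N` downwards. The divergence is needed for
the mean: the stretching term is transport by `w`, and integrates to zero only when `div w = 0`. -/
lemma curl3_biotSavart3_node (hL : 0 < L) (hT : 0 < T) (hN : 0 < N) {f : ℝ → E 3 → E 3}
    {φ : E 3 → E 3} {w : ℕ → ℝ → E 3 → E 3} (hf : ∀ t ∈ Ico 0 T, ContDiff ℝ 2 (f t) ∧
      SpacePeriodic L (f t)) (hφ : ContDiff ℝ 3 φ) (hφp : SpacePeriodic L φ)
    (hw : IsVorticityApprox3 L σ T N f φ w)
    (hU : ∀ k < N, ContDiff ℝ 3 (biotSavart3 L (w k (node T N (k + 1)))) ∧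
      ∀ x, divergence (biotSavart3 L (w k (node T N (k + 1)))) x = 0) :
    ∀ k < N, ∫ x in cell 3 L, ‖diffOp curlOp3 (biotSavart3 L (w k (node T N (k + 1)))) x
        - w k (node T N (k + 1)) x‖ ^ 2 = 0 := by
  have hlt := node_lt_succ hT hN
  have hend : ∀ k, node T N (k + 1) ∈ Icc (node T N k) (node T N (k + 1)) := fun k =>
    ⟨(hlt k).le, le_rfl⟩
  have hfs : ∀ k < N, ∀ s ∈ Ioo (node T N k) (node T N (k + 1)), s ∈ Ico 0 T := fun k hk s hs =>
    ⟨(node_nonneg hT.le _).trans hs.1.le, hs.2.trans_le (node_le hT.le hN hk)⟩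
  have hf1 : ∀ k < N, ∀ s ∈ Ioo (node T N k) (node T N (k + 1)), ContDiff ℝ 1 (f s) :=
    fun k hk s hs => (hf s (hfs k hk s hs)).1.of_le (by norm_num)
  have heq : ∀ k < N, ∀ s ∈ Ioo (node T N k) (node T N (k + 1)), ∀ x,
      HasDerivAt (fun s => w k s x) (-((σ ^ 2 / 2) • Laplacian.laplacian (w k s) x)
        + advect (biotSavart3 L (w k (node T N (k + 1)))) (w k s) x
        - advect (w k s) (biotSavart3 L (w k (node T N (k + 1)))) x - curl3 (f s) x) s :=
    fun k hk s hs x => (hw.equation k hk s (Ioo_subset_Ico_self hs) x).hasDerivAt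
      (Icc_mem_nhds hs.1 hs.2)
  have hstep : ∀ k < N, (∀ x, divergence (w k (node T N (k + 1))) x = 0) →
      ∀ t ∈ Icc (node T N k) (node T N (k + 1)), ∀ x, divergence (w k t) x = 0 := by
    intro k hk h t ht x
    refine divergence_eq_zero_of_frozen (g := fun t => curl3 (f t)) (c := σ ^ 2 / 2) hL (hlt k)
      (by positivity) ((hU k hk).1.of_le (by norm_num)) (biotSavart3_periodic hL _) (hU k hk).2
      (hw.smooth k hk) (hw.periodic k hk) (fun s hs => ?_) (fun s hs y => ?_) (heq k hk) h ht x
    · rw [curl3_eq_diffOp (hf1 k hk s hs)]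
      exact contDiff_diffOp curlOp3 (hf s (hfs k hk s hs)).1 (by norm_num)
    · rw [curl3_eq_diffOp (hf1 k hk s hs)]
      exact divergence_diffOp_curlOp3 (hf s (hfs k hk s hs)).1 y
  have hmain : ∀ j k, k + j + 1 = N → (∀ x, divergence (w k (node T N (k + 1))) x = 0) ∧
      ∫ x in cell 3 L, w k (node T N (k + 1)) x = 0 := by
    intro j
    induction j with
    | zero =>
      intro k hk
      have h1 : w k (node T N (k + 1)) = diffOp curlOp3 φ := by
        rw [← curl3_eq_diffOp (hφ.of_le (by norm_num)), ← hw.terminal,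
          show k + 1 = N by omega, show N - 1 = k by omega]
      rw [h1]
      exact ⟨divergence_diffOp_curlOp3 (hφ.of_le (by norm_num)),
        integral_diffOp_eq_zero _ hL.le (hφ.of_le (by norm_num)) hφp⟩
    | succ j ih =>
      intro k hk
      rw [hw.matching k (by omega)]
      have hk1 : k + 1 < N := by omega
      obtain ⟨hd, hm⟩ := ih (k + 1) (by omega)
      have hdiv := hstep (k + 1) hk1 hd
      have hst : node T N (k + 1) ∈ Icc (node T N (k + 1)) (node T N (k + 1 + 1)) :=
        ⟨le_rfl, (hlt _).le⟩
      have hU1 : ContDiff ℝ 1 (biotSavart3 L (w (k + 1) (node T N (k + 1 + 1)))) :=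
        (hU _ hk1).1.of_le (by norm_num)
      have hw1 : ∀ s ∈ Ioo (node T N (k + 1)) (node T N (k + 1 + 1)),
          ContDiff ℝ 1 (w (k + 1) s) := fun s hs =>
        (contDiff_slice (hw.smooth _ hk1) (Ioo_subset_Icc_self hs)).of_le (by norm_num)
      have hc1 : ∀ s ∈ Ioo (node T N (k + 1)) (node T N (k + 1 + 1)), Continuous
          (advect (w (k + 1) s) (biotSavart3 L (w (k + 1) (node T N (k + 1 + 1))))) :=
        fun s hs => (hU1.continuous_fderiv one_ne_zero).clm_apply (hw1 s hs).continuous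
      refine ⟨hdiv _ hst, integral_eq_zero_of_frozen (S := fun t x => advect (w (k + 1) t)
        (biotSavart3 L (w (k + 1) (node T N (k + 1 + 1)))) x + curl3 (f t) x)
        (c := σ ^ 2 / 2) hL.le (hlt (k + 1)) hU1 (biotSavart3_periodic hL _) (hU _ hk1).2
        (hw.smooth _ hk1) (hw.periodic _ hk1)
        (fun s hs => (hc1 s hs).add (curl3_continuous (hf1 _ hk1 s hs)))
        (fun s hs => ?_) (fun s hs x => ?_) hm hst⟩
      · rw [integral_add (integrableOn_cell (hc1 s hs))
          (integrableOn_cell (curl3_continuous (hf1 _ hk1 s hs))),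
          integral_advect_eq_zero hL.le (hw1 s hs) hU1
            (hw.periodic _ hk1 s (Ioo_subset_Icc_self hs)) (biotSavart3_periodic hL _)
            (hdiv s (Ioo_subset_Icc_self hs)), zero_add, curl3_eq_diffOp (hf1 _ hk1 s hs)]
        exact integral_diffOp_eq_zero _ hL.le (hf1 _ hk1 s hs) (hf s (hfs _ hk1 s hs)).2
      · exact (heq _ hk1 s hs x).congr_deriv (sub_sub _ _ _)
  intro k hk
  have hU1 : ContDiff ℝ 1 (biotSavart3 L (w k (node T N (k + 1)))) :=
    (hU k hk).1.of_le (by norm_num)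
  obtain ⟨hd, hm⟩ := hmain (N - 1 - k) k (by omega)
  rw [← curl3_eq_diffOp hU1]
  exact curl3_biotSavart3 hL ((contDiff_slice (hw.smooth k hk) (hend k)).of_le (by norm_num))
    (hw.periodic k hk _ (hend k)) hm hd hU1

end Nodes

/-! ### The two dimensions as instances of the abstract estimate -/

section Convergence

variable (L T σ M : ℝ) (hL : 0 < L) (hT : 0 < T)
include hL hT

theorem global_error2 :
    ∃ K : ℝ, ∀ (f : ℝ → E 2 → E 2) (φ : E 2 → E 2) (u : ℝ → E 2 → E 2) (p : ℝ → E 2 → ℝ),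
      (∀ t ∈ Ico 0 T, ContDiff ℝ 2 (f t) ∧ SpacePeriodic L (f t)) →
      IsNSESolution L σ T f φ u p →
      ∀ (N : ℕ), 0 < N → ∀ w : ℕ → ℝ → E 2 → ℝ,
        IsVorticityApprox2 L σ T N f φ w →
        (∀ k < N, ∃ (v : ℝ → E 2 → E 2) (q : ℝ → E 2 → ℝ),
          IsNSESolution L σ (node T N (k + 1)) f
            (biotSavart2 L (w k (node T N (k + 1)))) v q ∧
          DerivativesBoundedBy M (node T N (k + 1)) v) →
        ∀ k < N, ∀ t ∈ Icc (node T N k) (node T N (k + 1)),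
          eLpNorm (fun x => u t x - biotSavart2 L (w k t) x) 2 (volume.restrict (cell 2 L))
            ≤ ENNReal.ofReal (K * (T / N)) := by
  obtain ⟨K, hK⟩ := global_error curlOp2 0 L T σ M hL hT (fun A hA => curlOp2_eq_zero hA)
    (fun A hA => by simpa using curlOp2_comp_self hA) (fun ω A => by simpa using by positivity)
    (biotSavart2 L) (R := 2 * (L / (2 * Real.pi))) (by positivity)
    (fun v ω hv hvp hd hm hω hωp => by
      rw [← curl2_eq_diffOp hv]
      exact (integral_sq_sub_biotSavart2_le hL hv hvp hd hm hω hωp).trans_eq (by ring))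
    (fun ω hω hωp => biotSavart2_continuous hL hω hωp)
  refine ⟨K, fun f φ u p hf hu N hN w hw hsol => ?_⟩
  have hTT : T ∈ Icc 0 T := ⟨hT.le, le_rfl⟩
  have hφ : ContDiff ℝ 3 φ := hu.terminal ▸ hu.contDiff hTT
  have hφp : SpacePeriodic L φ := hu.terminal ▸ hu.periodic T hTT
  refine hK f φ u p (fun t ht => (hf t ht).1) hu N hN w hw.smooth hw.periodic
    (fun k hk t ht x => ?_) ?_ hw.matching
    (curl2_biotSavart2_node hL hT hN hf hφ hφp hw fun k hk => ?_) hsol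
  · have ht0 : t ∈ Ico 0 T :=
      ⟨(node_nonneg hT.le _).trans ht.1.le, ht.2.trans_le (node_le hT.le hN hk)⟩
    have h1 : ContDiff ℝ 1 (f t) := (hf t ht0).1.of_le (by norm_num)
    refine ((hw.equation k hk t (Ioo_subset_Ico_self ht) x).hasDerivAt
      (Icc_mem_nhds ht.1 ht.2)).congr_deriv ?_
    simp [curl2_eq_diffOp h1]
  · rw [hw.terminal, curl2_eq_diffOp (hφ.of_le (by norm_num))]
  -- Smoothness and zero divergence of `U w` at the node are read off from the exact solution of
  -- which it is the terminal value.
  · obtain ⟨v, q, hv, -⟩ := hsol k hk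
    have hend : node T N (k + 1) ∈ Icc 0 (node T N (k + 1)) := ⟨node_nonneg hT.le _, le_rfl⟩
    rw [← hv.terminal]
    exact ⟨hv.contDiff hend, hv.incompressible _ hend⟩

theorem global_error3 :
    ∃ K : ℝ, ∀ (f : ℝ → E 3 → E 3) (φ : E 3 → E 3) (u : ℝ → E 3 → E 3) (p : ℝ → E 3 → ℝ),
      (∀ t ∈ Ico 0 T, ContDiff ℝ 2 (f t) ∧ SpacePeriodic L (f t)) →
      IsNSESolution L σ T f φ u p →
      ∀ (N : ℕ), 0 < N → ∀ w : ℕ → ℝ → E 3 → E 3,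
        IsVorticityApprox3 L σ T N f φ w →
        (∀ k < N, ∃ (v : ℝ → E 3 → E 3) (q : ℝ → E 3 → ℝ),
          IsNSESolution L σ (node T N (k + 1)) f
            (biotSavart3 L (w k (node T N (k + 1)))) v q ∧
          DerivativesBoundedBy M (node T N (k + 1)) v) →
        ∀ k < N, ∀ t ∈ Icc (node T N k) (node T N (k + 1)),
          eLpNorm (fun x => u t x - biotSavart3 L (w k t) x) 2 (volume.restrict (cell 3 L))
            ≤ ENNReal.ofReal (K * (T / N)) := by
  -- The stretching `B ω A` is `A ω`, that is `(ω, ∇)v` for `A = Dv`; `R` is the square root of the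
  -- Biot-Savart constant `4 (L / 2π)²`.
  obtain ⟨K, hK⟩ := global_error curlOp3 (ContinuousLinearMap.apply ℝ (E 3)) L T σ M hL hT
    (fun A hA => curlOp3_eq_zero hA) (fun A hA => curlOp3_comp_self hA)
    (fun ω A => (A.le_opNorm ω).trans_eq (mul_comm _ _))
    (biotSavart3 L) (R := 2 * (L / (2 * Real.pi))) (by positivity)
    (fun v ω hv hvp hd hm hω hωp => by
      rw [← curl3_eq_diffOp hv]
      exact (integral_sq_sub_biotSavart3_le hL hv hvp hd hm hω hωp).trans_eq (by ring))
    (fun ω hω hωp => biotSavart3_continuous hL hω hωp)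
  refine ⟨K, fun f φ u p hf hu N hN w hw hsol => ?_⟩
  have hTT : T ∈ Icc 0 T := ⟨hT.le, le_rfl⟩
  have hφ : ContDiff ℝ 3 φ := hu.terminal ▸ hu.contDiff hTT
  have hφp : SpacePeriodic L φ := hu.terminal ▸ hu.periodic T hTT
  refine hK f φ u p (fun t ht => (hf t ht).1) hu N hN w hw.smooth hw.periodic
    (fun k hk t ht x => ?_) ?_ hw.matching
    (curl3_biotSavart3_node hL hT hN hf hφ hφp hw fun k hk => ?_) hsol
  · have ht0 : t ∈ Ico 0 T :=
      ⟨(node_nonneg hT.le _).trans ht.1.le, ht.2.trans_le (node_le hT.le hN hk)⟩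
    have h1 : ContDiff ℝ 1 (f t) := (hf t ht0).1.of_le (by norm_num)
    rw [← curl3_eq_diffOp h1]
    exact (hw.equation k hk t (Ioo_subset_Ico_self ht) x).hasDerivAt (Icc_mem_nhds ht.1 ht.2)
  · rw [hw.terminal, curl3_eq_diffOp (hφ.of_le (by norm_num))]
  · obtain ⟨v, q, hv, -⟩ := hsol k hk
    have hend : node T N (k + 1) ∈ Icc 0 (node T N (k + 1)) := ⟨node_nonneg hT.le _, le_rfl⟩
    rw [← hv.terminal]
    exact ⟨hv.contDiff hend, hv.incompressible _ hend⟩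

end Convergence

end

end PeriodicNSE

end

open PeriodicNSE in
theorem mainTheorem3 (L T σ M : ℝ) (hL : 0 < L) (hT : 0 < T) (hσ : 0 < σ) :
    (∃ K : ℝ, ∀ (f : ℝ → E 2 → E 2) (φ : E 2 → E 2) (u : ℝ → E 2 → E 2) (p : ℝ → E 2 → ℝ),
      (∀ t ∈ Ico 0 T, ContDiff ℝ 2 (f t) ∧ SpacePeriodic L (f t)) →
      IsNSESolution L σ T f φ u p →
      ∀ (N : ℕ), 0 < N → ∀ w : ℕ → ℝ → E 2 → ℝ,
        IsVorticityApprox2 L σ T N f φ w →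
        (∀ k < N, ∃ (v : ℝ → E 2 → E 2) (q : ℝ → E 2 → ℝ),
          IsNSESolution L σ (node T N (k + 1)) f
            (biotSavart2 L (w k (node T N (k + 1)))) v q ∧
          DerivativesBoundedBy M (node T N (k + 1)) v) →
        ∀ k < N, ∀ t ∈ Icc (node T N k) (node T N (k + 1)),
          eLpNorm (fun x => u t x - biotSavart2 L (w k t) x) 2 (volume.restrict (cell 2 L))
            ≤ ENNReal.ofReal (K * (T / N))) ∧
    (∃ K : ℝ, ∀ (f : ℝ → E 3 → E 3) (φ : E 3 → E 3) (u : ℝ → E 3 → E 3) (p : ℝ → E 3 → ℝ),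
      (∀ t ∈ Ico 0 T, ContDiff ℝ 2 (f t) ∧ SpacePeriodic L (f t)) →
      IsNSESolution L σ T f φ u p →
      ∀ (N : ℕ), 0 < N → ∀ w : ℕ → ℝ → E 3 → E 3,
        IsVorticityApprox3 L σ T N f φ w →
        (∀ k < N, ∃ (v : ℝ → E 3 → E 3) (q : ℝ → E 3 → ℝ),
          IsNSESolution L σ (node T N (k + 1)) f
            (biotSavart3 L (w k (node T N (k + 1)))) v q ∧
          DerivativesBoundedBy M (node T N (k + 1)) v) →
        ∀ k < N, ∀ t ∈ Icc (node T N k) (node T N (k + 1)),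
          eLpNorm (fun x => u t x - biotSavart3 L (w k t) x) 2 (volume.restrict (cell 3 L))
            ≤ ENNReal.ofReal (K * (T / N))) := by
  exact ⟨global_error2 L T σ M hL hT, global_error3 L T σ M hL hT⟩
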